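/- Let $(M^3,\varphi,\xi,\eta,g)$ be a 3-dimensional Sasakian space form of constant $\varphi$-sectional curvature $c>1$; that is, $\varphi^2=-I+\eta\otimes\xi$, $\eta(\xi)=1$, $g(\varphi X,\varphi Y)=g(X,Y)-\eta(X)\eta(Y)$, $g(X,\varphi Y)=d\eta(X,Y)$ with $d\eta(X,Y)=\tfrac12\big(X\eta(Y)-Y\eta(X)-\eta([X,Y])\big)$, $N_\varphi+2\,d\eta\otimes\xi=0$, and every plane spanned by a unit vector $X\perp\xi$ and $\varphi X$ has sectional curvature $c$. Assume that the orbit space $\bar M$ of $\xi$ is a smooth surface such that the projection $\pi:M\to\bar M$ is a smooth submersion; $\bar M$ carries the metric $\bar g$ for which $\pi$ is a Riemannian submersion and the almost complex structure $\bar J$ with $\bar J\circ d\pi=d\pi\circ\varphi$. Let $\bar\gamma$ be a smooth curve in $\bar M$ parametrized by arc length, defined on an open interval (or on a circle, if it is closed). Put $f_1=\bar\gamma'$, $f_2=\bar Jf_1$, let $\bar\kappa=\bar g(\bar\nabla_{f_1}f_1,f_2)$ be its curvature, and let $f_1^H,f_2^H$ be the horizontal lifts (i.e. the lifts orthogonal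 to $\xi$) of $f_1,f_2$. Let $S_{\bar\gamma}=\pi^{-1}(\bar\gamma)$ be the Hopf cylinder over $\bar\gamma$, i.e. the immersed surface $\{(t,x):\bar\gamma(t)=\pi(x)\}$ with the map $\mathbf i(t,x)=x$ to $M$ and the induced metric. Assume that $S_{\bar\gamma}$ is proper-biharmonic, i.e. $\tau_2(\mathbf i)=0$ and $\tau(\mathbf i)\not\equiv0$. Here, for a map $\phi$ into $M$, $\tau(\phi)=\operatorname{trace}\nabla d\phi$ and $\tau_2(\phi)=-\Delta\tau(\phi)-\operatorname{trace}R(d\phi,\tau(\phi))d\phi$, with $-\Delta=\operatorname{trace}\nabla^2$ and $R(X,Y)=[\nabla_X,\nabla_Y]-\nabla_{[X,Y]}$. Let $I$ be a nonempty open interval and $\gamma:I\to S_{\bar\gamma}$ a geodesic of $S_{\bar\gamma}$ parametrized by arc length. Then $\mathbf i\circ\gamma:I\to M$ is proper-biharmonic (that is, $\tau_2(\mathbf i\circ\gamma)=0$ and $\tau(\mathbf i\circ\gamma)\not\equiv0$) if and only if $\gamma'=f_1^H$ on all of $I$ or $\gamma'=-f_1^H$ on all of $I$. Moreover, $\bar\kappa$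 is constant with $\bar\kappa^2=c-1$, and there are real constants $c_1,c_2$ with $c_1^2+c_2^2=1$ such that, along $\gamma$, $$\gamma'=c_1\xi+c_2f_1^H,\qquad \tau(\mathbf i\circ\gamma)=c_2(c_2\bar\kappa-2c_1)\,f_2^H,\qquad \tau_2(\mathbf i\circ\gamma)=2c_1c_2^2(c_2\bar\kappa-2c_1)\,\bar\kappa\, f_2^H .$$ -/

import Mathlib

open scoped Manifold ContDiff Topology

noncomputable section

namespace BiharmonicHopf

/-! ### Riemannian geometry on manifolds modelled on a normed space

All manifolds below have no boundary: they are modelled on `𝓘(ℝ, E)` with `E` finite-dimensional in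
the applications. -/

section Riemannian

variable {E : Type*} [NormedAddCommGroup E] [NormedSpace ℝ E]
  {M : Type*} [TopologicalSpace M] [ChartedSpace E M]
  {E' : Type*} [NormedAddCommGroup E'] [NormedSpace ℝ E']
  {X : Type*} [TopologicalSpace X] [ChartedSpace E' X]

variable (E M) in
/-- A family of (bilinear) forms on the tangent spaces of `M`; used for metric tensors only. -/
abbrev MetricTensor : Type _ :=
  (x : M) → TangentSpace 𝓘(ℝ, E) x → TangentSpace 𝓘(ℝ, E) x → ℝ

/-- The components, in the preferred chart at `x`, of a tangent vector `w` at a point `y` of the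
domain of that chart. -/
def coordComponents [IsManifold 𝓘(ℝ, E) ∞ M] (x y : M) (w : TangentSpace 𝓘(ℝ, E) y) : E :=
  (trivializationAt E (TangentSpace 𝓘(ℝ, E) : M → Type _) x).continuousLinearMapAt ℝ y w

/-- The coordinate vector field with constant components `v` in the preferred chart at `x`, on the
domain of that chart. -/
def coordField [IsManifold 𝓘(ℝ, E) ∞ M] (x : M) (v : E) (y : M) : TangentSpace 𝓘(ℝ, E) y :=
  (trivializationAt E (TangentSpace 𝓘(ℝ, E) : M → Type _) x).symmL ℝ y v

/-- The extension of `u ∈ T_x M` to a vector field with constant components in the preferred chart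
at `x`. -/
def extendVector [IsManifold 𝓘(ℝ, E) ∞ M] (x : M) (u : TangentSpace 𝓘(ℝ, E) x) (y : M) :
    TangentSpace 𝓘(ℝ, E) y :=
  coordField x (coordComponents x x u) y

/-- The derivative `∂_u (g(∂_v, ∂_w))` at `x` in the preferred chart at `x`. -/
def metricDeriv [IsManifold 𝓘(ℝ, E) ∞ M] (g : MetricTensor E M) (x : M)
    (u v w : TangentSpace 𝓘(ℝ, E) x) : ℝ :=
  mvfderiv 𝓘(ℝ, E) (fun y => g y (extendVector x v y) (extendVector x w y)) x u

/-- The Christoffel map `Γ_x(u, v)` of the Levi-Civita connection of `g` in the preferred chart at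
`x`: the unique vector with
`g(Γ(u, v), w) = ½ (∂_u g(∂_v, ∂_w) + ∂_v g(∂_u, ∂_w) - ∂_w g(∂_u, ∂_v))` for all `w`. -/
def christoffel [IsManifold 𝓘(ℝ, E) ∞ M] (g : MetricTensor E M) (x : M)
    (u v : TangentSpace 𝓘(ℝ, E) x) : TangentSpace 𝓘(ℝ, E) x :=
  Classical.epsilon fun z : TangentSpace 𝓘(ℝ, E) x => ∀ w : TangentSpace 𝓘(ℝ, E) x,
    g x z w = (metricDeriv g x u v w + metricDeriv g x v u w - metricDeriv g x w u v) / 2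

/-- The covariant derivative `∇^f_u V` at `p`, for the pull-back along `f : X → M` of the
Levi-Civita connection of `(M, g)`: in coordinates at `f p` it is
`(dV^k(u) + Γ^k_{ij} df(u)^i V^j) ∂_k`. -/
def covAlong [IsManifold 𝓘(ℝ, E) ∞ M] (g : MetricTensor E M) (f : X → M)
    (V : (p : X) → TangentSpace 𝓘(ℝ, E) (f p)) (p : X) (u : TangentSpace 𝓘(ℝ, E') p) :
    TangentSpace 𝓘(ℝ, E) (f p) :=
  coordField (f p)
      (mvfderiv 𝓘(ℝ, E') (fun p' => coordComponents (f p) (f p') (V p')) p u) (f p)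
    + christoffel g (f p) (mfderiv 𝓘(ℝ, E') 𝓘(ℝ, E) f p u) (V p)

/-- The Levi-Civita covariant derivative `(∇_u Y)(x)`, `u ∈ T_x M`. -/
def nabla [IsManifold 𝓘(ℝ, E) ∞ M] (g : MetricTensor E M)
    (Y : (x : M) → TangentSpace 𝓘(ℝ, E) x) (x : M) (u : TangentSpace 𝓘(ℝ, E) x) :
    TangentSpace 𝓘(ℝ, E) x :=
  covAlong g (fun y : M => y) Y x u

/-- `R(X, Y)Z = ∇_X ∇_Y Z - ∇_Y ∇_X Z - ∇_{[X, Y]} Z` at `x`, for vector fields. -/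
def curvatureField [IsManifold 𝓘(ℝ, E) ∞ M] (g : MetricTensor E M)
    (X Y Z : (x : M) → TangentSpace 𝓘(ℝ, E) x) (x : M) : TangentSpace 𝓘(ℝ, E) x :=
  nabla g (fun y => nabla g Z y (Y y)) x (X x) - nabla g (fun y => nabla g Z y (X y)) x (Y x)
    - nabla g Z x (VectorField.mlieBracket 𝓘(ℝ, E) X Y x)

/-- The curvature tensor `R(u, v)w` on tangent vectors at `x`, computed by extending them to
vector fields with constant components in a chart. -/
def curvature [IsManifold 𝓘(ℝ, E) ∞ M] (g : MetricTensor E M) (x : M)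
    (u v w : TangentSpace 𝓘(ℝ, E) x) : TangentSpace 𝓘(ℝ, E) x :=
  curvatureField g (extendVector x u) (extendVector x v) (extendVector x w) x

/-- A `g`-orthonormal basis of the tangent space at `p`. -/
def orthonormalBasisAt (g : MetricTensor E M) (p : M) :
    Fin (Module.finrank ℝ E) → TangentSpace 𝓘(ℝ, E) p :=
  Classical.epsilon fun e : Fin (Module.finrank ℝ E) → TangentSpace 𝓘(ℝ, E) p =>
    ∀ i j, g p (e i) (e j) = if i = j then 1 else 0

/-- The trace with respect to `g` of a bilinear map on the tangent space at `p`. -/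
def metricTrace {V : Type*} [AddCommGroup V] (g : MetricTensor E M) (p : M)
    (b : TangentSpace 𝓘(ℝ, E) p → TangentSpace 𝓘(ℝ, E) p → V) : V :=
  ∑ k, b (orthonormalBasisAt g p k) (orthonormalBasisAt g p k)

/-- The tension field `τ(f) = trace ∇df` of a map `f : (X, h) → (M, g)`, where
`∇df(u, v) = ∇^f_u (df(V)) - df(∇_u V)` for any vector field `V` extending `v`. -/
def tension [IsManifold 𝓘(ℝ, E) ∞ M] [IsManifold 𝓘(ℝ, E') ∞ X]
    (h : MetricTensor E' X) (g : MetricTensor E M) (f : X → M) (p : X) :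
    TangentSpace 𝓘(ℝ, E) (f p) :=
  metricTrace h p fun u v =>
    covAlong g f (fun p' => mfderiv 𝓘(ℝ, E') 𝓘(ℝ, E) f p' (extendVector p v p')) p u
      - mfderiv 𝓘(ℝ, E') 𝓘(ℝ, E) f p (nabla h (extendVector p v) p u)

/-- `-ΔV = trace ∇²V` for a section `V` along `f : (X, h) → (M, g)`, where
`∇²V(u, v) = ∇^f_u (∇^f_W V) - ∇^f_{∇_u W} V` for any vector field `W` extending `v`. -/
def traceHessian [IsManifold 𝓘(ℝ, E) ∞ M] [IsManifold 𝓘(ℝ, E') ∞ X]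
    (h : MetricTensor E' X) (g : MetricTensor E M) (f : X → M)
    (V : (p : X) → TangentSpace 𝓘(ℝ, E) (f p)) (p : X) : TangentSpace 𝓘(ℝ, E) (f p) :=
  metricTrace h p fun u v =>
    covAlong g f (fun p' => covAlong g f V p' (extendVector p v p')) p u
      - covAlong g f V p (nabla h (extendVector p v) p u)

/-- The bitension field `τ₂(f) = -Δτ(f) - trace R(df, τ(f)) df` of `f : (X, h) → (M, g)`. -/
def bitension [IsManifold 𝓘(ℝ, E) ∞ M] [IsManifold 𝓘(ℝ, E') ∞ X]
    (h : MetricTensor E' X) (g : MetricTensor E M) (f : X → M) (p : X) :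
    TangentSpace 𝓘(ℝ, E) (f p) :=
  traceHessian h g f (tension h g f) p
    - metricTrace h p fun u v =>
        curvature g (f p) (mfderiv 𝓘(ℝ, E') 𝓘(ℝ, E) f p u) (tension h g f p)
          (mfderiv 𝓘(ℝ, E') 𝓘(ℝ, E) f p v)

/-- `f : (X, h) → (M, g)` is proper-biharmonic on the open set `U`: it is biharmonic there
(`τ₂(f) = 0`), and it is not harmonic there (`τ(f)` does not vanish identically). -/
def IsProperBiharmonicOn [IsManifold 𝓘(ℝ, E) ∞ M] [IsManifold 𝓘(ℝ, E') ∞ X]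
    (h : MetricTensor E' X) (g : MetricTensor E M) (f : X → M) (U : Set X) : Prop :=
  (∀ p ∈ U, bitension h g f p = 0) ∧ ¬ ∀ p ∈ U, tension h g f p = 0

/-- The metric induced by `f : X → M` from the metric `g` of `M`. -/
def inducedMetric (g : MetricTensor E M) (f : X → M) : MetricTensor E' X :=
  fun p u v => g (f p) (mfderiv 𝓘(ℝ, E') 𝓘(ℝ, E) f p u) (mfderiv 𝓘(ℝ, E') 𝓘(ℝ, E) f p v)

/-- The standard metric `dt²` of the real line. -/
def lineMetric : MetricTensor ℝ ℝ := fun _ (u v : ℝ) => u * v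

/-- The velocity `γ'(s)` of a curve. -/
def velocity (γ : ℝ → M) (s : ℝ) : TangentSpace 𝓘(ℝ, E) (γ s) :=
  mfderiv 𝓘(ℝ, ℝ) 𝓘(ℝ, E) γ s (1 : ℝ)

/-- `γ` restricted to the open set `J` of parameters is a smooth geodesic of `(M, g)` parametrized
by arc length. -/
structure IsUnitSpeedGeodesicOn [IsManifold 𝓘(ℝ, E) ∞ M] (g : MetricTensor E M) (γ : ℝ → M)
    (J : Set ℝ) : Prop where
  smooth : ContMDiffOn 𝓘(ℝ, ℝ) 𝓘(ℝ, E) ∞ γ J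
  unit_speed : ∀ s ∈ J, g (γ s) (velocity γ s) (velocity γ s) = 1
  geodesic : ∀ s ∈ J, covAlong g γ (velocity γ) s (1 : ℝ) = 0

end Riemannian

/-- Smooth Riemannian metrics on a manifold modelled on `E`. -/
abbrev SmoothMetric (E : Type*) [NormedAddCommGroup E] [NormedSpace ℝ E]
    (M : Type*) [TopologicalSpace M] [ChartedSpace E M] [IsManifold 𝓘(ℝ, E) ∞ M] : Type _ :=
  Bundle.ContMDiffRiemannianMetric 𝓘(ℝ, E) ∞ E (TangentSpace 𝓘(ℝ, E) : M → Type _)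

/-- The underlying metric tensor of a smooth Riemannian metric. -/
def SmoothMetric.tensor {E : Type*} [NormedAddCommGroup E] [NormedSpace ℝ E]
    {M : Type*} [TopologicalSpace M] [ChartedSpace E M] [IsManifold 𝓘(ℝ, E) ∞ M]
    (g : SmoothMetric E M) : MetricTensor E M :=
  fun x u v => g.inner x u v

/-! ### Contact metric and Sasakian structures -/

section Contact

variable {E : Type*} [NormedAddCommGroup E] [NormedSpace ℝ E]
  {M : Type*} [TopologicalSpace M] [ChartedSpace E M] [IsManifold 𝓘(ℝ, E) ∞ M]

/-- The vector field `X` is smooth near `x`. -/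
def SmoothFieldAt (X : (x : M) → TangentSpace 𝓘(ℝ, E) x) (x : M) : Prop :=
  ContMDiffAt 𝓘(ℝ, E) 𝓘(ℝ, E).tangent ∞ (fun y => (⟨y, X y⟩ : TangentBundle 𝓘(ℝ, E) M)) x

/-- `dη(X, Y) = ½ (X(η(Y)) - Y(η(X)) - η([X, Y]))` at `x`. -/
def extDeriv₁ (η : (x : M) → TangentSpace 𝓘(ℝ, E) x →L[ℝ] ℝ)
    (X Y : (x : M) → TangentSpace 𝓘(ℝ, E) x) (x : M) : ℝ :=
  (mvfderiv 𝓘(ℝ, E) (fun y => η y (Y y)) x (X x)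
    - mvfderiv 𝓘(ℝ, E) (fun y => η y (X y)) x (Y x)
    - η x (VectorField.mlieBracket 𝓘(ℝ, E) X Y x)) / 2

/-- The Nijenhuis tensor `N_φ(X, Y) = [φX, φY] - φ[φX, Y] - φ[X, φY] + φ²[X, Y]` at `x`. -/
def nijenhuis (φ : (x : M) → TangentSpace 𝓘(ℝ, E) x →L[ℝ] TangentSpace 𝓘(ℝ, E) x)
    (X Y : (x : M) → TangentSpace 𝓘(ℝ, E) x) (x : M) : TangentSpace 𝓘(ℝ, E) x :=
  VectorField.mlieBracket 𝓘(ℝ, E) (fun y => φ y (X y)) (fun y => φ y (Y y)) x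
    - φ x (VectorField.mlieBracket 𝓘(ℝ, E) (fun y => φ y (X y)) Y x)
    - φ x (VectorField.mlieBracket 𝓘(ℝ, E) X (fun y => φ y (Y y)) x)
    + φ x (φ x (VectorField.mlieBracket 𝓘(ℝ, E) X Y x))

/-- `(φ, ξ, η, g)` is a contact metric structure on `M`. -/
structure IsContactMetric
    (φ : (x : M) → TangentSpace 𝓘(ℝ, E) x →L[ℝ] TangentSpace 𝓘(ℝ, E) x)
    (ξ : (x : M) → TangentSpace 𝓘(ℝ, E) x) (η : (x : M) → TangentSpace 𝓘(ℝ, E) x →L[ℝ] ℝ)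
    (g : SmoothMetric E M) : Prop where
  smooth_φ : ContMDiff 𝓘(ℝ, E) (𝓘(ℝ, E).prod 𝓘(ℝ, E →L[ℝ] E)) ∞
    (fun x => Bundle.TotalSpace.mk' (E →L[ℝ] E)
      (E := fun x : M => TangentSpace 𝓘(ℝ, E) x →L[ℝ] TangentSpace 𝓘(ℝ, E) x) x (φ x))
  smooth_ξ : ∀ x, SmoothFieldAt ξ x
  smooth_η : ContMDiff 𝓘(ℝ, E) (𝓘(ℝ, E).prod 𝓘(ℝ, E →L[ℝ] ℝ)) ∞
    (fun x => Bundle.TotalSpace.mk' (E →L[ℝ] ℝ)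
      (E := fun x : M => TangentSpace 𝓘(ℝ, E) x →L[ℝ] Bundle.Trivial M ℝ x) x (η x))
  φ_sq : ∀ x v, φ x (φ x v) = -v + η x v • ξ x
  η_ξ : ∀ x, η x (ξ x) = 1
  compatible : ∀ x u v, g.inner x (φ x u) (φ x v) = g.inner x u v - η x u * η x v
  contact : ∀ (X Y : (x : M) → TangentSpace 𝓘(ℝ, E) x) (x : M),
    SmoothFieldAt X x → SmoothFieldAt Y x → g.inner x (X x) (φ x (Y x)) = extDeriv₁ η X Y x

/-- `(φ, ξ, η, g)` is a Sasakian structure: a contact metric structure that is normal, i.e.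
`N_φ + 2 dη ⊗ ξ = 0`. -/
structure IsSasakian
    (φ : (x : M) → TangentSpace 𝓘(ℝ, E) x →L[ℝ] TangentSpace 𝓘(ℝ, E) x)
    (ξ : (x : M) → TangentSpace 𝓘(ℝ, E) x) (η : (x : M) → TangentSpace 𝓘(ℝ, E) x →L[ℝ] ℝ)
    (g : SmoothMetric E M) : Prop extends IsContactMetric φ ξ η g where
  normal : ∀ (X Y : (x : M) → TangentSpace 𝓘(ℝ, E) x) (x : M),
    SmoothFieldAt X x → SmoothFieldAt Y x →
      nijenhuis φ X Y x + (2 * extDeriv₁ η X Y x) • ξ x = 0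

/-- `(M, φ, ξ, η, g)` is a Sasakian space form `M(c)`: it is Sasakian, and for every unit vector `u`
orthogonal to `ξ` the sectional curvature of the plane spanned by the orthonormal vectors `u`,
`φ u` is `c`. -/
structure IsSasakianSpaceForm
    (φ : (x : M) → TangentSpace 𝓘(ℝ, E) x →L[ℝ] TangentSpace 𝓘(ℝ, E) x)
    (ξ : (x : M) → TangentSpace 𝓘(ℝ, E) x) (η : (x : M) → TangentSpace 𝓘(ℝ, E) x →L[ℝ] ℝ)
    (g : SmoothMetric E M) (c : ℝ) : Prop extends IsSasakian φ ξ η g where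
  φ_sectional : ∀ (x : M) (u : TangentSpace 𝓘(ℝ, E) x),
    g.inner x u u = 1 → g.inner x u (ξ x) = 0 →
      g.inner x (curvature g.tensor x u (φ x u) (φ x u)) u = c

/-- `x` and `y` lie on the same orbit (maximal integral curve) of the vector field `ξ`. -/
def SameOrbit (ξ : (x : M) → TangentSpace 𝓘(ℝ, E) x) (x y : M) : Prop :=
  ∃ (σ : ℝ → M) (J : Set ℝ), IsOpen J ∧ J.OrdConnected ∧ IsMIntegralCurveOn σ ξ J ∧
    ∃ a ∈ J, ∃ b ∈ J, σ a = x ∧ σ b = y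

end Contact

/-! ### The fibration over the orbit space and Hopf cylinders -/

/-- The model space `ℝⁿ`. -/
abbrev Euc (n : ℕ) : Type := EuclideanSpace ℝ (Fin n)

section Hopf

variable {M : Type*} [TopologicalSpace M] [ChartedSpace (Euc 3) M] [IsManifold (𝓡 3) ∞ M]
  {N : Type*} [TopologicalSpace N] [ChartedSpace (Euc 2) N] [IsManifold (𝓡 2) ∞ N]
  {C : Type*} [TopologicalSpace C] [ChartedSpace ℝ C] [IsManifold 𝓘(ℝ, ℝ) ∞ C]
  {S : Type*} [TopologicalSpace S] [ChartedSpace (Euc 2) S] [IsManifold (𝓡 2) ∞ S]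

/-- `π : M → N` is the fibration of the regular contact metric manifold `(M, φ, ξ, η, g)` onto its
orbit space `N`: a surjective smooth submersion whose fibres are the orbits of `ξ`. The orbit space
carries the metric `h` that makes `π` a Riemannian submersion and the almost complex structure `J`
induced by `φ`. -/
structure IsOrbitFibration
    (φ : (x : M) → TangentSpace (𝓡 3) x →L[ℝ] TangentSpace (𝓡 3) x)
    (ξ : (x : M) → TangentSpace (𝓡 3) x) (η : (x : M) → TangentSpace (𝓡 3) x →L[ℝ] ℝ)
    (g : SmoothMetric (Euc 3) M) (h : SmoothMetric (Euc 2) N)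
    (J : (y : N) → TangentSpace (𝓡 2) y →L[ℝ] TangentSpace (𝓡 2) y) (π : M → N) : Prop where
  smooth : ContMDiff (𝓡 3) (𝓡 2) ∞ π
  surjective : Function.Surjective π
  submersion : ∀ x, Function.Surjective (mfderiv (𝓡 3) (𝓡 2) π x)
  fibres : ∀ x y, π x = π y ↔ SameOrbit ξ x y
  isometric : ∀ (x : M) (u v : TangentSpace (𝓡 3) x), η x u = 0 → η x v = 0 →
    h.inner (π x) (mfderiv (𝓡 3) (𝓡 2) π x u) (mfderiv (𝓡 3) (𝓡 2) π x v) = g.inner x u v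
  complex : ∀ (x : M) (v : TangentSpace (𝓡 3) x),
    J (π x) (mfderiv (𝓡 3) (𝓡 2) π x v) = mfderiv (𝓡 3) (𝓡 2) π x (φ x v)

/-- `β : C → N` is a smooth curve parametrized by arc length. Its domain is a 1-manifold `C` with a
smooth vector field `D = d/ds`: an open interval, or a circle if the curve is closed. -/
structure IsArcLengthCurve (h : SmoothMetric (Euc 2) N)
    (D : (t : C) → TangentSpace 𝓘(ℝ, ℝ) t) (β : C → N) : Prop where
  smooth : ContMDiff 𝓘(ℝ, ℝ) (𝓡 2) ∞ β
  smooth_D : ∀ t, SmoothFieldAt D t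
  unit_speed : ∀ t, h.inner (β t) (mfderiv 𝓘(ℝ, ℝ) (𝓡 2) β t (D t))
    (mfderiv 𝓘(ℝ, ℝ) (𝓡 2) β t (D t)) = 1

/-- `f₁ = β'`. -/
def frame₁ (D : (t : C) → TangentSpace 𝓘(ℝ, ℝ) t) (β : C → N) (t : C) :
    TangentSpace (𝓡 2) (β t) :=
  mfderiv 𝓘(ℝ, ℝ) (𝓡 2) β t (D t)

/-- `f₂ = J f₁`. -/
def frame₂ (J : (y : N) → TangentSpace (𝓡 2) y →L[ℝ] TangentSpace (𝓡 2) y)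
    (D : (t : C) → TangentSpace 𝓘(ℝ, ℝ) t) (β : C → N) (t : C) : TangentSpace (𝓡 2) (β t) :=
  J (β t) (frame₁ D β t)

/-- The curvature `κ = h(∇_{f₁} f₁, f₂)` of the arc-length curve `β` in `(N, h, J)`. -/
def curveCurvature (h : SmoothMetric (Euc 2) N)
    (J : (y : N) → TangentSpace (𝓡 2) y →L[ℝ] TangentSpace (𝓡 2) y)
    (D : (t : C) → TangentSpace 𝓘(ℝ, ℝ) t) (β : C → N) (t : C) : ℝ :=
  h.inner (β t) (covAlong h.tensor β (frame₁ D β) t (D t)) (frame₂ J D β t)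

/-- `i : S → M` is the Hopf cylinder `π⁻¹(β)` over the curve `β : C → N`: the surface `S` is the
fibre product `{(t, x) ∈ C × M | β t = π x}`, with projections `q : S → C` and `i : S → M`, and `i`
is an immersion. If `β` is injective, then `i` is injective with image `π⁻¹(β(C))`. -/
structure IsHopfCylinder (π : M → N) (β : C → N) (q : S → C) (i : S → M) : Prop where
  smooth_q : ContMDiff (𝓡 2) 𝓘(ℝ, ℝ) ∞ q
  smooth_i : ContMDiff (𝓡 2) (𝓡 3) ∞ i
  immersion : ∀ p, Function.Injective (mfderiv (𝓡 2) (𝓡 3) i p)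
  comm : ∀ p, β (q p) = π (i p)
  fibre_product : ∀ (t : C) (x : M), β t = π x → ∃! p, q p = t ∧ i p = x

/-- The horizontal lift to `x` of a tangent vector `w` of `N` at the point `π x`: the unique
`v ∈ T_x M` with `η(v) = 0` and `dπ(v) = w`. -/
def horizontalLift (η : (x : M) → TangentSpace (𝓡 3) x →L[ℝ] ℝ) (π : M → N) (x : M)
    (w : TangentBundle (𝓡 2) N) : TangentSpace (𝓡 3) x :=
  Classical.epsilon fun v : TangentSpace (𝓡 3) x =>
    η x v = 0 ∧ (⟨π x, mfderiv (𝓡 3) (𝓡 2) π x v⟩ : TangentBundle (𝓡 2) N) = w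

/-- The horizontal lift `f₁ᴴ` of `f₁ = β'` along the Hopf cylinder. -/
def lift₁ (η : (x : M) → TangentSpace (𝓡 3) x →L[ℝ] ℝ) (π : M → N)
    (D : (t : C) → TangentSpace 𝓘(ℝ, ℝ) t) (β : C → N) (q : S → C) (i : S → M) (p : S) :
    TangentSpace (𝓡 3) (i p) :=
  horizontalLift η π (i p) ⟨β (q p), frame₁ D β (q p)⟩

/-- The horizontal lift `f₂ᴴ` of `f₂ = J β'` along the Hopf cylinder. -/
def lift₂ (η : (x : M) → TangentSpace (𝓡 3) x →L[ℝ] ℝ) (π : M → N)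
    (J : (y : N) → TangentSpace (𝓡 2) y →L[ℝ] TangentSpace (𝓡 2) y)
    (D : (t : C) → TangentSpace 𝓘(ℝ, ℝ) t) (β : C → N) (q : S → C) (i : S → M) (p : S) :
    TangentSpace (𝓡 3) (i p) :=
  horizontalLift η π (i p) ⟨β (q p), frame₂ J D β (q p)⟩

end Hopf

end BiharmonicHopf

end

/-! Write e for the horizontal lift of the unit tangent of the base curve. Along the Hopf cylinder
the triple e, φe, ξ is an orthonormal frame of the ambient manifold; e and ξ are tangent to the
surface and φe is its normal. Three facts determine all derivatives of this frame: ∇_u ξ = -φu, the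
preservation of horizontal covariant derivatives by a Riemannian submersion up to vertical terms,
and the symmetry of the second fundamental form. With κ the curvature of the base curve, the
derivatives of e, φe, ξ in the direction e are κφe, -κe + ξ, -φe, and in the direction ξ they are
-φe, e, 0 (`IsHopfFrame.covAlong_e`, `IsHopfFrame.covAlong_φ_e`, `IsHopfFrame.covAlong_ξ`).

The derivatives of the two tangent fields are normal, so both fields are parallel on the surface.
Hence the cylinder is flat, and a geodesic has constant components c₂, c₁ on e, ξ. The tension of
the cylinder is κφe. The tangential components of its bitension force dκ = 0, and the normal one
then gives κ(κ² - (c - 1)) = 0 (`IsHopfFrame.curvature_of_biharmonic`). A continuous function on a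
connected curve with values among finitely many roots is constant; the root 0 is excluded because
the cylinder is not harmonic.

With κ constant, differentiation along the geodesic acts on the frame by a constant matrix. It gives
∇_T T = Aφe with A = c₂(c₂κ - 2c₁), and ∇_T∇_T(φe) = -((c₂κ - c₁)² + c₂²)φe. The Sasakian curvature
gives R(T, φe)T = -(c₁² + c c₂²)φe. With κ² = c - 1 these add up to τ₂ = 2c₁c₂κAφe. If A ≠ 0 then c₂
≠ 0, and κ ≠ 0 because c > 1, so τ₂ vanishes only for c₁ = 0, that is c₂ = ±1.

The connection is defined pointwise, in the preferred chart at each point, and trace frames and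
lifts are arbitrary choices. The calculus is therefore built up first: `SmoothAlongNear.induction`
reduces statements about fields to coordinate fields, the Koszul formula in one fixed chart gives
smoothness of covariant derivatives, and `covAlong_bundleMap_eq` and `metricTrace_eq_sum` make
traces computable in any orthonormal frame of geodesic fields. -/

namespace BiharmonicHopf

open Filter

set_option linter.unusedSectionVars false

/-! ### Coordinate components and smooth vector fields along maps -/

section Coordinates

variable {E : Type*} [NormedAddCommGroup E] [NormedSpace ℝ E]
  {M : Type*} [TopologicalSpace M] [ChartedSpace E M] [IsManifold 𝓘(ℝ, E) ∞ M]
  {E' : Type*} [NormedAddCommGroup E'] [NormedSpace ℝ E']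
  {X : Type*} [TopologicalSpace X] [ChartedSpace E' X]
  {E'' : Type*} [NormedAddCommGroup E''] [NormedSpace ℝ E'']
  {Y : Type*} [TopologicalSpace Y] [ChartedSpace E'' Y]

lemma coordField_coordComponents {x y : M} (hy : y ∈ (chartAt E x).source)
    (w : TangentSpace 𝓘(ℝ, E) y) : coordField x (coordComponents x y w) y = w :=
  Bundle.Trivialization.symmL_continuousLinearMapAt _ (R := ℝ) hy w

lemma coordComponents_coordField {x y : M} (hy : y ∈ (chartAt E x).source) (v : E) :
    coordComponents x y (coordField x v y) = v :=
  Bundle.Trivialization.continuousLinearMapAt_symmL _ (R := ℝ) hy v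

lemma coordField_add (x y : M) (v w : E) :
    coordField x (v + w) y = coordField x v y + coordField x w y := map_add _ _ _

lemma coordField_smul (x y : M) (a : ℝ) (v : E) :
    coordField x (a • v) y = a • coordField x v y := map_smul _ _ _

lemma coordField_sum {ι : Type*} (s : Finset ι) (x y : M) (v : ι → E) :
    coordField x (∑ k ∈ s, v k) y = ∑ k ∈ s, coordField x (v k) y := map_sum _ _ _

lemma coordComponents_add (x y : M) (v w : TangentSpace 𝓘(ℝ, E) y) :
    coordComponents x y (v + w) = coordComponents x y v + coordComponents x y w := map_add _ _ _

lemma coordComponents_smul (x y : M) (a : ℝ) (v : TangentSpace 𝓘(ℝ, E) y) :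
    coordComponents x y (a • v) = a • coordComponents x y v := map_smul _ _ _

lemma extendVector_self (x : M) (u : TangentSpace 𝓘(ℝ, E) x) : extendVector x u x = u :=
  coordField_coordComponents (mem_chart_source E x) u

lemma coordComponents_eq_snd {x y : M} (hy : y ∈ (chartAt E x).source)
    (w : TangentSpace 𝓘(ℝ, E) y) : coordComponents x y w =
      (trivializationAt E (TangentSpace 𝓘(ℝ, E) : M → Type _) x
        (⟨y, w⟩ : TangentBundle 𝓘(ℝ, E) M)).2 := by
  have hy' : y ∈ (trivializationAt E (TangentSpace 𝓘(ℝ, E) : M → Type _) x).baseSet := hy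
  exact congrFun (Bundle.Trivialization.coe_linearMapAt_of_mem (R := ℝ) _ hy') w

variable (E') in
/-- Smoothness at `p` of a vector field `V` along a map `f`. -/
def SmoothAlongAt (f : X → M) (V : (p : X) → TangentSpace 𝓘(ℝ, E) (f p)) (p : X) : Prop :=
  ContMDiffAt 𝓘(ℝ, E') 𝓘(ℝ, E).tangent ∞ (fun p => (⟨f p, V p⟩ : TangentBundle 𝓘(ℝ, E) M)) p

variable {f : X → M} {V W : (p : X) → TangentSpace 𝓘(ℝ, E) (f p)} {p : X}

omit [IsManifold 𝓘(ℝ, E) ∞ M] in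
lemma ContMDiffAt.eventually_mem_source (hf : ContMDiffAt 𝓘(ℝ, E') 𝓘(ℝ, E) ∞ f p) {x₀ : M}
    (h : f p ∈ (chartAt E x₀).source) : ∀ᶠ p' in 𝓝 p, f p' ∈ (chartAt E x₀).source :=
  hf.continuousAt.eventually_mem ((chartAt E x₀).open_source.mem_nhds h)

/-- The base point x₀ is free: the chart may stay fixed while the point moves, which the preferred
chart at `f p` does not allow. -/
lemma smoothAlongAt_iff (x₀ : M) (h : f p ∈ (chartAt E x₀).source) :
    SmoothAlongAt E' f V p ↔ ContMDiffAt 𝓘(ℝ, E') 𝓘(ℝ, E) ∞ f p ∧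
      ContMDiffAt 𝓘(ℝ, E') 𝓘(ℝ, E) ∞ (fun p' => coordComponents x₀ (f p') (V p')) p := by
  unfold SmoothAlongAt
  have he : (⟨f p, V p⟩ : TangentBundle 𝓘(ℝ, E) M) ∈
      (trivializationAt E (TangentSpace 𝓘(ℝ, E) : M → Type _) x₀).source := by
    rw [Bundle.Trivialization.mem_source]; exact h
  refine (Bundle.Trivialization.contMDiffAt_iff (n := ∞) (IB := 𝓘(ℝ, E)) (IM := 𝓘(ℝ, E'))
    (f := fun p => (⟨f p, V p⟩ : TangentBundle 𝓘(ℝ, E) M)) he).trans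
    (and_congr_right fun hf => ?_)
  apply Filter.EventuallyEq.contMDiffAt_iff
  filter_upwards [ContMDiffAt.eventually_mem_source hf h] with p' hp'
  exact (coordComponents_eq_snd hp' _).symm

lemma SmoothAlongAt.contMDiffAt (h : SmoothAlongAt E' f V p) :
    ContMDiffAt 𝓘(ℝ, E') 𝓘(ℝ, E) ∞ f p :=
  ((smoothAlongAt_iff (f p) (mem_chart_source E _)).1 h).1

lemma SmoothAlongAt.components (h : SmoothAlongAt E' f V p) (x₀ : M)
    (hx : f p ∈ (chartAt E x₀).source) :
    ContMDiffAt 𝓘(ℝ, E') 𝓘(ℝ, E) ∞ (fun p' => coordComponents x₀ (f p') (V p')) p :=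
  ((smoothAlongAt_iff x₀ hx).1 h).2

lemma SmoothAlongAt.congr (h : SmoothAlongAt E' f V p) (hVW : ∀ᶠ p' in 𝓝 p, V p' = W p') :
    SmoothAlongAt E' f W p :=
  ContMDiffAt.congr_of_eventuallyEq h (hVW.mono fun p' hp => by simp only [hp])

lemma SmoothAlongAt.add (hV : SmoothAlongAt E' f V p) (hW : SmoothAlongAt E' f W p) :
    SmoothAlongAt E' f (fun p => V p + W p) p := by
  rw [smoothAlongAt_iff (f p) (mem_chart_source E _)] at *
  refine ⟨hV.1, ?_⟩
  simp only [coordComponents_add]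
  exact hV.2.add hW.2

lemma SmoothAlongAt.smul {a : X → ℝ} (ha : ContMDiffAt 𝓘(ℝ, E') 𝓘(ℝ, ℝ) ∞ a p)
    (hV : SmoothAlongAt E' f V p) : SmoothAlongAt E' f (fun p => a p • V p) p := by
  rw [smoothAlongAt_iff (f p) (mem_chart_source E _)] at *
  refine ⟨hV.1, ?_⟩
  simp only [coordComponents_smul]
  exact ha.smul hV.2

lemma SmoothAlongAt.neg (hV : SmoothAlongAt E' f V p) : SmoothAlongAt E' f (fun p => -V p) p := by
  have := SmoothAlongAt.smul (a := fun _ => (-1 : ℝ)) contMDiffAt_const hV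
  simpa using this

lemma SmoothAlongAt.sub (hV : SmoothAlongAt E' f V p) (hW : SmoothAlongAt E' f W p) :
    SmoothAlongAt E' f (fun p => V p - W p) p := by
  simpa only [sub_eq_add_neg] using hV.add hW.neg

lemma SmoothAlongAt.comp {k : Y → X} {s : Y} (hV : SmoothAlongAt E' f V (k s))
    (hk : ContMDiffAt 𝓘(ℝ, E'') 𝓘(ℝ, E') ∞ k s) :
    SmoothAlongAt E'' (fun s => f (k s)) (fun s => V (k s)) s :=
  ContMDiffAt.comp (g := fun p => (⟨f p, V p⟩ : TangentBundle 𝓘(ℝ, E) M)) s hV hk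

lemma smoothAlongAt_coordField {x₀ y : M} (hy : y ∈ (chartAt E x₀).source) (v : E) :
    SmoothAlongAt E (fun y : M => y) (coordField x₀ v) y := by
  rw [smoothAlongAt_iff x₀ hy]
  refine ⟨contMDiffAt_id, ?_⟩
  refine (contMDiffAt_const (c := v)).congr_of_eventuallyEq ?_
  filter_upwards [(chartAt E x₀).open_source.mem_nhds hy] with z hz
  exact coordComponents_coordField hz v

lemma eventually_smoothAlongAt_coordField {x₀ y : M} (hy : y ∈ (chartAt E x₀).source) (v : E) :
    ∀ᶠ z in 𝓝 y, SmoothAlongAt E (fun y : M => y) (coordField x₀ v) z := by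
  filter_upwards [(chartAt E x₀).open_source.mem_nhds hy] with z hz
  exact smoothAlongAt_coordField hz v

lemma eventually_smoothAlongAt_extendVector (x : M) (u : TangentSpace 𝓘(ℝ, E) x) :
    ∀ᶠ z in 𝓝 x, SmoothAlongAt E (fun y : M => y) (extendVector x u) z :=
  eventually_smoothAlongAt_coordField (mem_chart_source E x) _

/-- Local expansion of a field along a map in the coordinate fields of a chart. -/
lemma eq_sum_coordField [FiniteDimensional ℝ E] {x₀ y : M} (hy : y ∈ (chartAt E x₀).source)
    (w : TangentSpace 𝓘(ℝ, E) y) :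
    w = ∑ k, (Module.finBasis ℝ E).repr (coordComponents x₀ y w) k •
      coordField x₀ (Module.finBasis ℝ E k) y := by
  conv_lhs => rw [← coordField_coordComponents hy w,
    ← (Module.finBasis ℝ E).sum_repr (coordComponents x₀ y w)]
  simp only [coordField_sum, coordField_smul]

lemma SmoothAlongAt.repr_components [FiniteDimensional ℝ E] (h : SmoothAlongAt E' f V p) (x₀ : M)
    (hx : f p ∈ (chartAt E x₀).source) (k : Fin (Module.finrank ℝ E)) :
    ContMDiffAt 𝓘(ℝ, E') 𝓘(ℝ, ℝ) ∞
      (fun p' => (Module.finBasis ℝ E).repr (coordComponents x₀ (f p') (V p')) k) p := by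
  have h1 := h.components x₀ hx
  let L : E →L[ℝ] ℝ := LinearMap.toContinuousLinearMap ((Module.finBasis ℝ E).coord k)
  exact (L.contMDiff.contMDiffAt (x := coordComponents x₀ (f p) (V p))).comp p h1

end Coordinates

/-! ### Push-forwards, partial derivatives in a chart, brackets of coordinate fields -/

section Derivatives

variable {E : Type*} [NormedAddCommGroup E] [NormedSpace ℝ E]
  {M : Type*} [TopologicalSpace M] [ChartedSpace E M] [IsManifold 𝓘(ℝ, E) ∞ M]
  {E' : Type*} [NormedAddCommGroup E'] [NormedSpace ℝ E']
  {X : Type*} [TopologicalSpace X] [ChartedSpace E' X] [IsManifold 𝓘(ℝ, E') ∞ X]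
  {E'' : Type*} [NormedAddCommGroup E''] [NormedSpace ℝ E'']
  {Y : Type*} [TopologicalSpace Y] [ChartedSpace E'' Y]
  {G : Type*} [NormedAddCommGroup G] [NormedSpace ℝ G]

/-- The push-forward under `f` of a smooth field along `k` is a smooth field along `f ∘ k`. -/
lemma SmoothAlongAt.pushforward {f : X → M} {k : Y → X} {A : (s : Y) → TangentSpace 𝓘(ℝ, E') (k s)}
    {s : Y} (hf : ContMDiffAt 𝓘(ℝ, E') 𝓘(ℝ, E) ∞ f (k s)) (hA : SmoothAlongAt E'' k A s) :
    SmoothAlongAt E'' (fun s => f (k s))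
      (fun s => mfderiv 𝓘(ℝ, E') 𝓘(ℝ, E) f (k s) (A s)) s := by
  have h1 := (hf.mfderiv_const (m := ∞) (by simp)).comp s hA.contMDiffAt
  exact ContMDiffAt.clm_apply_of_inCoordinates (b₁ := k) (b₂ := fun s => f (k s))
    (ϕ := fun s => mfderiv 𝓘(ℝ, E') 𝓘(ℝ, E) f (k s)) (v := A) h1 hA (hf.comp s hA.contMDiffAt)

lemma smoothAlongAt_modelSpace_iff {f : Y → E} {V : (p : Y) → TangentSpace 𝓘(ℝ, E) (f p)} {p : Y} :
    SmoothAlongAt E'' f V p ↔ ContMDiffAt 𝓘(ℝ, E'') 𝓘(ℝ, E) ∞ f p ∧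
      ContMDiffAt 𝓘(ℝ, E'') 𝓘(ℝ, E) ∞ (fun p' => (V p' : E)) p := by
  rw [smoothAlongAt_iff (f p) (mem_chart_source E _)]
  simp only [coordComponents, TangentBundle.continuousLinearMapAt_model_space]
  exact Iff.rfl

/-- The derivative of a smooth function along a smooth field is smooth. -/
lemma SmoothAlongAt.contMDiffAt_mvfderiv {F : X → G} {k : Y → X}
    {A : (s : Y) → TangentSpace 𝓘(ℝ, E') (k s)} {s : Y}
    (hF : ContMDiffAt 𝓘(ℝ, E') 𝓘(ℝ, G) ∞ F (k s)) (hA : SmoothAlongAt E'' k A s) :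
    ContMDiffAt 𝓘(ℝ, E'') 𝓘(ℝ, G) ∞ (fun s => mvfderiv 𝓘(ℝ, E') F (k s) (A s)) s := by
  have h := SmoothAlongAt.pushforward hF hA
  exact (smoothAlongAt_modelSpace_iff.1 h).2

lemma coordField_eq_mfderiv {x y : M} (hy : y ∈ (chartAt E x).source) (v : E) :
    coordField x v y = mfderiv 𝓘(ℝ, E) 𝓘(ℝ, E) (extChartAt 𝓘(ℝ, E) x).symm
      (extChartAt 𝓘(ℝ, E) x y) v := by
  unfold coordField
  rw [TangentBundle.symmL_trivializationAt hy]
  simp only [modelWithCornersSelf_coe, Set.range_id, mfderivWithin_univ]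
  rfl

lemma coordComponents_eq_mvfderiv {x y : M} (hy : y ∈ (chartAt E x).source)
    (w : TangentSpace 𝓘(ℝ, E) y) :
    coordComponents x y w = mvfderiv 𝓘(ℝ, E) (extChartAt 𝓘(ℝ, E) x) y w := by
  unfold coordComponents
  rw [TangentBundle.continuousLinearMapAt_trivializationAt hy]
  rfl

lemma mdifferentiableAt_symm {x y : M} (hy : y ∈ (chartAt E x).source) :
    MDifferentiableAt 𝓘(ℝ, E) 𝓘(ℝ, E) (extChartAt 𝓘(ℝ, E) x).symm (extChartAt 𝓘(ℝ, E) x y) := by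
  have := (contMDiffOn_extChartAt_symm (I := 𝓘(ℝ, E)) (n := ∞) x).contMDiffAt
    ((isOpen_extChartAt_target x).mem_nhds ((extChartAt 𝓘(ℝ, E) x).map_source (by simpa using hy)))
  exact this.mdifferentiableAt (by simp)

/-- In a chart, the derivative along a coordinate field is a partial derivative. -/
lemma mvfderiv_coordField {F : M → G} {x y : M} (hy : y ∈ (chartAt E x).source)
    (hF : MDifferentiableAt 𝓘(ℝ, E) 𝓘(ℝ, G) F y) (v : E) :
    mvfderiv 𝓘(ℝ, E) F y (coordField x v y) =
      fderiv ℝ (F ∘ (extChartAt 𝓘(ℝ, E) x).symm) (extChartAt 𝓘(ℝ, E) x y) v := by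
  have hs : (extChartAt 𝓘(ℝ, E) x).symm (extChartAt 𝓘(ℝ, E) x y) = y :=
    (extChartAt 𝓘(ℝ, E) x).left_inv (by simpa using hy)
  have hc := mfderiv_comp_of_eq (x := extChartAt 𝓘(ℝ, E) x y) hF (mdifferentiableAt_symm hy) hs
  rw [mfderiv_eq_fderiv] at hc
  rw [hc, coordField_eq_mfderiv hy]
  simp only [mvfderiv]
  conv_rhs => rw [hs]
  rfl

lemma contDiffAt_comp_symm {F : M → G} {x y : M} (hy : y ∈ (chartAt E x).source)
    (hF : ContMDiffAt 𝓘(ℝ, E) 𝓘(ℝ, G) ∞ F y) :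
    ContDiffAt ℝ ∞ (F ∘ (extChartAt 𝓘(ℝ, E) x).symm) (extChartAt 𝓘(ℝ, E) x y) := by
  have hs : (extChartAt 𝓘(ℝ, E) x).symm (extChartAt 𝓘(ℝ, E) x y) = y :=
    (extChartAt 𝓘(ℝ, E) x).left_inv (by simpa using hy)
  rw [← contMDiffAt_iff_contDiffAt]
  refine ContMDiffAt.comp_of_eq hF ?_ hs
  exact (contMDiffOn_extChartAt_symm (I := 𝓘(ℝ, E)) (n := ∞) x).contMDiffAt
    ((isOpen_extChartAt_target x).mem_nhds ((extChartAt 𝓘(ℝ, E) x).map_source (by simpa using hy)))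

/-- Derivatives along coordinate fields of one chart commute. -/
lemma mvfderiv_coordField_comm {F : M → G} {x y : M} (hy : y ∈ (chartAt E x).source)
    (hF : ∀ᶠ z in 𝓝 y, ContMDiffAt 𝓘(ℝ, E) 𝓘(ℝ, G) ∞ F z) (v w : E) :
    mvfderiv 𝓘(ℝ, E) (fun z => mvfderiv 𝓘(ℝ, E) F z (coordField x w z)) y (coordField x v y) =
    mvfderiv 𝓘(ℝ, E) (fun z => mvfderiv 𝓘(ℝ, E) F z (coordField x v z)) y (coordField x w y) := by
  have hs : (extChartAt 𝓘(ℝ, E) x).symm (extChartAt 𝓘(ℝ, E) x y) = y :=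
    (extChartAt 𝓘(ℝ, E) x).left_inv (by simpa using hy)
  set c := extChartAt 𝓘(ℝ, E) x with hcdef
  have hcont : ContinuousAt c.symm (c y) := (mdifferentiableAt_symm hy).continuousAt
  have hsm := contDiffAt_comp_symm hy hF.self_of_nhds
  have key : ∀ v w : E,
      mvfderiv 𝓘(ℝ, E) (fun z => mvfderiv 𝓘(ℝ, E) F z (coordField x w z)) y (coordField x v y) =
      fderiv ℝ (fderiv ℝ (F ∘ c.symm)) (c y) v w := by
    intro v w
    have h1 : ContMDiffAt 𝓘(ℝ, E) 𝓘(ℝ, G) ∞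
        (fun z => mvfderiv 𝓘(ℝ, E) F z (coordField x w z)) y :=
      (smoothAlongAt_coordField hy w).contMDiffAt_mvfderiv hF.self_of_nhds
    rw [mvfderiv_coordField hy (h1.mdifferentiableAt (by simp))]
    have h2 : (fun z => mvfderiv 𝓘(ℝ, E) F z (coordField x w z)) ∘ c.symm =ᶠ[𝓝 (c y)]
        fun e => fderiv ℝ (F ∘ c.symm) e w := by
      have h3 : ∀ᶠ z in 𝓝 (c.symm (c y)), z ∈ (chartAt E x).source ∧
          ContMDiffAt 𝓘(ℝ, E) 𝓘(ℝ, G) ∞ F z := by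
        rw [hs]; exact Filter.Eventually.and ((chartAt E x).open_source.mem_nhds hy) hF
      have h4 : ∀ᶠ e in 𝓝 (c y), e ∈ c.target := (isOpen_extChartAt_target x).mem_nhds
        (c.map_source (by simpa [hcdef] using hy))
      filter_upwards [hcont.eventually h3, h4] with e he he'
      simp only [Function.comp]
      rw [mvfderiv_coordField he.1 (he.2.mdifferentiableAt (by simp)), ← hcdef, c.right_inv he']
    rw [h2.fderiv_eq]
    have h5 : DifferentiableAt ℝ (fderiv ℝ (F ∘ c.symm)) (c y) :=
      (hsm.fderiv_right (m := 1) (by norm_cast)).differentiableAt (by simp)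
    rw [fderiv_clm_apply h5 (differentiableAt_const w)]
    simp
  rw [key, key]
  exact hsm.isSymmSndFDerivAt (by simp only [minSmoothness_of_isRCLikeNormedField]; exact WithTop.coe_le_coe.2 le_top) v w

/-- Pulled back by the inverse chart, coordinate fields become constant, and constant fields
commute. -/
lemma mlieBracket_coordField (x : M) (v w : E) :
    VectorField.mlieBracket 𝓘(ℝ, E) (coordField x v) (coordField x w) x = 0 := by
  have key : ∀ v : E, VectorField.mpullbackWithin 𝓘(ℝ, E) 𝓘(ℝ, E) (extChartAt 𝓘(ℝ, E) x).symm
      (coordField x v) (Set.range 𝓘(ℝ, E)) =ᶠ[𝓝 (extChartAt 𝓘(ℝ, E) x x)] fun _ => v := by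
    intro v
    filter_upwards [(isOpen_extChartAt_target (I := 𝓘(ℝ, E)) x).mem_nhds
      (mem_extChartAt_target x)] with e he
    have h1 := isInvertible_mfderivWithin_extChartAt_symm he
    have h2 : (extChartAt 𝓘(ℝ, E) x).symm e ∈ (chartAt E x).source := by
      simpa using (extChartAt 𝓘(ℝ, E) x).map_target he
    have h3 : coordField x v ((extChartAt 𝓘(ℝ, E) x).symm e) =
        mfderivWithin 𝓘(ℝ, E) 𝓘(ℝ, E) (extChartAt 𝓘(ℝ, E) x).symm (Set.range 𝓘(ℝ, E)) e v := by
      unfold coordField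
      rw [TangentBundle.symmL_trivializationAt h2, (extChartAt 𝓘(ℝ, E) x).right_inv he]
      rfl
    simp only [VectorField.mpullbackWithin]
    rw [h3]
    exact h1.inverse_apply_eq.2 rfl
  rw [VectorField.mlieBracket, VectorField.mlieBracketWithin_apply,
    Filter.EventuallyEq.lieBracketWithin_vectorField_eq_nhds (key v) (key w),
    VectorField.lieBracketWithin_eq]
  simp only [fderivWithin_fun_const, Pi.zero_apply, zero_apply, sub_self]
  exact map_zero _

lemma mlieBracket_extendVector (x : M) (u v : TangentSpace 𝓘(ℝ, E) x) :
    VectorField.mlieBracket 𝓘(ℝ, E) (extendVector x u) (extendVector x v) x = 0 :=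
  mlieBracket_coordField x _ _

end Derivatives

/-! ### Riemannian metric tensors -/

section Metric

variable {E : Type*} [NormedAddCommGroup E] [NormedSpace ℝ E]
  {M : Type*} [TopologicalSpace M] [ChartedSpace E M] [IsManifold 𝓘(ℝ, E) ∞ M]
  {E' : Type*} [NormedAddCommGroup E'] [NormedSpace ℝ E']
  {X : Type*} [TopologicalSpace X] [ChartedSpace E' X] [IsManifold 𝓘(ℝ, E') ∞ X]
  {E'' : Type*} [NormedAddCommGroup E''] [NormedSpace ℝ E'']
  {Y : Type*} [TopologicalSpace Y] [ChartedSpace E'' Y]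

instance finiteDimensional_tangentSpace [FiniteDimensional ℝ E] (x : M) :
    FiniteDimensional ℝ (TangentSpace 𝓘(ℝ, E) x) := inferInstanceAs (FiniteDimensional ℝ E)

/-- `g` is a smooth Riemannian metric tensor. -/
structure IsRiemannian (g : MetricTensor E M) : Prop where
  add_left : ∀ x u v w, g x (u + v) w = g x u w + g x v w
  smul_left : ∀ x (a : ℝ) u v, g x (a • u) v = a * g x u v
  symm : ∀ x u v, g x u v = g x v u
  pos : ∀ x u, u ≠ 0 → 0 < g x u u
  smooth : ∀ x v w, ∀ y ∈ (chartAt E x).source, ContMDiffAt 𝓘(ℝ, E) 𝓘(ℝ, ℝ) ∞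
    (fun y => g y (coordField x v y) (coordField x w y)) y

namespace IsRiemannian

variable {g : MetricTensor E M} (hg : IsRiemannian g) {x : M}
include hg

lemma add_right (u v w : TangentSpace 𝓘(ℝ, E) x) : g x u (v + w) = g x u v + g x u w := by
  rw [hg.symm, hg.add_left, hg.symm x v, hg.symm x w]

lemma smul_right (a : ℝ) (u v : TangentSpace 𝓘(ℝ, E) x) : g x u (a • v) = a * g x u v := by
  rw [hg.symm, hg.smul_left, hg.symm]

lemma zero_left (v : TangentSpace 𝓘(ℝ, E) x) : g x 0 v = 0 := by
  simpa using hg.smul_left x 0 0 v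

lemma zero_right (v : TangentSpace 𝓘(ℝ, E) x) : g x v 0 = 0 := by
  rw [hg.symm, hg.zero_left]

lemma neg_left (u v : TangentSpace 𝓘(ℝ, E) x) : g x (-u) v = -g x u v := by
  simpa using hg.smul_left x (-1) u v

lemma neg_right (u v : TangentSpace 𝓘(ℝ, E) x) : g x u (-v) = -g x u v := by
  rw [hg.symm, hg.neg_left, hg.symm]

lemma sub_left (u v w : TangentSpace 𝓘(ℝ, E) x) : g x (u - v) w = g x u w - g x v w := by
  rw [sub_eq_add_neg, hg.add_left, hg.neg_left, sub_eq_add_neg]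

lemma sub_right (u v w : TangentSpace 𝓘(ℝ, E) x) : g x u (v - w) = g x u v - g x u w := by
  rw [sub_eq_add_neg, hg.add_right, hg.neg_right, sub_eq_add_neg]

lemma sum_left {ι : Type*} (s : Finset ι) (u : ι → TangentSpace 𝓘(ℝ, E) x)
    (v : TangentSpace 𝓘(ℝ, E) x) : g x (∑ k ∈ s, u k) v = ∑ k ∈ s, g x (u k) v := by
  classical
  induction s using Finset.induction_on with
  | empty => simp [hg.zero_left]
  | insert a s ha ih => rw [Finset.sum_insert ha, hg.add_left, ih, Finset.sum_insert ha]

lemma sum_right {ι : Type*} (s : Finset ι) (u : ι → TangentSpace 𝓘(ℝ, E) x)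
    (v : TangentSpace 𝓘(ℝ, E) x) : g x v (∑ k ∈ s, u k) = ∑ k ∈ s, g x v (u k) := by
  rw [hg.symm, hg.sum_left]
  exact Finset.sum_congr rfl fun k _ => hg.symm x _ _

lemma eq_zero_of_self {u : TangentSpace 𝓘(ℝ, E) x} (h : g x u u = 0) : u = 0 := by
  by_contra hu
  exact (hg.pos x u hu).ne' h

lemma eq_of_forall {u v : TangentSpace 𝓘(ℝ, E) x} (h : ∀ w, g x u w = g x v w) : u = v := by
  rw [← sub_eq_zero]
  apply hg.eq_zero_of_self
  rw [hg.sub_left, h, sub_self]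

/-- Definiteness makes u ↦ g(u, ·) injective into the dual, hence surjective by dimension. This is
the existence needed for the vector chosen in `christoffel`. -/
lemma exists_forall_eq [FiniteDimensional ℝ E] (ℓ : TangentSpace 𝓘(ℝ, E) x → ℝ)
    (hadd : ∀ u v, ℓ (u + v) = ℓ u + ℓ v) (hsmul : ∀ (a : ℝ) u, ℓ (a • u) = a * ℓ u) :
    ∃ z, ∀ w, g x z w = ℓ w := by
  let B : TangentSpace 𝓘(ℝ, E) x →ₗ[ℝ] Module.Dual ℝ (TangentSpace 𝓘(ℝ, E) x) :=
    LinearMap.mk₂ ℝ (g x) (hg.add_left x) (hg.smul_left x) (fun u v w => hg.add_right u v w)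
      (fun a u v => hg.smul_right a u v)
  have hB : Function.Injective B := by
    rw [← LinearMap.ker_eq_bot, LinearMap.ker_eq_bot']
    intro u hu
    apply hg.eq_zero_of_self
    exact congrArg (fun L : Module.Dual ℝ (TangentSpace 𝓘(ℝ, E) x) => L u) hu
  have hB' := (LinearMap.injective_iff_surjective_of_finrank_eq_finrank
    (Subspace.dual_finrank_eq (K := ℝ) (V := TangentSpace 𝓘(ℝ, E) x)).symm).1 hB
  obtain ⟨z, hz⟩ := hB' (IsLinearMap.mk' ℓ ⟨hadd, hsmul⟩)
  exact ⟨z, fun w => congrArg (fun L : Module.Dual ℝ (TangentSpace 𝓘(ℝ, E) x) => L w) hz⟩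

/-- The metric of two smooth fields along a map is smooth. -/
lemma contMDiffAt [FiniteDimensional ℝ E] {f : X → M}
    {V W : (p : X) → TangentSpace 𝓘(ℝ, E) (f p)} {p : X}
    (hV : SmoothAlongAt E' f V p) (hW : SmoothAlongAt E' f W p) :
    ContMDiffAt 𝓘(ℝ, E') 𝓘(ℝ, ℝ) ∞ (fun p => g (f p) (V p) (W p)) p := by
  have hs := mem_chart_source E (f p)
  have hf := hV.contMDiffAt
  have h1 : ∀ᶠ p' in 𝓝 p, g (f p') (V p') (W p') =
      ∑ k, ∑ l, (Module.finBasis ℝ E).repr (coordComponents (f p) (f p') (V p')) k *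
        ((Module.finBasis ℝ E).repr (coordComponents (f p) (f p') (W p')) l *
        g (f p') (coordField (f p) (Module.finBasis ℝ E k) (f p'))
          (coordField (f p) (Module.finBasis ℝ E l) (f p'))) := by
    filter_upwards [ContMDiffAt.eventually_mem_source hf hs] with p' hp'
    conv_lhs => rw [eq_sum_coordField hp' (V p'), eq_sum_coordField hp' (W p')]
    rw [hg.sum_left]
    refine Finset.sum_congr rfl fun k _ => ?_
    rw [hg.sum_right]
    refine Finset.sum_congr rfl fun l _ => ?_
    rw [hg.smul_left, hg.smul_right]
  refine ContMDiffAt.congr_of_eventuallyEq ?_ h1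
  refine ContMDiffAt.sum fun k _ => ContMDiffAt.sum fun l _ => ?_
  have h2 := (hg.smooth (f p) (Module.finBasis ℝ E k) (Module.finBasis ℝ E l) (f p) hs).comp p hf
  exact (hV.repr_components (f p) hs k).mul ((hW.repr_components (f p) hs l).mul h2)

end IsRiemannian

end Metric

/-! ### Christoffel maps: defining identity, symmetry, bilinearity -/

section Christoffel

variable {E : Type*} [NormedAddCommGroup E] [NormedSpace ℝ E] [FiniteDimensional ℝ E]
  {M : Type*} [TopologicalSpace M] [ChartedSpace E M] [IsManifold 𝓘(ℝ, E) ∞ M]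
  {g : MetricTensor E M} (hg : IsRiemannian g) {x : M}

lemma extendVector_add (x : M) (u v : TangentSpace 𝓘(ℝ, E) x) (y : M) :
    extendVector x (u + v) y = extendVector x u y + extendVector x v y := by
  simp only [extendVector, coordComponents_add, coordField_add]

lemma extendVector_smul (x : M) (a : ℝ) (u : TangentSpace 𝓘(ℝ, E) x) (y : M) :
    extendVector x (a • u) y = a • extendVector x u y := by
  simp only [extendVector, coordComponents_smul, coordField_smul]

include hg

lemma mdifferentiableAt_metric_extendVector (u v : TangentSpace 𝓘(ℝ, E) x) :
    MDifferentiableAt 𝓘(ℝ, E) 𝓘(ℝ, ℝ)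
      (fun y => g y (extendVector x u y) (extendVector x v y)) x :=
  (hg.smooth x _ _ x (mem_chart_source E x)).mdifferentiableAt (by simp)

lemma metricDeriv_symm (u v w : TangentSpace 𝓘(ℝ, E) x) :
    metricDeriv g x u v w = metricDeriv g x u w v := by
  simp only [metricDeriv, hg.symm _ (extendVector x v _)]

lemma metricDeriv_add_right (u v w w' : TangentSpace 𝓘(ℝ, E) x) :
    metricDeriv g x u v (w + w') = metricDeriv g x u v w + metricDeriv g x u v w' := by
  simp only [metricDeriv, extendVector_add, hg.add_right]
  rw [mvfderiv_fun_add (mdifferentiableAt_metric_extendVector hg v w)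
    (mdifferentiableAt_metric_extendVector hg v w')]
  rfl

lemma metricDeriv_smul_right (a : ℝ) (u v w : TangentSpace 𝓘(ℝ, E) x) :
    metricDeriv g x u v (a • w) = a * metricDeriv g x u v w := by
  simp only [metricDeriv, extendVector_smul, hg.smul_right]
  rw [mvfderiv_fun_mul mdifferentiableAt_const (mdifferentiableAt_metric_extendVector hg v w), mvfderiv_const]
  simp

lemma christoffel_spec (u v w : TangentSpace 𝓘(ℝ, E) x) :
    g x (christoffel g x u v) w =
      (metricDeriv g x u v w + metricDeriv g x v u w - metricDeriv g x w u v) / 2 := by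
  refine Classical.epsilon_spec (p := fun z : TangentSpace 𝓘(ℝ, E) x =>
    ∀ w : TangentSpace 𝓘(ℝ, E) x, g x z w = (metricDeriv g x u v w + metricDeriv g x v u w -
      metricDeriv g x w u v) / 2) ?_ w
  refine hg.exists_forall_eq _ (fun w w' => ?_) (fun a w => ?_)
  · rw [metricDeriv_add_right hg, metricDeriv_add_right hg]
    simp only [metricDeriv, map_add]
    ring
  · rw [metricDeriv_smul_right hg, metricDeriv_smul_right hg]
    simp only [metricDeriv, map_smul, smul_eq_mul]
    ring

lemma christoffel_symm (u v : TangentSpace 𝓘(ℝ, E) x) :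
    christoffel g x u v = christoffel g x v u := by
  refine hg.eq_of_forall fun w => ?_
  rw [christoffel_spec hg, christoffel_spec hg, metricDeriv_symm hg w u v, add_comm]

lemma christoffel_add_right (u v w : TangentSpace 𝓘(ℝ, E) x) :
    christoffel g x u (v + w) = christoffel g x u v + christoffel g x u w := by
  refine hg.eq_of_forall fun z => ?_
  rw [hg.add_left, christoffel_spec hg, christoffel_spec hg, christoffel_spec hg,
    metricDeriv_add_right hg, metricDeriv_symm hg u (v + w), metricDeriv_add_right hg,
    metricDeriv_symm hg u z v, metricDeriv_symm hg u z w]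
  simp only [metricDeriv, map_add]
  ring

lemma christoffel_smul_right (a : ℝ) (u v : TangentSpace 𝓘(ℝ, E) x) :
    christoffel g x u (a • v) = a • christoffel g x u v := by
  refine hg.eq_of_forall fun z => ?_
  rw [hg.smul_left, christoffel_spec hg, christoffel_spec hg,
    metricDeriv_smul_right hg, metricDeriv_symm hg u (a • v), metricDeriv_smul_right hg,
    metricDeriv_symm hg u z v]
  simp only [metricDeriv, map_smul, smul_eq_mul]
  ring

lemma christoffel_add_left (u v w : TangentSpace 𝓘(ℝ, E) x) :
    christoffel g x (u + v) w = christoffel g x u w + christoffel g x v w := by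
  rw [christoffel_symm hg, christoffel_add_right hg, christoffel_symm hg w u,
    christoffel_symm hg w v]

lemma christoffel_smul_left (a : ℝ) (u v : TangentSpace 𝓘(ℝ, E) x) :
    christoffel g x (a • u) v = a • christoffel g x u v := by
  rw [christoffel_symm hg, christoffel_smul_right hg, christoffel_symm hg]

end Christoffel

/-! ### Covariant derivatives along maps and metric compatibility -/

section Covariant

variable {E : Type*} [NormedAddCommGroup E] [NormedSpace ℝ E]
  {M : Type*} [TopologicalSpace M] [ChartedSpace E M] [IsManifold 𝓘(ℝ, E) ∞ M]
  {E' : Type*} [NormedAddCommGroup E'] [NormedSpace ℝ E']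
  {X : Type*} [TopologicalSpace X] [ChartedSpace E' X] [IsManifold 𝓘(ℝ, E') ∞ X]
  {E'' : Type*} [NormedAddCommGroup E''] [NormedSpace ℝ E'']
  {Y : Type*} [TopologicalSpace Y] [ChartedSpace E'' Y] [IsManifold 𝓘(ℝ, E'') ∞ Y]

variable (E') in
/-- Smoothness, in a neighbourhood of `p`, of a vector field `V` along a map `f`. -/
def SmoothAlongNear (f : X → M) (V : (p : X) → TangentSpace 𝓘(ℝ, E) (f p)) (p : X) : Prop :=
  ∀ᶠ p' in 𝓝 p, SmoothAlongAt E' f V p'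

variable (E') in
/-- Smoothness of a real function in a neighbourhood of `p`. -/
def SmoothNear (a : X → ℝ) (p : X) : Prop :=
  ∀ᶠ p' in 𝓝 p, ContMDiffAt 𝓘(ℝ, E') 𝓘(ℝ, ℝ) ∞ a p'

variable {f : X → M} {V W : (p : X) → TangentSpace 𝓘(ℝ, E) (f p)} {p : X}

lemma SmoothAlongNear.self (h : SmoothAlongNear E' f V p) : SmoothAlongAt E' f V p :=
  h.self_of_nhds

/-- Smoothness of order ∞ at one point does not pass to a neighbourhood, since the neighbourhood
there depends on the finite order. This stronger form does, so it is the hypothesis under which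
fields are differentiated repeatedly. -/
lemma SmoothAlongNear.eventually (h : SmoothAlongNear E' f V p) :
    ∀ᶠ p' in 𝓝 p, SmoothAlongNear E' f V p' := eventually_eventually_nhds.2 h

lemma SmoothAlongNear.map (h : SmoothAlongNear E' f V p) :
    ∀ᶠ p' in 𝓝 p, ContMDiffAt 𝓘(ℝ, E') 𝓘(ℝ, E) ∞ f p' := h.mono fun _ h => h.contMDiffAt

lemma SmoothAlongNear.congr (h : SmoothAlongNear E' f V p) (hVW : ∀ᶠ p' in 𝓝 p, V p' = W p') :
    SmoothAlongNear E' f W p := by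
  filter_upwards [h, eventually_eventually_nhds.2 hVW] with p' h1 h2 using h1.congr h2

lemma SmoothAlongNear.add (hV : SmoothAlongNear E' f V p) (hW : SmoothAlongNear E' f W p) :
    SmoothAlongNear E' f (fun p => V p + W p) p := by
  filter_upwards [hV, hW] with p' h1 h2 using h1.add h2

lemma SmoothAlongNear.sub (hV : SmoothAlongNear E' f V p) (hW : SmoothAlongNear E' f W p) :
    SmoothAlongNear E' f (fun p => V p - W p) p := by
  filter_upwards [hV, hW] with p' h1 h2 using h1.sub h2

lemma SmoothAlongNear.smul {a : X → ℝ} (ha : SmoothNear E' a p) (hV : SmoothAlongNear E' f V p) :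
    SmoothAlongNear E' f (fun p => a p • V p) p := by
  filter_upwards [ha, hV] with p' h1 h2 using h2.smul h1

lemma smoothNear_const (c : ℝ) : SmoothNear E' (fun _ : X => c) p :=
  Eventually.of_forall fun _ => contMDiffAt_const

lemma SmoothAlongNear.comp {k : Y → X} {s : Y} (hV : SmoothAlongNear E' f V (k s))
    (hk : ∀ᶠ s' in 𝓝 s, ContMDiffAt 𝓘(ℝ, E'') 𝓘(ℝ, E') ∞ k s') :
    SmoothAlongNear E'' (fun s => f (k s)) (fun s => V (k s)) s := by
  filter_upwards [hk, hk.self_of_nhds.continuousAt.eventually hV] with s' h1 h2 using h2.comp h1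

lemma SmoothAlongNear.pushforward {f : X → M} {k : Y → X}
    {A : (s : Y) → TangentSpace 𝓘(ℝ, E') (k s)} {s : Y}
    (hf : ∀ᶠ p in 𝓝 (k s), ContMDiffAt 𝓘(ℝ, E') 𝓘(ℝ, E) ∞ f p) (hA : SmoothAlongNear E'' k A s) :
    SmoothAlongNear E'' (fun s => f (k s))
      (fun s => mfderiv 𝓘(ℝ, E') 𝓘(ℝ, E) f (k s) (A s)) s := by
  filter_upwards [hA, hA.self.contMDiffAt.continuousAt.eventually hf] with s' h1 h2
    using h1.pushforward h2

lemma SmoothAlongNear.smoothNear_mvfderiv {F : X → ℝ} {A : (p : X) → TangentSpace 𝓘(ℝ, E') p}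
    (hF : SmoothNear E' F p) (hA : SmoothAlongNear E' (fun p : X => p) A p) :
    SmoothNear E' (fun p => mvfderiv 𝓘(ℝ, E') F p (A p)) p := by
  filter_upwards [hF, hA] with p' h1 h2 using SmoothAlongAt.contMDiffAt_mvfderiv h1 h2

variable [FiniteDimensional ℝ E]

lemma IsRiemannian.smoothNear {g : MetricTensor E M} (hg : IsRiemannian g)
    (hV : SmoothAlongNear E' f V p) (hW : SmoothAlongNear E' f W p) :
    SmoothNear E' (fun p => g (f p) (V p) (W p)) p := by
  filter_upwards [hV, hW] with p' h1 h2 using hg.contMDiffAt h1 h2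

lemma smoothAlongNear_coordField {x₀ y : M} (hy : y ∈ (chartAt E x₀).source) (v : E) :
    SmoothAlongNear E (fun y : M => y) (coordField x₀ v) y :=
  eventually_smoothAlongAt_coordField hy v

lemma smoothAlongNear_extendVector (x : M) (u : TangentSpace 𝓘(ℝ, E) x) :
    SmoothAlongNear E (fun y : M => y) (extendVector x u) x :=
  eventually_smoothAlongAt_extendVector x u

/-- A property of smooth fields along `f` near `p` holds if it holds for the coordinate fields of
a chart and passes to sums, multiples by functions, and fields that agree near `p`. -/
theorem SmoothAlongNear.induction
    {motive : ((p : X) → TangentSpace 𝓘(ℝ, E) (f p)) → Prop}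
    (x₀ : M) (hx₀ : f p ∈ (chartAt E x₀).source)
    (coord : ∀ v, motive fun p' => coordField x₀ v (f p'))
    (add : ∀ V W, SmoothAlongNear E' f V p → SmoothAlongNear E' f W p → motive V → motive W →
      motive fun p' => V p' + W p')
    (smul : ∀ (a : X → ℝ) V, SmoothNear E' a p → SmoothAlongNear E' f V p → motive V →
      motive fun p' => a p' • V p')
    (congr : ∀ V W, SmoothAlongNear E' f V p → (∀ᶠ p' in 𝓝 p, V p' = W p') → motive V → motive W)
    (hV : SmoothAlongNear E' f V p) : motive V := by
  have hcoord : ∀ v, SmoothAlongNear E' f (fun p' => coordField x₀ v (f p')) p := fun v =>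
    (smoothAlongNear_coordField hx₀ v).comp (k := f) hV.map
  have hsrc := ContMDiffAt.eventually_mem_source hV.map.self_of_nhds hx₀
  have hterm : ∀ k, SmoothNear E' (fun p' =>
      (Module.finBasis ℝ E).repr (coordComponents x₀ (f p') (V p')) k) p := by
    intro k
    filter_upwards [hV, hsrc] with p' h1 h2 using h1.repr_components x₀ h2 k
  have hsum : ∀ s : Finset (Fin (Module.finrank ℝ E)),
      SmoothAlongNear E' f (fun p' => ∑ k ∈ s,
        (Module.finBasis ℝ E).repr (coordComponents x₀ (f p') (V p')) k •
          coordField x₀ (Module.finBasis ℝ E k) (f p')) p ∧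
      motive (fun p' => ∑ k ∈ s,
        (Module.finBasis ℝ E).repr (coordComponents x₀ (f p') (V p')) k •
          coordField x₀ (Module.finBasis ℝ E k) (f p')) := by
    classical
    intro s
    induction s using Finset.induction_on with
    | empty =>
      have h0 : ∀ y, coordField x₀ (0 : E) y = 0 := fun y => map_zero _
      simp only [Finset.sum_empty]
      have h1 := hcoord 0
      have h2 := coord 0
      simp only [h0] at h1 h2
      exact ⟨h1, h2⟩
    | insert a s ha ih =>
      simp only [Finset.sum_insert ha]
      have h1 := (hcoord (Module.finBasis ℝ E a)).smul (hterm a)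
      exact ⟨h1.add ih.1, add _ _ h1 ih.1 (smul _ _ (hterm a) (hcoord _) (coord _)) ih.2⟩
  refine congr _ _ (hsum Finset.univ).1 ?_ (hsum Finset.univ).2
  filter_upwards [hsrc] with p' hp'
  exact (eq_sum_coordField hp' (V p')).symm

variable {g : MetricTensor E M}

lemma mvfderiv_congr {G : Type*} [NormedAddCommGroup G] [NormedSpace ℝ G] {F₁ F₂ : X → G}
    (h : ∀ᶠ p' in 𝓝 p, F₁ p' = F₂ p') (u : TangentSpace 𝓘(ℝ, E') p) :
    mvfderiv 𝓘(ℝ, E') F₁ p u = mvfderiv 𝓘(ℝ, E') F₂ p u := by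
  have h1 : F₁ =ᶠ[𝓝 p] F₂ := h
  simp only [mvfderiv]
  rw [h1.mfderiv_eq]
  rfl

lemma covAlong_congr (h : ∀ᶠ p' in 𝓝 p, V p' = W p') (u : TangentSpace 𝓘(ℝ, E') p) :
    covAlong g f V p u = covAlong g f W p u := by
  unfold covAlong
  rw [h.self_of_nhds, mvfderiv_congr (h.mono fun p' hp => by rw [hp])]

variable (hg : IsRiemannian g)
include hg

lemma covAlong_map_add (V : (p : X) → TangentSpace 𝓘(ℝ, E) (f p)) (u v : TangentSpace 𝓘(ℝ, E') p) :
    covAlong g f V p (u + v) = covAlong g f V p u + covAlong g f V p v := by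
  simp only [covAlong, map_add, coordField_add, christoffel_add_left hg]
  abel

lemma covAlong_map_smul (V : (p : X) → TangentSpace 𝓘(ℝ, E) (f p)) (a : ℝ)
    (u : TangentSpace 𝓘(ℝ, E') p) : covAlong g f V p (a • u) = a • covAlong g f V p u := by
  simp only [covAlong, map_smul, coordField_smul, christoffel_smul_left hg, smul_add]

lemma covAlong_add (hV : SmoothAlongAt E' f V p) (hW : SmoothAlongAt E' f W p)
    (u : TangentSpace 𝓘(ℝ, E') p) :
    covAlong g f (fun p => V p + W p) p u = covAlong g f V p u + covAlong g f W p u := by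
  simp only [covAlong, coordComponents_add]
  rw [mvfderiv_fun_add ((hV.components _ (mem_chart_source E _)).mdifferentiableAt (by simp))
    ((hW.components _ (mem_chart_source E _)).mdifferentiableAt (by simp)), add_apply,
    coordField_add, christoffel_add_right hg]
  abel

lemma covAlong_smul {a : X → ℝ} (ha : ContMDiffAt 𝓘(ℝ, E') 𝓘(ℝ, ℝ) ∞ a p)
    (hV : SmoothAlongAt E' f V p) (u : TangentSpace 𝓘(ℝ, E') p) :
    covAlong g f (fun p => a p • V p) p u =
      mvfderiv 𝓘(ℝ, E') a p u • V p + a p • covAlong g f V p u := by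
  simp only [covAlong, coordComponents_smul]
  rw [mvfderiv_fun_smul (ha.mdifferentiableAt (by simp))
    ((hV.components _ (mem_chart_source E _)).mdifferentiableAt (by simp)), add_apply,
    coordField_add, christoffel_smul_right hg, ContinuousLinearMap.smulRight_apply,
    coordField_smul, coordField_coordComponents (mem_chart_source E _),
    _root_.smul_apply, coordField_smul, smul_add]
  abel

lemma covAlong_neg (hV : SmoothAlongAt E' f V p) (u : TangentSpace 𝓘(ℝ, E') p) :
    covAlong g f (fun p => -V p) p u = -covAlong g f V p u := by
  have h := covAlong_smul hg (a := fun _ => (-1 : ℝ)) contMDiffAt_const hV u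
  rw [mvfderiv_const] at h
  simpa using h

lemma covAlong_sub (hV : SmoothAlongAt E' f V p) (hW : SmoothAlongAt E' f W p)
    (u : TangentSpace 𝓘(ℝ, E') p) :
    covAlong g f (fun p => V p - W p) p u = covAlong g f V p u - covAlong g f W p u := by
  simp only [sub_eq_add_neg]
  rw [covAlong_add hg hV hW.neg, covAlong_neg hg hW]

lemma covAlong_zero (u : TangentSpace 𝓘(ℝ, E') p) :
    covAlong g f (fun p => (0 : TangentSpace 𝓘(ℝ, E) (f p))) p u = 0 := by
  have h0 : ∀ p', coordComponents (f p) (f p') (0 : TangentSpace 𝓘(ℝ, E) (f p')) = 0 :=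
    fun p' => map_zero _
  have h1 : coordField (f p) (0 : E) (f p) = 0 := map_zero _
  have h2 := christoffel_smul_right hg 0 (mfderiv 𝓘(ℝ, E') 𝓘(ℝ, E) f p u)
    (0 : TangentSpace 𝓘(ℝ, E) (f p))
  simp only [smul_zero, zero_smul] at h2
  simp only [covAlong, h0, h2]
  rw [mvfderiv_const]
  simp [h1]

omit hg in
/-- Chain rule. -/
lemma covAlong_comp {k : Y → X} {s : Y} (hV : SmoothAlongAt E' f V (k s))
    (hk : MDifferentiableAt 𝓘(ℝ, E'') 𝓘(ℝ, E') k s) (u : TangentSpace 𝓘(ℝ, E'') s) :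
    covAlong g (fun s => f (k s)) (fun s => V (k s)) s u =
      covAlong g f V (k s) (mfderiv 𝓘(ℝ, E'') 𝓘(ℝ, E') k s u) := by
  unfold covAlong
  have h1 := mfderiv_comp_apply s (hV.contMDiffAt.mdifferentiableAt (by simp)) hk u
  have h2 : mvfderiv 𝓘(ℝ, E'') (fun s' => coordComponents (f (k s)) (f (k s')) (V (k s'))) s u =
      mvfderiv 𝓘(ℝ, E') (fun p' => coordComponents (f (k s)) (f p') (V p')) (k s)
        (mfderiv 𝓘(ℝ, E'') 𝓘(ℝ, E') k s u) :=
    mfderiv_comp_apply s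
      ((hV.components (f (k s)) (mem_chart_source E _)).mdifferentiableAt (by simp)) hk u
  rw [h2]
  congr 1
  exact congrArg (fun w => christoffel g (f (k s)) w (V (k s))) h1

omit hg in
/-- The restriction to a map of a vector field. -/
lemma covAlong_field {Z : (y : M) → TangentSpace 𝓘(ℝ, E) y}
    (hZ : SmoothAlongAt E (fun y : M => y) Z (f p)) (hf : MDifferentiableAt 𝓘(ℝ, E') 𝓘(ℝ, E) f p)
    (u : TangentSpace 𝓘(ℝ, E') p) :
    covAlong g f (fun p => Z (f p)) p u =
      nabla g Z (f p) (mfderiv 𝓘(ℝ, E') 𝓘(ℝ, E) f p u) :=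
  covAlong_comp (f := fun y : M => y) (k := f) hZ hf u

omit hg in
-- The components are constant in the very chart used at `f p`, so only the Christoffel term
-- survives.
lemma covAlong_coordField_self (hf : ContMDiffAt 𝓘(ℝ, E') 𝓘(ℝ, E) ∞ f p) (v : E)
    (u : TangentSpace 𝓘(ℝ, E') p) :
    covAlong g f (fun p' => coordField (f p) v (f p')) p u =
      christoffel g (f p) (mfderiv 𝓘(ℝ, E') 𝓘(ℝ, E) f p u) (coordField (f p) v (f p)) := by
  unfold covAlong
  have h1 : ∀ᶠ p' in 𝓝 p, coordComponents (f p) (f p') (coordField (f p) v (f p')) = v := by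
    filter_upwards [ContMDiffAt.eventually_mem_source hf (mem_chart_source E _)] with p' hp'
    exact coordComponents_coordField hp' v
  have h0 : coordField (f p) (0 : E) (f p) = 0 := map_zero _
  rw [mvfderiv_congr h1, mvfderiv_const]
  simp [h0]

/-- The Levi-Civita connection is compatible with the metric. -/
theorem metric_compat (hV : SmoothAlongNear E' f V p) (hW : SmoothAlongNear E' f W p)
    (u : TangentSpace 𝓘(ℝ, E') p) :
    mvfderiv 𝓘(ℝ, E') (fun p => g (f p) (V p) (W p)) p u =
      g (f p) (covAlong g f V p u) (W p) + g (f p) (V p) (covAlong g f W p u) := by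
  have hx := mem_chart_source E (f p)
  have hc : ∀ v, SmoothAlongNear E' f (fun p' => coordField (f p) v (f p')) p := fun v =>
    (smoothAlongNear_coordField hx v).comp (k := f) hV.map
  have hd : ∀ {V W : (p : X) → TangentSpace 𝓘(ℝ, E) (f p)}, SmoothAlongNear E' f V p →
      SmoothAlongNear E' f W p → MDifferentiableAt 𝓘(ℝ, E') 𝓘(ℝ, ℝ)
        (fun p => g (f p) (V p) (W p)) p := fun h1 h2 =>
    (hg.contMDiffAt h1.self h2.self).mdifferentiableAt (by simp)
  refine SmoothAlongNear.induction (E' := E') (motive := fun V =>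
    mvfderiv 𝓘(ℝ, E') (fun p => g (f p) (V p) (W p)) p u =
      g (f p) (covAlong g f V p u) (W p) + g (f p) (V p) (covAlong g f W p u))
    (f p) hx ?_ ?_ ?_ ?_ hV
  · intro v
    refine SmoothAlongNear.induction (E' := E') (motive := fun W =>
      mvfderiv 𝓘(ℝ, E') (fun p' => g (f p') (coordField (f p) v (f p')) (W p')) p u =
        g (f p) (covAlong g f (fun p' => coordField (f p) v (f p')) p u) (W p) +
          g (f p) (coordField (f p) v (f p)) (covAlong g f W p u))
      (f p) hx ?_ ?_ ?_ ?_ hW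
    · intro w
      rw [covAlong_coordField_self hV.map.self_of_nhds, covAlong_coordField_self hV.map.self_of_nhds]
      -- In the sum of the two defining expressions for Γ(u', v) and Γ(u', w) the derivatives along
      -- v and w cancel in pairs, which leaves ∂_{u'} g(v, w).
      rw [hg.symm _ (coordField (f p) v (f p)), christoffel_spec hg, christoffel_spec hg]
      set u' := mfderiv 𝓘(ℝ, E') 𝓘(ℝ, E) f p u with hu'
      have h1 : mvfderiv 𝓘(ℝ, E') (fun p' => g (f p') (coordField (f p) v (f p'))
          (coordField (f p) w (f p'))) p u =
          metricDeriv g (f p) u' (coordField (f p) v (f p)) (coordField (f p) w (f p)) := by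
        unfold metricDeriv
        simp only [extendVector, coordComponents_coordField hx]
        exact mfderiv_comp_apply p
          ((hg.smooth (f p) v w (f p) hx).mdifferentiableAt (by simp))
          (hV.map.self_of_nhds.mdifferentiableAt (by simp)) u
      rw [h1, metricDeriv_symm hg u' (coordField (f p) w (f p))]
      rw [metricDeriv_symm hg (coordField (f p) v (f p)) u' (coordField (f p) w (f p)),
        metricDeriv_symm hg (coordField (f p) w (f p)) u']
      ring
    · intro W₁ W₂ h1 h2 e1 e2
      simp only [hg.add_right]
      rw [mvfderiv_fun_add (hd (hc v) h1) (hd (hc v) h2), add_apply, e1, e2,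
        covAlong_add hg h1.self h2.self, hg.add_right]
      ring
    · intro a W₁ ha h1 e1
      simp only [hg.smul_right]
      rw [mvfderiv_fun_mul (ha.self_of_nhds.mdifferentiableAt (by simp)) (hd (hc v) h1), add_apply,
        _root_.smul_apply, _root_.smul_apply, e1, covAlong_smul hg ha.self_of_nhds h1.self,
        hg.add_right, hg.smul_right, hg.smul_right]
      simp only [smul_eq_mul]
      ring
    · intro W₁ W₂ h1 h2 e1
      rw [← mvfderiv_congr (F₁ := fun p' => g (f p') (coordField (f p) v (f p')) (W₁ p'))
        (h2.mono fun p' hp => by rw [hp]), e1, ← covAlong_congr h2,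
        ← h2.self_of_nhds]
  · intro W₁ W₂ h1 h2 e1 e2
    simp only [hg.add_left]
    rw [mvfderiv_fun_add (hd h1 hW) (hd h2 hW), add_apply, e1, e2,
      covAlong_add hg h1.self h2.self, hg.add_left]
    ring
  · intro a W₁ ha h1 e1
    simp only [hg.smul_left]
    rw [mvfderiv_fun_mul (ha.self_of_nhds.mdifferentiableAt (by simp)) (hd h1 hW), add_apply,
      _root_.smul_apply, _root_.smul_apply, e1, covAlong_smul hg ha.self_of_nhds h1.self,
      hg.add_left, hg.smul_left, hg.smul_left]
    simp only [smul_eq_mul]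
    ring
  · intro W₁ W₂ h1 h2 e1
    rw [← mvfderiv_congr (F₁ := fun p' => g (f p') (W₁ p') (W p'))
      (h2.mono fun p' hp => by rw [hp]), e1, ← covAlong_congr h2,
      ← h2.self_of_nhds]

end Covariant

/-! ### Smoothness of a field from its metric products -/

section Regularity

variable {E : Type*} [NormedAddCommGroup E] [NormedSpace ℝ E]
  {M : Type*} [TopologicalSpace M] [ChartedSpace E M] [IsManifold 𝓘(ℝ, E) ∞ M]
  {E' : Type*} [NormedAddCommGroup E'] [NormedSpace ℝ E']
  {X : Type*} [TopologicalSpace X] [ChartedSpace E' X] [IsManifold 𝓘(ℝ, E') ∞ X]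
  {f : X → M} {V W : (p : X) → TangentSpace 𝓘(ℝ, E) (f p)} {p : X} {g : MetricTensor E M}
  [FiniteDimensional ℝ E]

lemma isInvertible_of_pos (A : E →L[ℝ] E →L[ℝ] ℝ) (hA : ∀ v, v ≠ 0 → 0 < A v v) :
    A.IsInvertible := by
  have hinj : Function.Injective (A : E →ₗ[ℝ] E →L[ℝ] ℝ) := by
    rw [← LinearMap.ker_eq_bot, LinearMap.ker_eq_bot']
    intro v hv
    by_contra h0
    have hv' : A v = 0 := hv
    have := hA v h0
    rw [hv'] at this
    simp at this
  have hdim : Module.finrank ℝ E = Module.finrank ℝ (E →L[ℝ] ℝ) := by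
    rw [← LinearEquiv.finrank_eq (LinearMap.toContinuousLinearMap (𝕜 := ℝ) (E := E) (F' := ℝ))]
    exact (Subspace.dual_finrank_eq (K := ℝ) (V := E)).symm
  let e : E ≃L[ℝ] (E →L[ℝ] ℝ) :=
    (LinearEquiv.ofInjectiveOfFinrankEq (A : E →ₗ[ℝ] E →L[ℝ] ℝ) hinj hdim).toContinuousLinearEquiv
  exact ⟨e, by ext v w; rfl⟩

/-- A vector field along `f` is smooth if its products with the coordinate fields are smooth. -/
theorem smoothAlongAt_of_metric (hg : IsRiemannian g) (x₀ : M) (hx : f p ∈ (chartAt E x₀).source)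
    (hf : ContMDiffAt 𝓘(ℝ, E') 𝓘(ℝ, E) ∞ f p)
    (h : ∀ v, ContMDiffAt 𝓘(ℝ, E') 𝓘(ℝ, ℝ) ∞
      (fun p' => g (f p') (V p') (coordField x₀ v (f p'))) p) : SmoothAlongAt E' f V p := by
  rw [smoothAlongAt_iff x₀ hx]
  refine ⟨hf, ?_⟩
  let b := Module.finBasis ℝ E
  let c : Fin (Module.finrank ℝ E) → E →L[ℝ] ℝ := fun k =>
    LinearMap.toContinuousLinearMap (b.coord k)
  have hb : ∀ v : E, ∑ k, c k v • b k = v := fun v => b.sum_repr v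
  -- `G` is the Gram form of the coordinate fields and `ℓ` the functional g(V, ·). The components of
  -- V solve G(V) = ℓ, so they are smooth because inversion of linear maps is smooth.
  let G : X → E →L[ℝ] E →L[ℝ] ℝ := fun p' => ∑ k, ∑ l,
    g (f p') (coordField x₀ (b k) (f p')) (coordField x₀ (b l) (f p')) • (c k).smulRight (c l)
  let ℓ : X → E →L[ℝ] ℝ := fun p' => ∑ l, g (f p') (V p') (coordField x₀ (b l) (f p')) • c l
  have hG : ∀ p' v w, G p' v w = g (f p') (coordField x₀ v (f p')) (coordField x₀ w (f p')) := by
    intro p' v w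
    conv_rhs => rw [← hb v, ← hb w]
    simp only [coordField_sum, coordField_smul, hg.sum_left, hg.sum_right, hg.smul_left,
      hg.smul_right]
    simp only [G, _root_.sum_apply, _root_.smul_apply,
      ContinuousLinearMap.smulRight_apply, smul_eq_mul]
    exact Finset.sum_congr rfl fun k _ => Finset.sum_congr rfl fun l _ => by ring
  have hℓ : ∀ p' w, ℓ p' w = g (f p') (V p') (coordField x₀ w (f p')) := by
    intro p' w
    conv_rhs => rw [← hb w]
    simp only [coordField_sum, coordField_smul, hg.sum_right, hg.smul_right]
    simp only [ℓ, _root_.sum_apply, _root_.smul_apply, smul_eq_mul]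
    exact Finset.sum_congr rfl fun l _ => by ring
  have hGs : ContMDiffAt 𝓘(ℝ, E') 𝓘(ℝ, E →L[ℝ] E →L[ℝ] ℝ) ∞ G p := by
    refine ContMDiffAt.sum fun k _ => ContMDiffAt.sum fun l _ => ?_
    exact ContMDiffAt.smul ((hg.smooth x₀ (b k) (b l) (f p) hx).comp p hf) contMDiffAt_const
  have hℓs : ContMDiffAt 𝓘(ℝ, E') 𝓘(ℝ, E →L[ℝ] ℝ) ∞ ℓ p :=
    ContMDiffAt.sum fun l _ => ContMDiffAt.smul (h (b l)) contMDiffAt_const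
  have hinv : ∀ p', f p' ∈ (chartAt E x₀).source → (G p').IsInvertible := by
    intro p' hp'
    refine isInvertible_of_pos _ fun v hv => ?_
    rw [hG]
    refine hg.pos _ _ fun h0 => hv ?_
    rw [← coordComponents_coordField hp' v, h0]
    exact map_zero _
  have hGi : ContMDiffAt 𝓘(ℝ, E') 𝓘(ℝ, (E →L[ℝ] ℝ) →L[ℝ] E) ∞
      (fun p' => (G p').inverse) p := by
    obtain ⟨e, he⟩ := hinv p hx
    have := (contDiffAt_map_inverse (n := ∞) e).contMDiffAt
    rw [he] at this
    exact this.comp p hGs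
  refine (hGi.clm_apply hℓs).congr_of_eventuallyEq ?_
  filter_upwards [ContMDiffAt.eventually_mem_source hf hx] with p' hp'
  have h1 : G p' (coordComponents x₀ (f p') (V p')) = ℓ p' := by
    ext w
    rw [hG, hℓ, coordField_coordComponents hp']
  exact ((hinv p' hp').inverse_apply_eq.2 h1.symm).symm

end Regularity

/-! ### Torsion-freeness, Koszul formula, smoothness of covariant derivatives -/

section Symmetry

variable {E : Type*} [NormedAddCommGroup E] [NormedSpace ℝ E]
  {M : Type*} [TopologicalSpace M] [ChartedSpace E M] [IsManifold 𝓘(ℝ, E) ∞ M]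
  {E' : Type*} [NormedAddCommGroup E'] [NormedSpace ℝ E']
  {X : Type*} [TopologicalSpace X] [ChartedSpace E' X] [IsManifold 𝓘(ℝ, E') ∞ X]
  {f : X → M} {V W : (p : X) → TangentSpace 𝓘(ℝ, E) (f p)} {p : X} {g : MetricTensor E M}
  [FiniteDimensional ℝ E] (hg : IsRiemannian g)
include hg

/-- The Levi-Civita connection is torsion-free. -/
theorem covAlong_mfderiv_coordField_comm {x₀ : X} (hx : p ∈ (chartAt E' x₀).source)
    (hf : ∀ᶠ p' in 𝓝 p, ContMDiffAt 𝓘(ℝ, E') 𝓘(ℝ, E) ∞ f p') (v w : E') :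
    covAlong g f (fun p' => mfderiv 𝓘(ℝ, E') 𝓘(ℝ, E) f p' (coordField x₀ w p')) p
      (coordField x₀ v p) =
    covAlong g f (fun p' => mfderiv 𝓘(ℝ, E') 𝓘(ℝ, E) f p' (coordField x₀ v p')) p
      (coordField x₀ w p) := by
  have hsrc := ContMDiffAt.eventually_mem_source hf.self_of_nhds (mem_chart_source E (f p))
  -- In the chart at `f p`, the field df(∂_w) has as components the partial derivative along w of
  -- the coordinate expression of f. The claim thus reduces to symmetry of second derivatives and of
  -- the Christoffel map.
  have h1 : ∀ w, ∀ᶠ p' in 𝓝 p, coordComponents (f p) (f p')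
      (mfderiv 𝓘(ℝ, E') 𝓘(ℝ, E) f p' (coordField x₀ w p')) =
      mvfderiv 𝓘(ℝ, E') (fun p' => extChartAt 𝓘(ℝ, E) (f p) (f p')) p' (coordField x₀ w p') := by
    intro w
    filter_upwards [hsrc, hf] with p' h2 h3
    rw [coordComponents_eq_mvfderiv h2]
    exact (mfderiv_comp_apply p' (mdifferentiableAt_extChartAt (I := 𝓘(ℝ, E)) h2)
      (h3.mdifferentiableAt (by simp)) _).symm
  have h4 : ∀ᶠ p' in 𝓝 p, ContMDiffAt 𝓘(ℝ, E') 𝓘(ℝ, E) ∞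
      (fun p' => extChartAt 𝓘(ℝ, E) (f p) (f p')) p' := by
    filter_upwards [hsrc, hf] with p' h2 h3
    exact (contMDiffAt_extChartAt' (I := 𝓘(ℝ, E)) (n := ∞) h2).comp p' h3
  unfold covAlong
  rw [christoffel_symm hg, mvfderiv_congr (h1 w), mvfderiv_congr (h1 v),
    mvfderiv_coordField_comm hx h4]

lemma nabla_coordField_comm {x₀ y : M} (hy : y ∈ (chartAt E x₀).source) (v w : E) :
    nabla g (coordField x₀ w) y (coordField x₀ v y) =
      nabla g (coordField x₀ v) y (coordField x₀ w y) := by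
  have h := covAlong_mfderiv_coordField_comm hg (f := fun y : M => y) hy
    (Eventually.of_forall fun _ => contMDiffAt_id) v w
  have hid : ∀ y : M, mfderiv 𝓘(ℝ, E) 𝓘(ℝ, E) (fun y : M => y) y =
      ContinuousLinearMap.id ℝ (TangentSpace 𝓘(ℝ, E) y) := fun y => mfderiv_id
  simp only [hid] at h
  exact h

/-- Koszul formula for coordinate fields. -/
lemma koszul_coordField {x₀ y : M} (hy : y ∈ (chartAt E x₀).source) (u v w : E) :
    2 * g y (nabla g (coordField x₀ v) y (coordField x₀ u y)) (coordField x₀ w y) =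
      mvfderiv 𝓘(ℝ, E) (fun y => g y (coordField x₀ v y) (coordField x₀ w y)) y (coordField x₀ u y)
      + mvfderiv 𝓘(ℝ, E) (fun y => g y (coordField x₀ u y) (coordField x₀ w y)) y
        (coordField x₀ v y)
      - mvfderiv 𝓘(ℝ, E) (fun y => g y (coordField x₀ u y) (coordField x₀ v y)) y
        (coordField x₀ w y) := by
  have hs := fun v => smoothAlongNear_coordField hy v
  rw [metric_compat hg (hs v) (hs w), metric_compat hg (hs u) (hs w),
    metric_compat hg (hs u) (hs v)]
  have c := fun v w => nabla_coordField_comm hg hy v w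
  simp only [nabla] at c ⊢
  rw [c v u, c w u, c w v, hg.symm y (coordField x₀ u y), hg.symm y (coordField x₀ v y)]
  ring

/-- The definition of `nabla` changes chart with the point and says nothing about smooth dependence
on it. The Koszul formula expresses the products with coordinate fields of the single chart at x₀
through derivatives of smooth functions. -/
lemma smoothAlongAt_nabla_coordField {x₀ y : M} (hy : y ∈ (chartAt E x₀).source) (u v : E) :
    SmoothAlongAt E (fun y : M => y)
      (fun y => nabla g (coordField x₀ v) y (coordField x₀ u y)) y := by
  refine smoothAlongAt_of_metric hg x₀ hy contMDiffAt_id fun w => ?_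
  have hs := fun v => smoothAlongAt_coordField hy v
  have hs2 : ∀ u v w, ContMDiffAt 𝓘(ℝ, E) 𝓘(ℝ, ℝ) ∞ (fun y => mvfderiv 𝓘(ℝ, E)
      (fun y => g y (coordField x₀ v y) (coordField x₀ w y)) y (coordField x₀ u y)) y :=
    fun u v w => SmoothAlongAt.contMDiffAt_mvfderiv (hg.smooth x₀ v w y hy) (hs u)
  have h3 : ∀ᶠ z in 𝓝 y, g z (nabla g (coordField x₀ v) z (coordField x₀ u z)) (coordField x₀ w z)
      = (1 / 2 : ℝ) * (mvfderiv 𝓘(ℝ, E) (fun y => g y (coordField x₀ v y) (coordField x₀ w y)) z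
        (coordField x₀ u z)
      + mvfderiv 𝓘(ℝ, E) (fun y => g y (coordField x₀ u y) (coordField x₀ w y)) z
        (coordField x₀ v z)
      - mvfderiv 𝓘(ℝ, E) (fun y => g y (coordField x₀ u y) (coordField x₀ v y)) z
        (coordField x₀ w z)) := by
    filter_upwards [(chartAt E x₀).open_source.mem_nhds hy] with z hz
    rw [← koszul_coordField hg hz]
    ring
  refine ContMDiffAt.congr_of_eventuallyEq ?_ h3
  exact contMDiffAt_const.mul (((hs2 u v w).add (hs2 v u w)).sub (hs2 w u v))

/-- The covariant derivative of a smooth field along a smooth field is smooth. -/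
theorem SmoothAlongNear.covAlong (hV : SmoothAlongNear E' f V p) [FiniteDimensional ℝ E']
    {A : (p : X) → TangentSpace 𝓘(ℝ, E') p} (hA : SmoothAlongNear E' (fun p : X => p) A p) :
    SmoothAlongNear E' f (fun p => BiharmonicHopf.covAlong g f V p (A p)) p := by
  have hx := mem_chart_source E (f p)
  have hsrc := ContMDiffAt.eventually_mem_source hV.map.self_of_nhds hx
  refine SmoothAlongNear.induction (E' := E') (motive := fun V => SmoothAlongNear E' f
    (fun p => BiharmonicHopf.covAlong g f V p (A p)) p) (f p) hx ?_ ?_ ?_ ?_ hV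
  · intro v
    have h1 : ∀ᶠ p' in 𝓝 p,
        nabla g (coordField (f p) v) (f p') (mfderiv 𝓘(ℝ, E') 𝓘(ℝ, E) f p' (A p')) =
        BiharmonicHopf.covAlong g f (fun p' => coordField (f p) v (f p')) p' (A p') := by
      filter_upwards [hsrc, hV.map] with p' h2 h3
      exact (covAlong_field (smoothAlongAt_coordField h2 v) (h3.mdifferentiableAt (by simp)) _).symm
    refine SmoothAlongNear.congr ?_ h1
    -- The direction df(A) is itself a field along f. A second induction, on this field, leaves only
    -- the derivative of one coordinate field along another.
    refine SmoothAlongNear.induction (E' := E') (motive := fun W => SmoothAlongNear E' f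
      (fun p' => nabla g (coordField (f p) v) (f p') (W p')) p) (f p) hx ?_ ?_ ?_ ?_
      (SmoothAlongNear.pushforward hV.map hA)
    · intro w
      filter_upwards [hsrc, hV.map] with p' h2 h3
      exact (smoothAlongAt_nabla_coordField hg h2 w v).comp h3
    · intro W₁ W₂ h1 h2 e1 e2
      exact (e1.add e2).congr (Eventually.of_forall fun p' => (covAlong_map_add hg _ _ _).symm)
    · intro a W₁ ha h1 e1
      exact (e1.smul ha).congr (Eventually.of_forall fun p' => (covAlong_map_smul hg _ _ _).symm)
    · intro W₁ W₂ h1 h2 e1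
      exact e1.congr (h2.mono fun p' hp => by rw [hp])
  · intro W₁ W₂ h1 h2 e1 e2
    refine (e1.add e2).congr ?_
    filter_upwards [h1, h2] with p' h3 h4 using (covAlong_add hg h3 h4 _).symm
  · intro a W₁ ha h1 e1
    refine ((h1.smul (SmoothAlongNear.smoothNear_mvfderiv ha hA)).add (e1.smul ha)).congr ?_
    filter_upwards [h1, ha] with p' h3 h4 using (covAlong_smul hg h4 h3 _).symm
  · intro W₁ W₂ h1 h2 e1
    refine e1.congr ?_
    filter_upwards [eventually_eventually_nhds.2 h2] with p' h3 using covAlong_congr h3 _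

end Symmetry

/-! ### Second fundamental form of a map and the composition formula -/

section Hessian

variable {E : Type*} [NormedAddCommGroup E] [NormedSpace ℝ E]
  {M : Type*} [TopologicalSpace M] [ChartedSpace E M] [IsManifold 𝓘(ℝ, E) ∞ M]
  {E' : Type*} [NormedAddCommGroup E'] [NormedSpace ℝ E']
  {X : Type*} [TopologicalSpace X] [ChartedSpace E' X] [IsManifold 𝓘(ℝ, E') ∞ X]
  {E'' : Type*} [NormedAddCommGroup E''] [NormedSpace ℝ E'']
  {Y : Type*} [TopologicalSpace Y] [ChartedSpace E'' Y] [IsManifold 𝓘(ℝ, E'') ∞ Y]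
  {f : X → M} {p : X} {g : MetricTensor E M} {h : MetricTensor E' X}
  [FiniteDimensional ℝ E] [FiniteDimensional ℝ E'] (hg : IsRiemannian g) (hh : IsRiemannian h)

lemma extendVector_coordField (p : X) (v : E') (y : X) :
    extendVector p (coordField p v p) y = coordField p v y := by
  rw [extendVector, coordComponents_coordField (mem_chart_source E' p)]

include hg hh

/-- For a bundle map `L` along `f`, the expression `∇^f_u (L W) - L (∇_u W)` depends only on the
value of the field `W` at the point. -/
theorem covAlong_bundleMap_eq
    (L : (p : X) → TangentSpace 𝓘(ℝ, E') p → TangentSpace 𝓘(ℝ, E) (f p))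
    (hadd : ∀ p u v, L p (u + v) = L p u + L p v) (hsmul : ∀ p (a : ℝ) u, L p (a • u) = a • L p u)
    (hL : ∀ W, SmoothAlongNear E' (fun p : X => p) W p → SmoothAlongAt E' f (fun p => L p (W p)) p)
    {W : (p : X) → TangentSpace 𝓘(ℝ, E') p} (hW : SmoothAlongNear E' (fun p : X => p) W p)
    (u : TangentSpace 𝓘(ℝ, E') p) :
    covAlong g f (fun p' => L p' (extendVector p (W p) p')) p u
        - L p (nabla h (extendVector p (W p)) p u) =
      covAlong g f (fun p' => L p' (W p')) p u - L p (nabla h W p u) := by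
  have hx := mem_chart_source E' p
  refine SmoothAlongNear.induction (E' := E') (f := fun p : X => p) (motive := fun W =>
    covAlong g f (fun p' => L p' (extendVector p (W p) p')) p u
        - L p (nabla h (extendVector p (W p)) p u) =
      covAlong g f (fun p' => L p' (W p')) p u - L p (nabla h W p u)) p hx ?_ ?_ ?_ ?_ hW
  · intro v
    have h1 : extendVector p (coordField p v p) = coordField p v :=
      funext (extendVector_coordField p v)
    simp only [h1]
  · intro W₁ W₂ h1 h2 e1 e2
    have s1 := smoothAlongNear_extendVector p (W₁ p)
    have s2 := smoothAlongNear_extendVector p (W₂ p)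
    have h3 : extendVector p (W₁ p + W₂ p) =
        fun y => extendVector p (W₁ p) y + extendVector p (W₂ p) y :=
      funext (extendVector_add p _ _)
    have h4 := covAlong_add hh h1.self h2.self u
    have h5 := covAlong_add hh s1.self s2.self u
    have h6 := covAlong_add hg (hL _ h1) (hL _ h2) u
    have h7 := covAlong_add hg (hL _ s1) (hL _ s2) u
    simp only [h3, nabla, hadd, h4, h5, h6, h7] at e1 e2 ⊢
    rw [add_sub_add_comm, e1, e2, add_sub_add_comm]
  · intro a W₁ ha h1 e1
    have s1 := smoothAlongNear_extendVector p (W₁ p)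
    have h3 : extendVector p (a p • W₁ p) = fun y => a p • extendVector p (W₁ p) y :=
      funext (extendVector_smul p _ _)
    have h4 := covAlong_smul hh ha.self_of_nhds h1.self u
    have h5 := covAlong_smul hh (a := fun _ => a p) contMDiffAt_const s1.self u
    have h6 := covAlong_smul hg ha.self_of_nhds (hL _ h1) u
    have h7 := covAlong_smul hg (a := fun _ => a p) contMDiffAt_const (hL _ s1) u
    rw [mvfderiv_const] at h5 h7
    simp only [zero_apply, zero_smul, zero_add] at h5 h7
    simp only [h3, nabla, hadd, hsmul, h4, h5, h6, h7] at e1 ⊢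
    -- The Leibniz terms da(u)·L(W), one from the derivative of the image of the field and one from
    -- the image of its derivative, cancel.
    rw [← smul_sub, e1, smul_sub]
    abel
  · intro W₁ W₂ h1 h2 e1
    rw [← h2.self_of_nhds, e1]
    have h3 : covAlong g f (fun p' => L p' (W₁ p')) p u = covAlong g f (fun p' => L p' (W₂ p')) p u :=
      covAlong_congr (h2.mono fun p' hp => by rw [hp]) u
    have h4 : nabla h W₁ p u = nabla h W₂ p u := covAlong_congr h2 u
    rw [h3, h4]

omit hg hh

/-- The second fundamental form `∇dψ` of a map. -/
noncomputable def secondFund (h : MetricTensor E' X) (g : MetricTensor E M) (f : X → M) (p : X)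
    (u v : TangentSpace 𝓘(ℝ, E') p) : TangentSpace 𝓘(ℝ, E) (f p) :=
  covAlong g f (fun p' => mfderiv 𝓘(ℝ, E') 𝓘(ℝ, E) f p' (extendVector p v p')) p u
    - mfderiv 𝓘(ℝ, E') 𝓘(ℝ, E) f p (nabla h (extendVector p v) p u)

lemma tension_eq_metricTrace (p : X) : tension h g f p = metricTrace h p (secondFund h g f p) := rfl

lemma SmoothAlongNear.pushforward_field (hf : ∀ᶠ p' in 𝓝 p, ContMDiffAt 𝓘(ℝ, E') 𝓘(ℝ, E) ∞ f p')
    {W : (p : X) → TangentSpace 𝓘(ℝ, E') p} (hW : SmoothAlongNear E' (fun p : X => p) W p) :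
    SmoothAlongNear E' f (fun p => mfderiv 𝓘(ℝ, E') 𝓘(ℝ, E) f p (W p)) p :=
  SmoothAlongNear.pushforward (k := fun p : X => p) hf hW

variable (hf : ∀ᶠ p' in 𝓝 p, ContMDiffAt 𝓘(ℝ, E') 𝓘(ℝ, E) ∞ f p')

section
include hg hh hf

lemma secondFund_eq {W : (p : X) → TangentSpace 𝓘(ℝ, E') p}
    (hW : SmoothAlongNear E' (fun p : X => p) W p) (u : TangentSpace 𝓘(ℝ, E') p) :
    secondFund h g f p u (W p) =
      covAlong g f (fun p' => mfderiv 𝓘(ℝ, E') 𝓘(ℝ, E) f p' (W p')) p u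
        - mfderiv 𝓘(ℝ, E') 𝓘(ℝ, E) f p (nabla h W p u) :=
  covAlong_bundleMap_eq hg hh (fun p => mfderiv 𝓘(ℝ, E') 𝓘(ℝ, E) f p) (fun _ _ _ => map_add _ _ _)
    (fun _ _ _ => map_smul _ _ _) (fun _ hW => (hW.pushforward_field hf).self) hW u

/-- Both connections are torsion-free, so each of the two terms is symmetric on coordinate fields.
Linearity in the second argument is then inherited from the first. -/
lemma secondFund_symm (u v : TangentSpace 𝓘(ℝ, E') p) :
    secondFund h g f p u v = secondFund h g f p v u := by
  have hx := mem_chart_source E' p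
  have h1 := covAlong_mfderiv_coordField_comm hg hx hf (coordComponents p p u) (coordComponents p p v)
  have h2 := nabla_coordField_comm hh hx (coordComponents p p u) (coordComponents p p v)
  rw [coordField_coordComponents hx, coordField_coordComponents hx] at h1 h2
  simp only [secondFund]
  exact congrArg₂ (fun a b => a - mfderiv 𝓘(ℝ, E') 𝓘(ℝ, E) f p b) h1 h2

lemma secondFund_add_left (u v w : TangentSpace 𝓘(ℝ, E') p) :
    secondFund h g f p (u + v) w = secondFund h g f p u w + secondFund h g f p v w := by
  simp only [secondFund, nabla, covAlong_map_add hg, covAlong_map_add hh, map_add]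
  abel

lemma secondFund_smul_left (a : ℝ) (u v : TangentSpace 𝓘(ℝ, E') p) :
    secondFund h g f p (a • u) v = a • secondFund h g f p u v := by
  simp only [secondFund, nabla, covAlong_map_smul hg, covAlong_map_smul hh, map_smul, smul_sub]

lemma secondFund_add_right (u v w : TangentSpace 𝓘(ℝ, E') p) :
    secondFund h g f p u (v + w) = secondFund h g f p u v + secondFund h g f p u w := by
  rw [secondFund_symm hg hh hf, secondFund_add_left hg hh hf, secondFund_symm hg hh hf v,
    secondFund_symm hg hh hf w]

lemma secondFund_smul_right (a : ℝ) (u v : TangentSpace 𝓘(ℝ, E') p) :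
    secondFund h g f p u (a • v) = a • secondFund h g f p u v := by
  rw [secondFund_symm hg hh hf, secondFund_smul_left hg hh hf, secondFund_symm hg hh hf v]

/-- The derivative of the pulled-back metric in terms of the second fundamental form. -/
lemma mvfderiv_metric_pushforward {V W : (p : X) → TangentSpace 𝓘(ℝ, E') p}
    (hV : SmoothAlongNear E' (fun p : X => p) V p) (hW : SmoothAlongNear E' (fun p : X => p) W p)
    (u : TangentSpace 𝓘(ℝ, E') p) :
    mvfderiv 𝓘(ℝ, E') (fun p => g (f p) (mfderiv 𝓘(ℝ, E') 𝓘(ℝ, E) f p (V p))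
        (mfderiv 𝓘(ℝ, E') 𝓘(ℝ, E) f p (W p))) p u =
      g (f p) (secondFund h g f p u (V p)) (mfderiv 𝓘(ℝ, E') 𝓘(ℝ, E) f p (W p)) +
      g (f p) (mfderiv 𝓘(ℝ, E') 𝓘(ℝ, E) f p (nabla h V p u))
        (mfderiv 𝓘(ℝ, E') 𝓘(ℝ, E) f p (W p)) +
      g (f p) (mfderiv 𝓘(ℝ, E') 𝓘(ℝ, E) f p (V p)) (secondFund h g f p u (W p)) +
      g (f p) (mfderiv 𝓘(ℝ, E') 𝓘(ℝ, E) f p (V p))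
        (mfderiv 𝓘(ℝ, E') 𝓘(ℝ, E) f p (nabla h W p u)) := by
  rw [metric_compat hg (hV.pushforward_field hf) (hW.pushforward_field hf),
    secondFund_eq hg hh hf hV, secondFund_eq hg hh hf hW, hg.sub_left, hg.sub_right]
  ring

end

/-- Composition formula for covariant derivatives along maps. -/
theorem covAlong_comp_pushforward {k : Y → X} {V : (s : Y) → TangentSpace 𝓘(ℝ, E') (k s)} {s : Y}
    (hg : IsRiemannian g) (hh : IsRiemannian h)
    (hf : ∀ᶠ p' in 𝓝 (k s), ContMDiffAt 𝓘(ℝ, E') 𝓘(ℝ, E) ∞ f p') (hV : SmoothAlongNear E'' k V s)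
    (u : TangentSpace 𝓘(ℝ, E'') s) :
    covAlong g (fun s => f (k s)) (fun s => mfderiv 𝓘(ℝ, E') 𝓘(ℝ, E) f (k s) (V s)) s u =
      mfderiv 𝓘(ℝ, E') 𝓘(ℝ, E) f (k s) (covAlong h k V s u) +
        secondFund h g f (k s) (mfderiv 𝓘(ℝ, E'') 𝓘(ℝ, E') k s u) (V s) := by
  have hx := mem_chart_source E' (k s)
  refine SmoothAlongNear.induction (E' := E'') (motive := fun V =>
    covAlong g (fun s => f (k s)) (fun s => mfderiv 𝓘(ℝ, E') 𝓘(ℝ, E) f (k s) (V s)) s u =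
      mfderiv 𝓘(ℝ, E') 𝓘(ℝ, E) f (k s) (covAlong h k V s u) +
        secondFund h g f (k s) (mfderiv 𝓘(ℝ, E'') 𝓘(ℝ, E') k s u) (V s)) (k s) hx ?_ ?_ ?_ ?_ hV
  · intro v
    have hs := smoothAlongNear_coordField hx v
    have hk := hV.map.self_of_nhds.mdifferentiableAt (n := ∞) (by simp)
    have h2 := covAlong_comp (g := g) (hs.pushforward_field hf).self hk u
    have h3 := covAlong_field (g := h) hs.self hk u
    rw [secondFund_eq hg hh hf hs, h3]
    exact h2.trans (by abel)
  · intro W₁ W₂ h1 h2 e1 e2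
    simp only [map_add]
    rw [covAlong_add hg (SmoothAlongNear.pushforward hf h1).self
      (SmoothAlongNear.pushforward hf h2).self, covAlong_add hh h1.self h2.self, e1, e2, map_add,
      secondFund_add_right hg hh hf]
    abel
  · intro a W₁ ha h1 e1
    simp only [map_smul]
    rw [covAlong_smul hg ha.self_of_nhds (SmoothAlongNear.pushforward hf h1).self,
      covAlong_smul hh ha.self_of_nhds h1.self, e1, map_add, map_smul, map_smul,
      secondFund_smul_right hg hh hf, smul_add]
    abel
  · intro W₁ W₂ h1 h2 e1
    rw [← covAlong_congr (V := W₁) h2, ← h2.self_of_nhds, ← e1]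
    exact (covAlong_congr (h2.mono fun p' hp => by rw [hp]) u).symm

/-- The second fundamental form of an isometric immersion is normal. -/
theorem secondFund_normal (hg : IsRiemannian g) (hh : IsRiemannian (inducedMetric g f : MetricTensor E' X))
    (hf : ∀ᶠ p' in 𝓝 p, ContMDiffAt 𝓘(ℝ, E') 𝓘(ℝ, E) ∞ f p') (u v w : TangentSpace 𝓘(ℝ, E') p) :
    g (f p) (secondFund (inducedMetric g f) g f p u v) (mfderiv 𝓘(ℝ, E') 𝓘(ℝ, E) f p w) = 0 := by
  set T : TangentSpace 𝓘(ℝ, E') p → TangentSpace 𝓘(ℝ, E') p → TangentSpace 𝓘(ℝ, E') p → ℝ :=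
    fun u v w => g (f p) (secondFund (inducedMetric g f) g f p u v)
      (mfderiv 𝓘(ℝ, E') 𝓘(ℝ, E) f p w) with hT
  have hsymm : ∀ u v w, T u v w = T v u w := fun u v w => by
    simp only [hT, secondFund_symm hg hh hf u v]
  have hanti : ∀ u v w, T u v w = -T u w v := by
    intro u v w
    have sv := smoothAlongNear_extendVector p v
    have sw := smoothAlongNear_extendVector p w
    have h1 := mvfderiv_metric_pushforward hg hh hf sv sw u
    have h2 := metric_compat hh sv sw u
    have h3 : mvfderiv 𝓘(ℝ, E') (fun p' => inducedMetric g f p' (extendVector p v p')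
      (extendVector p w p')) p u = mvfderiv 𝓘(ℝ, E') (fun p' => g (f p')
        (mfderiv 𝓘(ℝ, E') 𝓘(ℝ, E) f p' (extendVector p v p'))
        (mfderiv 𝓘(ℝ, E') 𝓘(ℝ, E) f p' (extendVector p w p'))) p u := rfl
    rw [h3, h1, extendVector_self, extendVector_self] at h2
    have h4 : inducedMetric g f p (covAlong (inducedMetric g f) (fun y : X => y)
        (extendVector p v) p u) w = g (f p) (mfderiv 𝓘(ℝ, E') 𝓘(ℝ, E) f p
        (nabla (inducedMetric g f) (extendVector p v) p u)) (mfderiv 𝓘(ℝ, E') 𝓘(ℝ, E) f p w) := rfl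
    have h5 : inducedMetric g f p v (covAlong (inducedMetric g f) (fun y : X => y)
        (extendVector p w) p u) = g (f p) (mfderiv 𝓘(ℝ, E') 𝓘(ℝ, E) f p v)
        (mfderiv 𝓘(ℝ, E') 𝓘(ℝ, E) f p (nabla (inducedMetric g f) (extendVector p w) p u)) := rfl
    rw [h4, h5] at h2
    simp only [hT]
    rw [hg.symm _ (secondFund _ g f p u w)]
    linarith
  -- A trilinear expression symmetric in the first two arguments and skew in the last two vanishes:
  -- alternating the two symmetries returns to the original arguments with the opposite sign.
  have h1 := hanti u v w
  have h2 := hanti v w u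
  have h3 := hanti w u v
  have h4 := hsymm u v w
  have h5 := hsymm v w u
  have h6 := hsymm w u v
  change T u v w = 0
  linarith

end Hessian

/-! ### Metric traces in orthonormal bases -/

section Trace

variable {E : Type*} [NormedAddCommGroup E] [NormedSpace ℝ E] [FiniteDimensional ℝ E]
  {M : Type*} [TopologicalSpace M] [ChartedSpace E M] [IsManifold 𝓘(ℝ, E) ∞ M]
  {g : MetricTensor E M} (hg : IsRiemannian g) {p : M}
include hg

lemma eq_sum_orthonormal {ι : Type*} [Fintype ι] [DecidableEq ι]
    (hι : Fintype.card ι = Module.finrank ℝ E) (e : ι → TangentSpace 𝓘(ℝ, E) p)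
    (he : ∀ i j, g p (e i) (e j) = if i = j then 1 else 0) (v : TangentSpace 𝓘(ℝ, E) p) :
    v = ∑ k, g p v (e k) • e k := by
  have hli : LinearIndependent ℝ e := by
    rw [Fintype.linearIndependent_iff]
    intro c hc i
    have h1 : g p (∑ k, c k • e k) (e i) = c i := by
      simp [hg.sum_left, hg.smul_left, he]
    rw [← h1, hc, hg.zero_left]
  let b := basisOfLinearIndependentOfCardEqFinrank' e hli hι
  obtain ⟨c, hc⟩ : ∃ c : ι → ℝ, v = ∑ k, c k • e k :=
    ⟨b.repr v, (b.sum_repr v).symm.trans (Finset.sum_congr rfl fun k _ =>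
      congrArg (fun w => b.repr v k • w)
        (congrFun (coe_basisOfLinearIndependentOfCardEqFinrank' e hli hι) k))⟩
  have h1 : ∀ i, g p v (e i) = c i := by
    intro i
    rw [hc]
    simp [hg.sum_left, hg.smul_left, he]
  simp only [h1]
  exact hc

/-- The trace is defined with a chosen basis. The given e shows that an orthonormal basis exists, so
the choice is one; the coefficients between the two bases form an orthogonal matrix (`hcoef`), which
cancels in the bilinear expression. -/
lemma metricTrace_eq_sum {ι : Type*} [Fintype ι] [DecidableEq ι]
    (hι : Fintype.card ι = Module.finrank ℝ E) (e : ι → TangentSpace 𝓘(ℝ, E) p)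
    (he : ∀ i j, g p (e i) (e j) = if i = j then 1 else 0) {V : Type*} [AddCommGroup V] [Module ℝ V]
    (b : TangentSpace 𝓘(ℝ, E) p → TangentSpace 𝓘(ℝ, E) p → V)
    (hb₁ : ∀ u v w, b (u + v) w = b u w + b v w) (hb₂ : ∀ (a : ℝ) u v, b (a • u) v = a • b u v)
    (hb₃ : ∀ u v w, b u (v + w) = b u v + b u w) (hb₄ : ∀ (a : ℝ) u v, b u (a • v) = a • b u v) :
    metricTrace g p b = ∑ k, b (e k) (e k) := by
  have hsum₁ : ∀ (s : Finset ι) (u : ι → TangentSpace 𝓘(ℝ, E) p) v,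
      b (∑ k ∈ s, u k) v = ∑ k ∈ s, b (u k) v := by
    intro s u v
    exact map_sum (IsLinearMap.mk' (fun u => b u v) ⟨fun x y => hb₁ x y v, fun a x => hb₂ a x v⟩) _ _
  have hsum₂ : ∀ (s : Finset ι) (u : ι → TangentSpace 𝓘(ℝ, E) p) v,
      b v (∑ k ∈ s, u k) = ∑ k ∈ s, b v (u k) := by
    intro s u v
    exact map_sum (IsLinearMap.mk' (fun u => b v u) ⟨fun x y => hb₃ v x y, fun a x => hb₄ a v x⟩) _ _
  set o := orthonormalBasisAt g p with ho
  have hspec : ∀ i j, g p (o i) (o j) = if i = j then 1 else 0 := by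
    refine Classical.epsilon_spec (p := fun e : Fin (Module.finrank ℝ E) → TangentSpace 𝓘(ℝ, E) p =>
      ∀ i j, g p (e i) (e j) = if i = j then 1 else 0) ?_
    let σ := (Fintype.equivFinOfCardEq hι).symm
    refine ⟨fun k => e (σ k), fun i j => ?_⟩
    rw [he]
    simp
  have hcoef : ∀ i j, ∑ k, g p (o k) (e i) * g p (o k) (e j) = if i = j then 1 else 0 := by
    intro i j
    rw [← he]
    conv_rhs => rw [eq_sum_orthonormal hg (Fintype.card_fin _) o hspec (e i)]
    rw [hg.sum_left]
    refine Finset.sum_congr rfl fun k _ => ?_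
    rw [hg.smul_left, hg.symm p (e i)]
  have h1 : ∀ k, b (o k) (o k) = ∑ i, ∑ j, (g p (o k) (e i) * g p (o k) (e j)) • b (e i) (e j) := by
    intro k
    conv_lhs => rw [eq_sum_orthonormal hg hι e he (o k)]
    rw [hsum₁]
    refine Finset.sum_congr rfl fun i _ => ?_
    rw [hsum₂]
    refine Finset.sum_congr rfl fun j _ => ?_
    rw [hb₂, hb₄, smul_smul]
  unfold metricTrace
  rw [← ho]
  simp only [h1]
  rw [Finset.sum_comm]
  refine Finset.sum_congr rfl fun i _ => ?_
  rw [Finset.sum_comm]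
  simp only [← Finset.sum_smul, hcoef]
  simp

end Trace

/-! ### The ambient, line and induced metrics as Riemannian metrics -/

section Instances

variable {E : Type*} [NormedAddCommGroup E] [NormedSpace ℝ E]
  {M : Type*} [TopologicalSpace M] [ChartedSpace E M] [IsManifold 𝓘(ℝ, E) ∞ M]
  {E' : Type*} [NormedAddCommGroup E'] [NormedSpace ℝ E']
  {X : Type*} [TopologicalSpace X] [ChartedSpace E' X] [IsManifold 𝓘(ℝ, E') ∞ X]

lemma SmoothMetric.isRiemannian (g : SmoothMetric E M) : IsRiemannian g.tensor where
  add_left x u v w := by simp [SmoothMetric.tensor]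
  smul_left x a u v := by simp [SmoothMetric.tensor]
  symm x u v := g.symm x u v
  pos x u hu := g.pos x u hu
  smooth x v w y hy := by
    have h := ContMDiffAt.clm_bundle_apply₂ (b := fun y : M => y) (ψ := fun y => g.inner y)
      (E₃ := Bundle.Trivial M ℝ) (n := ∞)
      (g.contMDiff y) (smoothAlongAt_coordField hy v) (smoothAlongAt_coordField hy w)
    exact ((Bundle.contMDiffAt_totalSpace (F := ℝ) (E := Bundle.Trivial M ℝ)).1 h).2

lemma isRiemannian_lineMetric : IsRiemannian lineMetric where
  add_left x u v w := by
    change ℝ at u v w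
    exact add_mul u v w
  smul_left x a u v := by
    change ℝ at u v
    exact mul_assoc a u v
  symm x u v := by
    change ℝ at u v
    exact mul_comm u v
  pos x u hu := mul_self_pos.2 hu
  smooth x v w y hy := by
    simp only [coordField, lineMetric, TangentBundle.symmL_model_space]
    exact contMDiffAt_const (c := v * w)

lemma isRiemannian_inducedMetric [FiniteDimensional ℝ E] {g : MetricTensor E M}
    (hg : IsRiemannian g) {f : X → M}
    (hf : ContMDiff 𝓘(ℝ, E') 𝓘(ℝ, E) ∞ f)
    (hinj : ∀ p, Function.Injective (mfderiv 𝓘(ℝ, E') 𝓘(ℝ, E) f p)) :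
    IsRiemannian (inducedMetric g f : MetricTensor E' X) where
  add_left x u v w := by simp only [inducedMetric, map_add, hg.add_left]
  smul_left x a u v := by simp only [inducedMetric, map_smul, hg.smul_left]
  symm x u v := hg.symm _ _ _
  pos x u hu := hg.pos _ _ fun h => hu (hinj x (h.trans (map_zero _).symm))
  smooth x v w y hy :=
    hg.contMDiffAt ((smoothAlongAt_coordField hy v).pushforward (k := fun y : X => y) (hf y))
      ((smoothAlongAt_coordField hy w).pushforward (k := fun y : X => y) (hf y))

end Instances

/-! ### Curvature tensor: tensoriality, skew-symmetries, Bianchi identity -/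

section Curvature

variable {E : Type*} [NormedAddCommGroup E] [NormedSpace ℝ E] [FiniteDimensional ℝ E]
  {M : Type*} [TopologicalSpace M] [ChartedSpace E M] [IsManifold 𝓘(ℝ, E) ∞ M]
  {g : MetricTensor E M} (hg : IsRiemannian g) {x : M}

/-- The curvature `R(u, v)Z` of a vector field `Z`, for vectors `u`, `v` extended to coordinate
fields. -/
noncomputable def curvatureOn (g : MetricTensor E M) (x : M) (u v : TangentSpace 𝓘(ℝ, E) x)
    (Z : (y : M) → TangentSpace 𝓘(ℝ, E) y) : TangentSpace 𝓘(ℝ, E) x :=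
  nabla g (fun y => nabla g Z y (extendVector x v y)) x u
    - nabla g (fun y => nabla g Z y (extendVector x u y)) x v

include hg

lemma curvature_eq_curvatureOn (u v w : TangentSpace 𝓘(ℝ, E) x) :
    curvature g x u v w = curvatureOn g x u v (extendVector x w) := by
  have h0 : nabla g (extendVector x w) x 0 = 0 := by
    have := covAlong_map_smul hg (f := fun y : M => y) (p := x) (extendVector x w) 0
      (0 : TangentSpace 𝓘(ℝ, E) x)
    simpa [nabla] using this
  simp only [curvature, curvatureField, curvatureOn, mlieBracket_extendVector, extendVector_self, h0,
    sub_zero]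

lemma smoothAlongNear_nabla {Z A : (y : M) → TangentSpace 𝓘(ℝ, E) y}
    (hZ : SmoothAlongNear E (fun y : M => y) Z x) (hA : SmoothAlongNear E (fun y : M => y) A x) :
    SmoothAlongNear E (fun y : M => y) (fun y => nabla g Z y (A y)) x :=
  SmoothAlongNear.covAlong hg hZ hA

/-- Coordinate derivatives of the function g(Z, W) commute. Expanding both orders by metric
compatibility, the mixed products of first derivatives cancel and the curvature terms remain. -/
lemma curvatureOn_metric (u v : TangentSpace 𝓘(ℝ, E) x) {Z W : (y : M) → TangentSpace 𝓘(ℝ, E) y}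
    (hZ : SmoothAlongNear E (fun y : M => y) Z x) (hW : SmoothAlongNear E (fun y : M => y) W x) :
    g x (curvatureOn g x u v Z) (W x) = - g x (Z x) (curvatureOn g x u v W) := by
  have hF := hg.smoothNear hZ hW
  have hx := mem_chart_source E x
  have hcomm := mvfderiv_coordField_comm hx hF (coordComponents x x u) (coordComponents x x v)
  rw [coordField_coordComponents hx, coordField_coordComponents hx] at hcomm
  have key : ∀ u v : TangentSpace 𝓘(ℝ, E) x, mvfderiv 𝓘(ℝ, E) (fun z => mvfderiv 𝓘(ℝ, E)
      (fun y => g y (Z y) (W y)) z (extendVector x v z)) x u =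
      g x (nabla g (fun y => nabla g Z y (extendVector x v y)) x u) (W x) +
      g x (nabla g Z x v) (nabla g W x u) + (g x (nabla g Z x u) (nabla g W x v) +
      g x (Z x) (nabla g (fun y => nabla g W y (extendVector x v y)) x u)) := by
    intro u v
    have hv := smoothAlongNear_extendVector x v
    have h1 : ∀ᶠ z in 𝓝 x, mvfderiv 𝓘(ℝ, E) (fun y => g y (Z y) (W y)) z (extendVector x v z) =
        g z (nabla g Z z (extendVector x v z)) (W z) +
          g z (Z z) (nabla g W z (extendVector x v z)) := by
      filter_upwards [hZ.eventually, hW.eventually] with z h2 h3 using metric_compat hg h2 h3 _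
    have sZ := smoothAlongNear_nabla hg hZ hv
    have sW := smoothAlongNear_nabla hg hW hv
    rw [mvfderiv_congr h1, mvfderiv_fun_add
      ((hg.contMDiffAt sZ.self hW.self).mdifferentiableAt (by simp))
      ((hg.contMDiffAt hZ.self sW.self).mdifferentiableAt (by simp)), add_apply,
      metric_compat hg sZ hW, metric_compat hg hZ sW, extendVector_self]
    rfl
  have h1 := key u v
  have h2 := key v u
  have h3 : mvfderiv 𝓘(ℝ, E) (fun z => mvfderiv 𝓘(ℝ, E)
      (fun y => g y (Z y) (W y)) z (extendVector x v z)) x u = mvfderiv 𝓘(ℝ, E)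
      (fun z => mvfderiv 𝓘(ℝ, E) (fun y => g y (Z y) (W y)) z (extendVector x u z)) x v := hcomm
  rw [h1, h2] at h3
  simp only [curvatureOn, hg.sub_left, hg.sub_right]
  linarith

/-- `R(u, v)Z` depends only on the value of `Z` at the point. -/
lemma curvatureOn_eq (u v : TangentSpace 𝓘(ℝ, E) x) {Z : (y : M) → TangentSpace 𝓘(ℝ, E) y}
    (hZ : SmoothAlongNear E (fun y : M => y) Z x) :
    curvatureOn g x u v Z = curvature g x u v (Z x) := by
  refine hg.eq_of_forall fun w => ?_
  have hw := smoothAlongNear_extendVector x w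
  -- Skew-symmetry moves the curvature onto the extension of w, and Z then enters only through its
  -- value at x.
  have h1 := curvatureOn_metric hg u v hZ hw
  have h2 := curvatureOn_metric hg u v (smoothAlongNear_extendVector x (Z x)) hw
  rw [extendVector_self] at h1 h2
  rw [curvature_eq_curvatureOn hg, h1, h2, extendVector_self]

lemma curvature_metric (u v w z : TangentSpace 𝓘(ℝ, E) x) :
    g x (curvature g x u v w) z = - g x w (curvature g x u v z) := by
  have h := curvatureOn_metric hg u v (smoothAlongNear_extendVector x w)
    (smoothAlongNear_extendVector x z)
  rwa [extendVector_self, extendVector_self, ← curvature_eq_curvatureOn hg,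
    ← curvature_eq_curvatureOn hg] at h

lemma curvature_antisymm (u v w : TangentSpace 𝓘(ℝ, E) x) :
    curvature g x u v w = - curvature g x v u w := by
  rw [curvature_eq_curvatureOn hg, curvature_eq_curvatureOn hg, curvatureOn, curvatureOn, neg_sub]

/-- Skew-symmetry turns linearity in the last argument into linearity of the metric. -/
lemma curvature_add_right (u v w z : TangentSpace 𝓘(ℝ, E) x) :
    curvature g x u v (w + z) = curvature g x u v w + curvature g x u v z := by
  refine hg.eq_of_forall fun t => ?_
  rw [hg.add_left, curvature_metric hg, curvature_metric hg u v w, curvature_metric hg u v z,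
    hg.add_left]
  ring

lemma curvature_smul_right (a : ℝ) (u v w : TangentSpace 𝓘(ℝ, E) x) :
    curvature g x u v (a • w) = a • curvature g x u v w := by
  refine hg.eq_of_forall fun t => ?_
  rw [hg.smul_left, curvature_metric hg, curvature_metric hg u v w, hg.smul_left]
  ring

lemma curvature_add_left (u v w z : TangentSpace 𝓘(ℝ, E) x) :
    curvature g x (u + v) w z = curvature g x u w z + curvature g x v w z := by
  have hz := smoothAlongNear_extendVector x z
  have h1 : ∀ y, nabla g (extendVector x z) y (extendVector x (u + v) y) =
      nabla g (extendVector x z) y (extendVector x u y) +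
      nabla g (extendVector x z) y (extendVector x v y) := fun y => by
    rw [extendVector_add]; exact covAlong_map_add hg _ _ _
  have h2 : nabla g (fun y => nabla g (extendVector x z) y (extendVector x u y) +
      nabla g (extendVector x z) y (extendVector x v y)) x w = _ :=
    covAlong_add hg (smoothAlongNear_nabla hg hz (smoothAlongNear_extendVector x u)).self
      (smoothAlongNear_nabla hg hz (smoothAlongNear_extendVector x v)).self w
  have h3 : nabla g (fun y => nabla g (extendVector x z) y (extendVector x w y)) x (u + v) = _ :=
    covAlong_map_add hg _ _ _
  simp only [curvature_eq_curvatureOn hg, curvatureOn, h1]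
  rw [h2, h3]
  simp only [nabla]
  abel

lemma curvature_smul_left (a : ℝ) (u w z : TangentSpace 𝓘(ℝ, E) x) :
    curvature g x (a • u) w z = a • curvature g x u w z := by
  have hz := smoothAlongNear_extendVector x z
  have h1 : ∀ y, nabla g (extendVector x z) y (extendVector x (a • u) y) =
      a • nabla g (extendVector x z) y (extendVector x u y) := fun y => by
    rw [extendVector_smul]; exact covAlong_map_smul hg _ _ _
  have h2 : nabla g (fun y => a • nabla g (extendVector x z) y (extendVector x u y)) x w = _ :=
    covAlong_smul hg (a := fun _ => a) contMDiffAt_const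
      (smoothAlongNear_nabla hg hz (smoothAlongNear_extendVector x u)).self w
  have h3 : nabla g (fun y => nabla g (extendVector x z) y (extendVector x w y)) x (a • u) = _ :=
    covAlong_map_smul hg _ _ _
  rw [mvfderiv_const, zero_apply, zero_smul, zero_add] at h2
  simp only [curvature_eq_curvatureOn hg, curvatureOn, h1]
  rw [h2, h3]
  simp only [nabla, smul_sub]

lemma curvature_smul_mid (a : ℝ) (u w z : TangentSpace 𝓘(ℝ, E) x) :
    curvature g x w (a • u) z = a • curvature g x w u z := by
  rw [curvature_antisymm hg, curvature_smul_left hg, curvature_antisymm hg w u, smul_neg]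

/-- First Bianchi identity. -/
lemma curvature_bianchi (u v w : TangentSpace 𝓘(ℝ, E) x) :
    curvature g x u v w + curvature g x v w u + curvature g x w u v = 0 := by
  have hc : ∀ (u v t : TangentSpace 𝓘(ℝ, E) x),
      nabla g (fun y => nabla g (extendVector x u) y (extendVector x v y)) x t =
      nabla g (fun y => nabla g (extendVector x v) y (extendVector x u y)) x t := by
    intro u v t
    refine covAlong_congr ?_ t
    filter_upwards [(chartAt E x).open_source.mem_nhds (mem_chart_source E x)] with y hy
    exact nabla_coordField_comm hg hy _ _
  simp only [curvature_eq_curvatureOn hg, curvatureOn]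
  rw [hc w v u, hc w u v, hc u v w]
  abel

end Curvature

/-! ### Algebra of contact metric structures -/

section ContactAlgebra

variable {E : Type*} [NormedAddCommGroup E] [NormedSpace ℝ E] [FiniteDimensional ℝ E]
  {M : Type*} [TopologicalSpace M] [ChartedSpace E M] [IsManifold 𝓘(ℝ, E) ∞ M]
  {E' : Type*} [NormedAddCommGroup E'] [NormedSpace ℝ E']
  {X : Type*} [TopologicalSpace X] [ChartedSpace E' X] [IsManifold 𝓘(ℝ, E') ∞ X]
  {φ : (x : M) → TangentSpace 𝓘(ℝ, E) x →L[ℝ] TangentSpace 𝓘(ℝ, E) x}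
  {ξ : (x : M) → TangentSpace 𝓘(ℝ, E) x} {η : (x : M) → TangentSpace 𝓘(ℝ, E) x →L[ℝ] ℝ}
  {g : SmoothMetric E M}

namespace IsContactMetric

variable (hM : IsContactMetric φ ξ η g)
include hM

/-- The formula for φ² gives φ²ξ = 0; applied to φξ, it makes φξ a multiple aξ with a = η(φξ). Then
0 = φ²ξ = a²ξ, so a = 0. -/
lemma φ_ξ (x : M) : φ x (ξ x) = 0 := by
  have h1 : φ x (φ x (ξ x)) = 0 := by rw [hM.φ_sq, hM.η_ξ, one_smul, neg_add_cancel]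
  have h2 : φ x (ξ x) = η x (φ x (ξ x)) • ξ x := by
    have h := hM.φ_sq x (φ x (ξ x))
    rw [h1, map_zero] at h
    exact (neg_add_eq_zero.1 h.symm)
  have h3 : η x (φ x (ξ x)) = 0 := by
    rw [h2, map_smul, h2, smul_smul] at h1
    have h := congrArg (η x) h1
    simpa [hM.η_ξ] using h
  rw [h2, h3, zero_smul]

lemma metric_ξ (x : M) (v : TangentSpace 𝓘(ℝ, E) x) : g.tensor x (ξ x) v = η x v := by
  have h := hM.compatible x (ξ x) v
  rw [hM.φ_ξ, hM.η_ξ, map_zero, zero_apply, one_mul] at h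
  exact (sub_eq_zero.1 h.symm)

lemma η_φ (x : M) (v : TangentSpace 𝓘(ℝ, E) x) : η x (φ x v) = 0 := by
  have h1 := hM.φ_sq x (φ x v)
  rw [hM.φ_sq x v, map_add, map_neg, map_smul, hM.φ_ξ, smul_zero, add_zero] at h1
  have h2 := congrArg (η x) (left_eq_add.1 h1)
  simpa [hM.η_ξ] using h2

lemma metric_φ_φ (x : M) (u v : TangentSpace 𝓘(ℝ, E) x) :
    g.tensor x (φ x u) (φ x v) = g.tensor x u v - η x u * η x v := hM.compatible x u v

lemma metric_φ (x : M) (u v : TangentSpace 𝓘(ℝ, E) x) :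
    g.tensor x u (φ x v) = -g.tensor x (φ x u) v := by
  have hg := g.isRiemannian
  have h := hM.metric_φ_φ x u (φ x v)
  rw [hM.φ_sq, hM.η_φ, hg.add_right, hg.neg_right, hg.smul_right, hg.symm x _ (ξ x), hM.metric_ξ,
    hM.η_φ] at h
  linarith

lemma metric_φ_self (x : M) (u : TangentSpace 𝓘(ℝ, E) x) : g.tensor x u (φ x u) = 0 := by
  have h := hM.metric_φ x u u
  rw [g.isRiemannian.symm x (φ x u)] at h
  linarith

lemma smoothAlongAt_ξ {f : X → M} {p : X} (hf : ContMDiffAt 𝓘(ℝ, E') 𝓘(ℝ, E) ∞ f p) :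
    SmoothAlongAt E' f (fun p => ξ (f p)) p :=
  SmoothAlongAt.comp (k := f) (hM.smooth_ξ (f p)) hf

lemma smoothAlongAt_φ {f : X → M} {V : (p : X) → TangentSpace 𝓘(ℝ, E) (f p)} {p : X}
    (hV : SmoothAlongAt E' f V p) : SmoothAlongAt E' f (fun p => φ (f p) (V p)) p :=
  ContMDiffAt.clm_bundle_apply (b := f) (ϕ := fun p => φ (f p)) (n := ∞)
    ((hM.smooth_φ (f p)).comp p hV.contMDiffAt) hV

lemma smoothNear_η {f : X → M} {V : (p : X) → TangentSpace 𝓘(ℝ, E) (f p)} {p : X}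
    (hV : SmoothAlongNear E' f V p) : SmoothNear E' (fun p => η (f p) (V p)) p := by
  have h := g.isRiemannian.smoothNear (hV.map.mono fun p' h => hM.smoothAlongAt_ξ h) hV
  simpa only [hM.metric_ξ] using h

lemma metric_nabla_ξ_ξ (x : M) (u : TangentSpace 𝓘(ℝ, E) x) : η x (nabla g.tensor ξ x u) = 0 := by
  have hξ : SmoothAlongNear E (fun y : M => y) ξ x := Eventually.of_forall hM.smooth_ξ
  have h := metric_compat g.isRiemannian hξ hξ u
  simp only [hM.metric_ξ, hM.η_ξ] at h
  rw [mvfderiv_const, g.isRiemannian.symm x _ (ξ x), hM.metric_ξ] at h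
  simp only [zero_apply] at h
  simp only [nabla]
  linarith

/-- The contact condition in terms of the Levi-Civita connection. -/
lemma metric_φ_eq_nabla_ξ (x : M) (u v : TangentSpace 𝓘(ℝ, E) x) :
    2 * g.tensor x u (φ x v) =
      g.tensor x (nabla g.tensor ξ x u) v - g.tensor x (nabla g.tensor ξ x v) u := by
  have hξ : SmoothAlongNear E (fun y : M => y) ξ x := Eventually.of_forall hM.smooth_ξ
  have su := smoothAlongNear_extendVector x u
  have sv := smoothAlongNear_extendVector x v
  have h1 := hM.contact _ _ x su.self sv.self
  rw [extDeriv₁, mlieBracket_extendVector, map_zero, sub_zero, extendVector_self,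
    extendVector_self] at h1
  have h2 := metric_compat g.isRiemannian hξ sv u
  have h3 := metric_compat g.isRiemannian hξ su v
  simp only [hM.metric_ξ] at h2 h3
  have hx := mem_chart_source E x
  have h4 := nabla_coordField_comm g.isRiemannian hx (coordComponents x x u) (coordComponents x x v)
  rw [coordField_coordComponents hx, coordField_coordComponents hx] at h4
  have h5 : covAlong g.tensor (fun y : M => y) (extendVector x v) x u =
    covAlong g.tensor (fun y : M => y) (extendVector x u) x v := h4
  rw [h2, h3, h5, extendVector_self, extendVector_self] at h1
  have h6 : g.inner x u (φ x v) = g.tensor x u (φ x v) := rfl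
  rw [h6] at h1
  simp only [nabla]
  linarith

end IsContactMetric

end ContactAlgebra

/-! ### The vertical direction of the orbit fibration -/

section Fibration

variable {M : Type*} [TopologicalSpace M] [ChartedSpace (Euc 3) M] [IsManifold (𝓡 3) ∞ M]
  {N : Type*} [TopologicalSpace N] [ChartedSpace (Euc 2) N] [IsManifold (𝓡 2) ∞ N]
  {φ : (x : M) → TangentSpace (𝓡 3) x →L[ℝ] TangentSpace (𝓡 3) x}
  {ξ : (x : M) → TangentSpace (𝓡 3) x} {η : (x : M) → TangentSpace (𝓡 3) x →L[ℝ] ℝ}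
  {g : SmoothMetric (Euc 3) M} {h : SmoothMetric (Euc 2) N}
  {J : (y : N) → TangentSpace (𝓡 2) y →L[ℝ] TangentSpace (𝓡 2) y} {π : M → N}

namespace IsOrbitFibration

variable (hM : IsContactMetric φ ξ η g) (hπ : IsOrbitFibration φ ξ η g h J π)
include hM hπ

/-- Points of one orbit have the same image, so π is constant along a local integral curve of ξ;
differentiate there. -/
lemma mfderiv_ξ (x : M) : mfderiv (𝓡 3) (𝓡 2) π x (ξ x) = 0 := by
  obtain ⟨σ, hσ0, hσ⟩ := exists_isMIntegralCurveAt_of_contMDiffAt_boundaryless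
    (I := 𝓡 3) (v := ξ) (t₀ := 0) (x₀ := x) ((hM.smooth_ξ x).of_le (by simp))
  rw [isMIntegralCurveAt_iff'] at hσ
  obtain ⟨ε, hε, hσ⟩ := hσ
  have h0 : (0 : ℝ) ∈ Metric.ball (0 : ℝ) ε := Metric.mem_ball_self hε
  have h1 : ∀ t ∈ Metric.ball (0 : ℝ) ε, π (σ t) = π x := by
    intro t ht
    refine ((hπ.fibres x (σ t)).2 ⟨σ, Metric.ball 0 ε, Metric.isOpen_ball, ?_, hσ, 0, h0, t, ht,
      hσ0, rfl⟩).symm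
    rw [Real.ball_eq_Ioo]
    exact Set.ordConnected_Ioo
  have h2 : (fun t => π (σ t)) =ᶠ[𝓝 0] fun _ => π x := by
    filter_upwards [Metric.ball_mem_nhds (0 : ℝ) hε] with t ht using h1 t ht
  have h3 : HasMFDerivAt 𝓘(ℝ, ℝ) (𝓡 3) σ 0 ((1 : ℝ →L[ℝ] ℝ).smulRight (ξ (σ 0))) :=
    (hσ 0 h0).hasMFDerivAt (Metric.ball_mem_nhds (0 : ℝ) hε)
  have h4 := ((hπ.smooth (σ 0)).mdifferentiableAt (by simp)).hasMFDerivAt.comp 0 h3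
  have h5 : HasMFDerivAt 𝓘(ℝ, ℝ) (𝓡 2) (fun t => π (σ t)) 0 0 :=
    (hasMFDerivAt_const (π x) (0 : ℝ)).congr_of_eventuallyEq h2
  have h6 := congrArg (fun L => L (1 : ℝ)) (hasMFDerivAt_unique h4 h5)
  subst hσ0
  have h7 : mfderiv (𝓡 3) (𝓡 2) π (σ 0) ((1 : ℝ) • ξ (σ 0)) = 0 := h6
  rwa [one_smul] at h7

end IsOrbitFibration

end Fibration

/-! ### Geometry of the Riemannian submersion onto the orbit space -/

section Fibration

variable {M : Type*} [TopologicalSpace M] [ChartedSpace (Euc 3) M] [IsManifold (𝓡 3) ∞ M]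
  {N : Type*} [TopologicalSpace N] [ChartedSpace (Euc 2) N] [IsManifold (𝓡 2) ∞ N]
  {φ : (x : M) → TangentSpace (𝓡 3) x →L[ℝ] TangentSpace (𝓡 3) x}
  {ξ : (x : M) → TangentSpace (𝓡 3) x} {η : (x : M) → TangentSpace (𝓡 3) x →L[ℝ] ℝ}
  {g : SmoothMetric (Euc 3) M} {h : SmoothMetric (Euc 2) N}
  {J : (y : N) → TangentSpace (𝓡 2) y →L[ℝ] TangentSpace (𝓡 2) y} {π : M → N}

namespace IsOrbitFibration

variable (hM : IsContactMetric φ ξ η g) (hπ : IsOrbitFibration φ ξ η g h J π)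
include hM hπ

/-- Subtracting vertical parts does not change images under dπ, and π is isometric on what remains.
The formula holds for all vectors, so it can be differentiated. -/
lemma metric_mfderiv (x : M) (u v : TangentSpace (𝓡 3) x) :
    h.tensor (π x) (mfderiv (𝓡 3) (𝓡 2) π x u) (mfderiv (𝓡 3) (𝓡 2) π x v) =
      g.tensor x u v - η x u * η x v := by
  have hg := g.isRiemannian
  have key : ∀ u, η x (u - η x u • ξ x) = 0 ∧
      mfderiv (𝓡 3) (𝓡 2) π x (u - η x u • ξ x) = mfderiv (𝓡 3) (𝓡 2) π x u := by
    intro u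
    rw [map_sub, map_smul, hM.η_ξ, map_sub, map_smul, hπ.mfderiv_ξ hM]
    simp
  have h1 : h.tensor (π x) (mfderiv (𝓡 3) (𝓡 2) π x (u - η x u • ξ x))
      (mfderiv (𝓡 3) (𝓡 2) π x (v - η x v • ξ x)) =
      g.tensor x (u - η x u • ξ x) (v - η x v • ξ x) := hπ.isometric x _ _ (key u).1 (key v).1
  rw [(key u).2, (key v).2, hg.sub_left, hg.sub_right, hg.sub_right, hg.smul_left, hg.smul_left,
    hg.smul_right, hg.smul_right, hM.metric_ξ, hM.metric_ξ, hg.symm x u (ξ x), hM.metric_ξ,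
    hM.η_ξ] at h1
  linarith

lemma eq_smul_ξ_of_mfderiv_eq_zero {x : M} {u : TangentSpace (𝓡 3) x}
    (hu : mfderiv (𝓡 3) (𝓡 2) π x u = 0) : u = η x u • ξ x := by
  have hg := g.isRiemannian
  rw [← sub_eq_zero]
  apply hg.eq_zero_of_self
  have h1 := hπ.metric_mfderiv hM x u u
  rw [hu, h.isRiemannian.zero_left] at h1
  rw [hg.sub_left, hg.sub_right, hg.sub_right, hg.smul_left, hg.smul_left,
    hg.smul_right, hg.smul_right, hM.metric_ξ, hM.metric_ξ, hg.symm x u (ξ x), hM.metric_ξ, hM.η_ξ]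
  linarith

lemma exists_horizontal (x : M) (w : TangentSpace (𝓡 2) (π x)) :
    ∃ v, η x v = 0 ∧ mfderiv (𝓡 3) (𝓡 2) π x v = w := by
  obtain ⟨v, hv⟩ := hπ.submersion x w
  refine ⟨v - η x v • ξ x, ?_, ?_⟩
  · rw [map_sub, map_smul, hM.η_ξ]; simp
  · rw [map_sub, map_smul, hπ.mfderiv_ξ hM, hv]; simp

lemma eq_of_mfderiv_eq {x : M} {u v : TangentSpace (𝓡 3) x} (hu : η x u = 0) (hv : η x v = 0)
    (huv : mfderiv (𝓡 3) (𝓡 2) π x u = mfderiv (𝓡 3) (𝓡 2) π x v) : u = v := by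
  have h1 := hπ.eq_smul_ξ_of_mfderiv_eq_zero hM (u := u - v) (by rw [map_sub, huv, sub_self])
  rw [map_sub, hu, hv, sub_self, zero_smul] at h1
  exact sub_eq_zero.1 h1

/-- Differentiate the pulled-back metric g - η ⊗ η on extensions of y and z. Both factors of the η
term vanish at x, so its derivative does too; metric compatibility of g removes the rest and leaves
the skew-symmetry. -/
lemma secondFund_antisymm {x : M} (u : TangentSpace (𝓡 3) x) {y z : TangentSpace (𝓡 3) x}
    (hy : η x y = 0) (hz : η x z = 0) :
    h.tensor (π x) (secondFund g.tensor h.tensor π x u y) (mfderiv (𝓡 3) (𝓡 2) π x z) =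
      - h.tensor (π x) (secondFund g.tensor h.tensor π x u z) (mfderiv (𝓡 3) (𝓡 2) π x y) := by
  have hg := g.isRiemannian
  have hh := h.isRiemannian
  have hs : ∀ᶠ x' in 𝓝 x, ContMDiffAt (𝓡 3) (𝓡 2) ∞ π x' := Eventually.of_forall hπ.smooth
  have sy := smoothAlongNear_extendVector x y
  have sz := smoothAlongNear_extendVector x z
  have h1 := mvfderiv_metric_pushforward hh hg hs sy sz u
  simp only [hπ.metric_mfderiv hM, extendVector_self] at h1
  have dη : ∀ {Y : (x : M) → TangentSpace (𝓡 3) x}, SmoothAlongNear (Euc 3) (fun y : M => y) Y x →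
      MDifferentiableAt (𝓡 3) 𝓘(ℝ, ℝ) (fun x' => η x' (Y x')) x := fun hY =>
    (hM.smoothNear_η hY).self_of_nhds.mdifferentiableAt (by simp)
  have hmul : MDifferentiableAt (𝓡 3) 𝓘(ℝ, ℝ)
      (fun x' => η x' (extendVector x y x') * η x' (extendVector x z x')) x :=
    (dη sy).mul (dη sz)
  rw [mvfderiv_fun_sub ((hg.contMDiffAt sy.self sz.self).mdifferentiableAt (by simp))
    hmul, mvfderiv_fun_mul (dη sy) (dη sz), extendVector_self, extendVector_self,
    hy, hz, zero_smul, zero_smul, add_zero, sub_zero, metric_compat hg sy sz u,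
    extendVector_self, extendVector_self] at h1
  simp only [nabla] at h1
  rw [hh.symm _ (secondFund _ _ π x u z)]
  linarith

/-- The field dπ(ξ) vanishes identically, so only the second term of the second fundamental form
survives. -/
lemma secondFund_ξ (x : M) (u : TangentSpace (𝓡 3) x) :
    secondFund g.tensor h.tensor π x u (ξ x) =
      - mfderiv (𝓡 3) (𝓡 2) π x (nabla g.tensor ξ x u) := by
  have hξ : SmoothAlongNear (Euc 3) (fun y : M => y) ξ x := Eventually.of_forall hM.smooth_ξ
  rw [secondFund_eq h.isRiemannian g.isRiemannian (Eventually.of_forall hπ.smooth) hξ]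
  simp only [hπ.mfderiv_ξ hM]
  rw [covAlong_zero h.isRiemannian, zero_sub]

/-- `∇_u ξ = -φ u`. -/
theorem nabla_ξ (x : M) (u : TangentSpace (𝓡 3) x) : nabla g.tensor ξ x u = -φ x u := by
  have hg := g.isRiemannian
  have hh := h.isRiemannian
  have hs : ∀ᶠ x' in 𝓝 x, ContMDiffAt (𝓡 3) (𝓡 2) ∞ π x' := Eventually.of_forall hπ.smooth
  -- The fibration makes ∇ξ skew on horizontal vectors, which is the Killing property. The contact
  -- condition prescribes the skew part of ∇ξ, so the two together determine it.
  have hor : ∀ {y z : TangentSpace (𝓡 3) x}, η x y = 0 → η x z = 0 →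
      g.tensor x (nabla g.tensor ξ x y) z = - g.tensor x (nabla g.tensor ξ x z) y := by
    intro y z hy hz
    have h1 := hπ.secondFund_antisymm hM (ξ x) hy hz
    rw [secondFund_symm hh hg hs (ξ x) y, secondFund_symm hh hg hs (ξ x) z, hπ.secondFund_ξ hM,
      hπ.secondFund_ξ hM, hh.neg_left, hh.neg_left, hπ.metric_mfderiv hM, hπ.metric_mfderiv hM,
      hy, hz] at h1
    linarith
  have hξ0 : nabla g.tensor ξ x (ξ x) = 0 := by
    apply hg.eq_zero_of_self
    have h1 := hM.metric_φ_eq_nabla_ξ x (ξ x) (nabla g.tensor ξ x (ξ x))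
    rw [hM.metric_ξ, hM.η_φ, hg.symm x _ (ξ x), hM.metric_ξ, hM.metric_nabla_ξ_ξ] at h1
    linarith
  have hdec : ∀ v : TangentSpace (𝓡 3) x, ∃ v', η x v' = 0 ∧ v = v' + η x v • ξ x := fun v =>
    ⟨v - η x v • ξ x, by rw [map_sub, map_smul, hM.η_ξ]; simp, by abel⟩
  obtain ⟨u', hu', hu⟩ := hdec u
  have h1 : nabla g.tensor ξ x u = nabla g.tensor ξ x u' := by
    conv_lhs => rw [hu]
    simp only [nabla] at hξ0 ⊢
    rw [covAlong_map_add hg, covAlong_map_smul hg, hξ0, smul_zero, add_zero]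
  have h2 : φ x u = φ x u' := by
    conv_lhs => rw [hu]
    rw [map_add, map_smul, hM.φ_ξ, smul_zero, add_zero]
  rw [h1, h2]
  refine hg.eq_of_forall fun w => ?_
  obtain ⟨w', hw', hw⟩ := hdec w
  rw [hw, hg.add_right, hg.add_right, hg.smul_right, hg.smul_right, hg.symm x _ (ξ x), hM.metric_ξ,
    hM.metric_nabla_ξ_ξ, hg.symm x _ (ξ x), hM.metric_ξ, map_neg, hM.η_φ, hg.neg_left]
  have h3 := hM.metric_φ_eq_nabla_ξ x u' w'
  have h4 := hor hu' hw'
  have h5 := hM.metric_φ x u' w'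
  linarith

/-- The second fundamental form of a Riemannian submersion vanishes on horizontal vectors. -/
theorem secondFund_horizontal {x : M} {y z : TangentSpace (𝓡 3) x} (hy : η x y = 0)
    (hz : η x z = 0) : secondFund g.tensor h.tensor π x y z = 0 := by
  have hg := g.isRiemannian
  have hh := h.isRiemannian
  have hs : ∀ᶠ x' in 𝓝 x, ContMDiffAt (𝓡 3) (𝓡 2) ∞ π x' := Eventually.of_forall hπ.smooth
  apply hh.eq_zero_of_self
  obtain ⟨t, ht, ht'⟩ := hπ.exists_horizontal hM x (secondFund g.tensor h.tensor π x y z)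
  -- Here t is the horizontal vector over the second fundamental form of y and z. Symmetry in the
  -- first two arguments and skewness in the last two again force the trilinear form to vanish, now
  -- on the horizontal vectors y, z, t.
  have h1 := hπ.secondFund_antisymm hM y hz ht
  have h2 := hπ.secondFund_antisymm hM z ht hy
  have h3 := hπ.secondFund_antisymm hM t hy hz
  rw [secondFund_symm hh hg hs y t] at h1
  rw [secondFund_symm hh hg hs z t, secondFund_symm hh hg hs z y] at h2
  rw [ht'] at h1 h2
  linarith

end IsOrbitFibration

end Fibration

/-! ### Derivative of φ and curvature of the Sasakian space form -/

section Sasakian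

variable {M : Type*} [TopologicalSpace M] [ChartedSpace (Euc 3) M] [IsManifold (𝓡 3) ∞ M]
  {φ : (x : M) → TangentSpace (𝓡 3) x →L[ℝ] TangentSpace (𝓡 3) x}
  {ξ : (x : M) → TangentSpace (𝓡 3) x} {η : (x : M) → TangentSpace (𝓡 3) x →L[ℝ] ℝ}
  {g : SmoothMetric (Euc 3) M}

namespace IsContactMetric

variable (hM : IsContactMetric φ ξ η g)
include hM

lemma orthonormal_frame {x : M} {e : TangentSpace (𝓡 3) x} (he : g.tensor x e e = 1)
    (hη : η x e = 0) (v : TangentSpace (𝓡 3) x) :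
    v = g.tensor x v e • e + g.tensor x v (φ x e) • φ x e + η x v • ξ x := by
  have hg := g.isRiemannian
  have h1 : g.tensor x e (ξ x) = 0 := by rw [hg.symm, hM.metric_ξ, hη]
  have h2 : g.tensor x (φ x e) (ξ x) = 0 := by rw [hg.symm, hM.metric_ξ, hM.η_φ]
  have h3 : g.tensor x (φ x e) (φ x e) = 1 := by rw [hM.metric_φ_φ, he, hη]; ring
  have h4 : g.tensor x (φ x e) e = 0 := by rw [hg.symm, hM.metric_φ_self]
  have h := eq_sum_orthonormal hg (ι := Fin 3) (p := x) (by simp) ![e, φ x e, ξ x] (by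
    intro i j
    fin_cases i <;> fin_cases j <;>
      simp [he, h1, h2, h3, h4, hM.metric_φ_self, hM.metric_ξ, hM.η_ξ, hM.η_φ, hη]) v
  rw [Fin.sum_univ_three] at h
  simp only [Matrix.cons_val_zero, Matrix.cons_val_one, Matrix.cons_val] at h
  rwa [hg.symm x v (ξ x), hM.metric_ξ] at h

variable (hξ : ∀ x u, nabla g.tensor ξ x u = -φ x u)
include hξ

/-- Derivative of the identity g(φY, Z) = -g(Y, φZ): the endomorphism ∇_u φ inherits skewness from
φ. -/
lemma nabla_φ_metric_antisymm {x : M} {Y Z : (x : M) → TangentSpace (𝓡 3) x}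
    (hY : SmoothAlongNear (Euc 3) (fun y : M => y) Y x)
    (hZ : SmoothAlongNear (Euc 3) (fun y : M => y) Z x) (u : TangentSpace (𝓡 3) x) :
    g.tensor x (nabla g.tensor (fun y => φ y (Y y)) x u - φ x (nabla g.tensor Y x u)) (Z x) =
      - g.tensor x (Y x)
        (nabla g.tensor (fun y => φ y (Z y)) x u - φ x (nabla g.tensor Z x u)) := by
  have hg := g.isRiemannian
  have sY : SmoothAlongNear (Euc 3) (fun y : M => y) (fun y => φ y (Y y)) x :=
    hY.mono fun _ h => hM.smoothAlongAt_φ h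
  have sZ : SmoothAlongNear (Euc 3) (fun y : M => y) (fun y => φ y (Z y)) x :=
    hZ.mono fun _ h => hM.smoothAlongAt_φ h
  have h1 := metric_compat hg sY hZ u
  have h2 := metric_compat hg hY sZ u
  have h3 : mvfderiv (𝓡 3) (fun y => g.tensor y (φ y (Y y)) (Z y)) x u =
      - mvfderiv (𝓡 3) (fun y => g.tensor y (Y y) (φ y (Z y))) x u := by
    simp only [hM.metric_φ]
    rw [mvfderiv_fun_neg]
    simp
  rw [h1, h2] at h3
  rw [hg.sub_left, hg.sub_right, hM.metric_φ x (Y x), ← neg_neg (g.tensor x (φ x _) (Z x)),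
    ← hM.metric_φ]
  simp only [nabla]
  linarith

lemma nabla_φ_ξ (x : M) (u : TangentSpace (𝓡 3) x) :
    nabla g.tensor (fun y => φ y (ξ y)) x u - φ x (nabla g.tensor ξ x u) = -u + η x u • ξ x := by
  have h1 : nabla g.tensor (fun y => φ y (ξ y)) x u = 0 := by
    simp only [hM.φ_ξ]
    exact covAlong_zero g.isRiemannian u
  rw [h1, hξ, map_neg, hM.φ_sq, zero_sub, neg_neg]

/-- Put P = (∇_u φ)Y. Skewness gives g(P, Y) = 0, and pairing with ξ gives η(P) = g(u, Y).
Differentiating |φY|² = |Y|² - η(Y)² at a point with η(Y) = 0 gives g(P, φY) = 0. In dimension three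
Y, φY and ξ span when Y ≠ 0, so only the ξ-component is left. -/
lemma nabla_φ_horizontal {x : M} {Y : (x : M) → TangentSpace (𝓡 3) x}
    (hY : SmoothAlongNear (Euc 3) (fun y : M => y) Y x) (hηY : η x (Y x) = 0)
    (u : TangentSpace (𝓡 3) x) :
    nabla g.tensor (fun y => φ y (Y y)) x u - φ x (nabla g.tensor Y x u) =
      g.tensor x u (Y x) • ξ x := by
  have hg := g.isRiemannian
  have sY : SmoothAlongNear (Euc 3) (fun y : M => y) (fun y => φ y (Y y)) x :=
    hY.mono fun _ h => hM.smoothAlongAt_φ h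
  have sξ : SmoothAlongNear (Euc 3) (fun y : M => y) ξ x := Eventually.of_forall hM.smooth_ξ
  have h1 := hM.nabla_φ_metric_antisymm hξ hY hY u
  have h2 := hM.nabla_φ_metric_antisymm hξ hY sξ u
  rw [hM.nabla_φ_ξ hξ] at h2
  have h3 : g.tensor x (nabla g.tensor (fun y => φ y (Y y)) x u - φ x (nabla g.tensor Y x u))
      (φ x (Y x)) = 0 := by
    have dη : MDifferentiableAt (𝓡 3) 𝓘(ℝ, ℝ) (fun x' => η x' (Y x')) x :=
      (hM.smoothNear_η hY).self_of_nhds.mdifferentiableAt (by simp)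
    have h4 := metric_compat hg sY sY u
    have h5 := metric_compat hg hY hY u
    simp only [hM.metric_φ_φ] at h4
    have hmul : MDifferentiableAt (𝓡 3) 𝓘(ℝ, ℝ) (fun x' => η x' (Y x') * η x' (Y x')) x :=
      dη.mul dη
    rw [mvfderiv_fun_sub ((hg.contMDiffAt hY.self hY.self).mdifferentiableAt (by simp))
      hmul, mvfderiv_fun_mul dη dη, hηY, zero_smul, add_zero, sub_zero, h5] at h4
    rw [hg.symm x (φ x (Y x)), hg.symm x (Y x)] at h4
    rw [hg.sub_left, hM.metric_φ_φ, hηY]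
    simp only [nabla]
    linarith
  set P := nabla g.tensor (fun y => φ y (Y y)) x u - φ x (nabla g.tensor Y x u) with hP
  have hPY : g.tensor x P (Y x) = 0 := by rw [hg.symm x (Y x)] at h1; linarith
  have hPξ : η x P = g.tensor x u (Y x) := by
    rw [hg.symm x P, hM.metric_ξ, hg.add_right, hg.neg_right, hg.smul_right,
      hg.symm x (Y x) (ξ x), hM.metric_ξ, hηY, hg.symm x (Y x) u] at h2
    linarith
  -- If Y vanishes at x there is no frame, but skewness against an extension of P itself gives g(P,
  -- P) = 0.
  by_cases hy : Y x = 0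
  · have h6 : g.tensor x P P = 0 := by
      have h7 := hM.nabla_φ_metric_antisymm hξ hY (smoothAlongNear_extendVector x P) u
      rwa [extendVector_self, hy, hg.zero_left, neg_zero] at h7
    rw [hg.eq_zero_of_self h6, hy, hg.zero_right, zero_smul]
  · have hpos := hg.pos x (Y x) hy
    set r := Real.sqrt (g.tensor x (Y x) (Y x)) with hr
    have hr0 : 0 < r := Real.sqrt_pos.2 hpos
    have hrr : r * r = g.tensor x (Y x) (Y x) := Real.mul_self_sqrt hpos.le
    have he : g.tensor x (r⁻¹ • Y x) (r⁻¹ • Y x) = 1 := by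
      rw [hg.smul_left, hg.smul_right, ← hrr]
      field_simp
    have h8 := hM.orthonormal_frame he (by rw [map_smul, hηY, smul_zero]) P
    rw [map_smul, hg.smul_right, hg.smul_right, hPY, h3, hPξ] at h8
    simpa using h8

/-- `(∇_u φ)Y = g(u, Y)ξ - η(Y)u`. -/
theorem nabla_φ {x : M} {Y : (x : M) → TangentSpace (𝓡 3) x}
    (hY : SmoothAlongNear (Euc 3) (fun y : M => y) Y x) (u : TangentSpace (𝓡 3) x) :
    nabla g.tensor (fun y => φ y (Y y)) x u =
      φ x (nabla g.tensor Y x u) + g.tensor x u (Y x) • ξ x - η x (Y x) • u := by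
  have hg := g.isRiemannian
  have sξ : SmoothAlongNear (Euc 3) (fun y : M => y) ξ x := Eventually.of_forall hM.smooth_ξ
  have sη := hM.smoothNear_η hY
  have sY' : SmoothAlongNear (Euc 3) (fun y : M => y) (fun y => Y y - η y (Y y) • ξ y) x :=
    hY.sub (sξ.smul sη)
  -- The field minus its ξ-part is horizontal and has the same image under φ; the derivative of the
  -- ξ-part supplies the correction terms.
  have h1 := hM.nabla_φ_horizontal hξ sY' (by rw [map_sub, map_smul, hM.η_ξ]; simp) u
  have h2 : ∀ y, φ y (Y y - η y (Y y) • ξ y) = φ y (Y y) := fun y => by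
    rw [map_sub, map_smul, hM.φ_ξ, smul_zero, sub_zero]
  have h3 : nabla g.tensor (fun y => Y y - η y (Y y) • ξ y) x u = _ :=
    covAlong_sub hg hY.self (sξ.smul sη).self u
  have h4 := covAlong_smul hg sη.self_of_nhds sξ.self u
  have h5 : covAlong g.tensor (fun y : M => y) ξ x u = -φ x u := hξ x u
  simp only [h2] at h1
  rw [h3, h4, h5, map_sub, map_add, map_smul, map_smul, map_neg, hM.φ_ξ, hM.φ_sq, smul_zero,
    zero_add, hg.sub_right, hg.smul_right, hg.symm x u (ξ x), hM.metric_ξ, sub_eq_iff_eq_add] at h1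
  rw [h1]
  simp only [nabla, smul_neg, smul_add, sub_smul, mul_smul]
  abel

/-- `R(u, v)ξ = η(v)u - η(u)v`. -/
theorem curvature_ξ (x : M) (u v : TangentSpace (𝓡 3) x) :
    curvature g.tensor x u v (ξ x) = η x v • u - η x u • v := by
  have hg := g.isRiemannian
  have sξ : SmoothAlongNear (Euc 3) (fun y : M => y) ξ x := Eventually.of_forall hM.smooth_ξ
  rw [← curvatureOn_eq hg u v sξ, curvatureOn]
  simp only [hξ]
  have h1 : ∀ u v : TangentSpace (𝓡 3) x,
      nabla g.tensor (fun y => -φ y (extendVector x v y)) x u =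
      -(φ x (nabla g.tensor (extendVector x v) x u) + g.tensor x u v • ξ x - η x v • u) := by
    intro u v
    have sv := smoothAlongNear_extendVector x v
    have h2 := hM.nabla_φ hξ sv u
    rw [extendVector_self] at h2
    rw [← h2]
    exact covAlong_neg hg (hM.smoothAlongAt_φ sv.self) u
  have hx := mem_chart_source (Euc 3) x
  have h4 := nabla_coordField_comm hg hx (coordComponents x x u) (coordComponents x x v)
  rw [coordField_coordComponents hx, coordField_coordComponents hx] at h4
  have h5 : nabla g.tensor (extendVector x v) x u = nabla g.tensor (extendVector x u) x v := h4
  rw [h1, h1, h5, hg.symm x u v]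
  abel

end IsContactMetric

/-- The curvature operator `R(·, φe)·` of a Sasakian space form on the span of `ξ` and a horizontal
unit vector `e`. -/
theorem IsSasakianSpaceForm.curvature_φ {c : ℝ} (hM : IsSasakianSpaceForm φ ξ η g c)
    (hξ : ∀ x u, nabla g.tensor ξ x u = -φ x u) {x : M} {e : TangentSpace (𝓡 3) x}
    (he : g.tensor x e e = 1) (hη : η x e = 0) (a b : ℝ) :
    curvature g.tensor x (a • ξ x + b • e) (φ x e) (a • ξ x + b • e) =
      -((a ^ 2 + c * b ^ 2) • φ x e) := by
  have hg := g.isRiemannian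
  have hC := hM.toIsContactMetric
  have hR := hC.curvature_ξ hξ x
  have h0 : g.tensor x (φ x e) (φ x e) = 1 := by rw [hC.metric_φ_φ, he, hη]; ring
  have h1 : g.tensor x (curvature g.tensor x e (φ x e) (φ x e)) e = c :=
    hM.φ_sectional x e he (by
      have h : g.tensor x e (ξ x) = 0 := by rw [hg.symm, hC.metric_ξ, hη]
      exact h)
  have self0 : ∀ u v w : TangentSpace (𝓡 3) x,
      g.tensor x (curvature g.tensor x u v w) w = 0 := by
    intro u v w
    have h := curvature_metric hg u v w w
    rw [hg.symm x w] at h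
    linarith
  have hξξ : curvature g.tensor x (ξ x) (φ x e) (ξ x) = -φ x e := by
    rw [hR, hC.η_φ, hC.η_ξ]; simp
  have heξ : curvature g.tensor x e (φ x e) (ξ x) = 0 := by
    rw [hR, hC.η_φ, hη]; simp
  -- Only the φe-component survives: the e-component by skewness, the ξ-component by `heξ`. The
  -- remaining one is -g(R(e, φe)φe, e) = -c.
  have hee : curvature g.tensor x e (φ x e) e = -(c • φ x e) := by
    rw [hC.orthonormal_frame he hη (curvature g.tensor x e (φ x e) e), self0,
      curvature_metric hg, hg.symm x e, h1, ← hC.metric_ξ, hg.symm x (ξ x), curvature_metric hg,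
      heξ, hg.zero_right]
    simp
  -- Since R(e, φe)ξ = 0, Bianchi gives R(ξ, φe)e = R(ξ, e)φe, which is orthogonal to φe. The
  -- e-component vanishes by skewness, and the ξ-component equals g(e, φe) = 0.
  have hξe : curvature g.tensor x (ξ x) (φ x e) e = 0 := by
    have hB := curvature_bianchi hg (ξ x) (φ x e) e
    rw [curvature_antisymm hg (φ x e) e, heξ, neg_zero, add_zero,
      curvature_antisymm hg e (ξ x)] at hB
    have hD : curvature g.tensor x (ξ x) (φ x e) e = curvature g.tensor x (ξ x) e (φ x e) := by
      rw [← sub_eq_zero, sub_eq_add_neg]; exact hB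
    rw [hC.orthonormal_frame he hη (curvature g.tensor x (ξ x) (φ x e) e), self0]
    have h2 : g.tensor x (curvature g.tensor x (ξ x) (φ x e) e) (φ x e) = 0 := by rw [hD, self0]
    have h3 : η x (curvature g.tensor x (ξ x) (φ x e) e) = 0 := by
      rw [← hC.metric_ξ, hg.symm x (ξ x), curvature_metric hg, hξξ, hg.neg_right,
        hC.metric_φ_self]
      simp
    rw [h2, h3]
    simp
  simp only [curvature_add_left hg, curvature_smul_left hg, curvature_add_right hg,
    curvature_smul_right hg, hξξ, heξ, hee, hξe]
  simp only [smul_zero, add_zero, zero_add, smul_neg, smul_smul, add_smul, neg_add]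
  congr 2
  · rw [pow_two]
  · congr 1; ring

end Sasakian

/-! ### Tension and bitension in frames of geodesic fields -/

section Trace

variable {E : Type*} [NormedAddCommGroup E] [NormedSpace ℝ E] [FiniteDimensional ℝ E]
  {M : Type*} [TopologicalSpace M] [ChartedSpace E M] [IsManifold 𝓘(ℝ, E) ∞ M]
  {E' : Type*} [NormedAddCommGroup E'] [NormedSpace ℝ E'] [FiniteDimensional ℝ E']
  {X : Type*} [TopologicalSpace X] [ChartedSpace E' X] [IsManifold 𝓘(ℝ, E') ∞ X]

/-- The maps π ∘ i and β ∘ q agree only pointwise, so fields along them have different types. Every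
tangent space unfolds to the model space; taking fields with values there allows substitution of one
map for the other. -/
lemma SmoothAlongAt.of_map_eq {f f' : X → M} (hf : ∀ p, f p = f' p) {V : X → E} {p : X}
    (hV : SmoothAlongAt E' f V p) : SmoothAlongAt E' f' V p := by
  obtain rfl : f = f' := funext hf
  exact hV

lemma covAlong_of_map_eq {g : MetricTensor E M} {f f' : X → M} (hf : ∀ p, f p = f' p) (V : X → E)
    (p : X) (u : TangentSpace 𝓘(ℝ, E') p) :
    (covAlong g f V p u : E) = covAlong g f' V p u := by
  obtain rfl : f = f' := funext hf
  rfl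

lemma mfderiv_of_map_eq {f f' : X → M} (hf : ∀ p, f p = f' p) (p : X)
    (u : TangentSpace 𝓘(ℝ, E') p) :
    (mfderiv 𝓘(ℝ, E') 𝓘(ℝ, E) f p u : E) = mfderiv 𝓘(ℝ, E') 𝓘(ℝ, E) f' p u := by
  obtain rfl : f = f' := funext hf
  rfl

lemma metric_of_point_eq (g : MetricTensor E M) {x y : M} (hxy : x = y) (u v : E) :
    g x u v = g y u v := by
  subst hxy
  rfl

variable {g : MetricTensor E M} (hg : IsRiemannian g) {h : MetricTensor E' X} (hh : IsRiemannian h)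
  {f : X → M} {p : X} {ι : Type*} [Fintype ι] [DecidableEq ι]
  (hι : Fintype.card ι = Module.finrank ℝ E') {A : ι → (p : X) → TangentSpace 𝓘(ℝ, E') p}
  (hA : ∀ k, SmoothAlongNear E' (fun p : X => p) (A k) p)
  (ho : ∀ i j, h p (A i p) (A j p) = if i = j then 1 else 0)
  (hpar : ∀ k, nabla h (A k) p (A k p) = 0)
include hg hh hι hA ho hpar

/-- The tension field in an orthonormal frame of geodesic fields. -/
theorem tension_eq_sum (hf : ∀ᶠ p' in 𝓝 p, ContMDiffAt 𝓘(ℝ, E') 𝓘(ℝ, E) ∞ f p') :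
    tension h g f p =
      ∑ k, covAlong g f (fun p' => mfderiv 𝓘(ℝ, E') 𝓘(ℝ, E) f p' (A k p')) p (A k p) := by
  rw [tension_eq_metricTrace, metricTrace_eq_sum hh hι (fun k => A k p) ho (secondFund h g f p)
    (fun u v w => secondFund_add_left hg hh hf u v w)
    (fun a u v => secondFund_smul_left hg hh hf a u v)
    (fun u v w => secondFund_add_right hg hh hf u v w)
    (fun a u v => secondFund_smul_right hg hh hf a u v)]
  refine Finset.sum_congr rfl fun k _ => ?_
  rw [secondFund_eq hg hh hf (hA k), hpar, map_zero, sub_zero]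

/-- The rough Laplacian in an orthonormal frame of geodesic fields. -/
theorem traceHessian_eq_sum {V : (p : X) → TangentSpace 𝓘(ℝ, E) (f p)}
    (hV : SmoothAlongNear E' f V p) :
    traceHessian h g f V p =
      ∑ k, covAlong g f (fun p' => covAlong g f V p' (A k p')) p (A k p) := by
  have hs : ∀ v : TangentSpace 𝓘(ℝ, E') p,
      SmoothAlongAt E' f (fun p' => covAlong g f V p' (extendVector p v p')) p := fun v =>
    (SmoothAlongNear.covAlong hg hV (smoothAlongNear_extendVector p v)).self
  have he : ∀ v : TangentSpace 𝓘(ℝ, E') p,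
      SmoothAlongAt E' (fun p : X => p) (extendVector p v) p := fun v =>
    (smoothAlongNear_extendVector p v).self
  unfold traceHessian
  rw [metricTrace_eq_sum hh hι (fun k => A k p) ho]
  · refine Finset.sum_congr rfl fun k _ => ?_
    -- The bundle map is ∇V itself: the Hessian expression depends on the extended field only
    -- through its value, so the frame field may replace the constant extension.
    rw [covAlong_bundleMap_eq hg hh (fun p u => covAlong g f V p u)
      (fun p u v => covAlong_map_add hg V u v) (fun p a u => covAlong_map_smul hg V a u)
      (fun W hW => (SmoothAlongNear.covAlong hg hV hW).self) (hA k), hpar]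
    have h0 := covAlong_map_smul hg V 0 (A k p)
    rw [zero_smul, zero_smul] at h0
    rw [h0, sub_zero]
  · intro u v w
    simp only [nabla, covAlong_map_add hg, covAlong_map_add hh]
    abel
  · intro a u v
    simp only [nabla, covAlong_map_smul hg, covAlong_map_smul hh, smul_sub]
  · intro u v w
    have h1 : nabla h (fun p' => extendVector p v p' + extendVector p w p') p u = _ :=
      covAlong_add hh (he v) (he w) u
    simp only [extendVector_add, covAlong_map_add hg]
    rw [covAlong_add hg (hs v) (hs w)]
    have h2 : extendVector p (v + w) = fun p' => extendVector p v p' + extendVector p w p' :=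
      funext fun p' => extendVector_add p v w p'
    rw [h2, h1, covAlong_map_add hg]
    simp only [nabla]
    abel
  · intro a u v
    have h1 := covAlong_smul hh (a := fun _ => a) contMDiffAt_const (he v) u
    have h3 := covAlong_smul hg (a := fun _ => a) contMDiffAt_const (hs v) u
    rw [mvfderiv_const, zero_apply, zero_smul, zero_add] at h1 h3
    have h2 : extendVector p (a • v) = fun p' => a • extendVector p v p' :=
      funext fun p' => extendVector_smul p a v p'
    simp only [extendVector_smul, covAlong_map_smul hg]
    rw [h3, h2, nabla, h1, covAlong_map_smul hg, smul_sub]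
    rfl

/-- The bitension field in an orthonormal frame of geodesic fields. -/
theorem bitension_eq_sum (ht : SmoothAlongNear E' f (tension h g f) p) :
    bitension h g f p =
      ∑ k, (covAlong g f (fun p' => covAlong g f (tension h g f) p' (A k p')) p (A k p)
        - curvature g (f p) (mfderiv 𝓘(ℝ, E') 𝓘(ℝ, E) f p (A k p)) (tension h g f p)
          (mfderiv 𝓘(ℝ, E') 𝓘(ℝ, E) f p (A k p))) := by
  rw [bitension, traceHessian_eq_sum hg hh hι hA ho hpar ht, Finset.sum_sub_distrib]
  congr 1
  refine metricTrace_eq_sum hh hι (fun k => A k p) ho _ ?_ ?_ ?_ ?_ <;> intros <;>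
    simp only [map_add, map_smul, curvature_add_left hg, curvature_smul_left hg,
      curvature_add_right hg, curvature_smul_right hg]

end Trace

/-! ### Horizontal lifts and the adapted frame of the Hopf cylinder -/

section Frame

variable {M : Type*} [TopologicalSpace M] [ChartedSpace (Euc 3) M] [IsManifold (𝓡 3) ∞ M]
  {N : Type*} [TopologicalSpace N] [ChartedSpace (Euc 2) N] [IsManifold (𝓡 2) ∞ N]
  {C : Type*} [TopologicalSpace C] [ChartedSpace ℝ C] [IsManifold 𝓘(ℝ, ℝ) ∞ C]
  {S : Type*} [TopologicalSpace S] [ChartedSpace (Euc 2) S] [IsManifold (𝓡 2) ∞ S]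
  {φ : (x : M) → TangentSpace (𝓡 3) x →L[ℝ] TangentSpace (𝓡 3) x}
  {ξ : (x : M) → TangentSpace (𝓡 3) x} {η : (x : M) → TangentSpace (𝓡 3) x →L[ℝ] ℝ}
  {g : SmoothMetric (Euc 3) M} {h : SmoothMetric (Euc 2) N}
  {J : (y : N) → TangentSpace (𝓡 2) y →L[ℝ] TangentSpace (𝓡 2) y} {π : M → N}
  {D : (t : C) → TangentSpace 𝓘(ℝ, ℝ) t} {β : C → N} {q : S → C} {i : S → M}

/-- A frame `E₁`, `Ξ` of the surface `i : S → M` with `di E₁ = e` horizontal and `di Ξ = ξ`, whose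
geodesic curvature `κ` is invariant along `Ξ`. -/
structure IsHopfFrame (φ : (x : M) → TangentSpace (𝓡 3) x →L[ℝ] TangentSpace (𝓡 3) x)
    (ξ : (x : M) → TangentSpace (𝓡 3) x) (η : (x : M) → TangentSpace (𝓡 3) x →L[ℝ] ℝ)
    (g : SmoothMetric (Euc 3) M) (i : S → M) (E₁ Ξ : (p : S) → TangentSpace (𝓡 2) p)
    (e : (p : S) → TangentSpace (𝓡 3) (i p)) (κ : S → ℝ) : Prop where
  smooth : ContMDiff (𝓡 2) (𝓡 3) ∞ i
  immersion : ∀ p, Function.Injective (mfderiv (𝓡 2) (𝓡 3) i p)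
  smooth_E₁ : ∀ p, SmoothAlongAt (Euc 2) (fun p : S => p) E₁ p
  smooth_Ξ : ∀ p, SmoothAlongAt (Euc 2) (fun p : S => p) Ξ p
  mfderiv_E₁ : ∀ p, mfderiv (𝓡 2) (𝓡 3) i p (E₁ p) = e p
  mfderiv_Ξ : ∀ p, mfderiv (𝓡 2) (𝓡 3) i p (Ξ p) = ξ (i p)
  unit : ∀ p, g.tensor (i p) (e p) (e p) = 1
  horizontal : ∀ p, η (i p) (e p) = 0
  curvature_eq : ∀ p, g.tensor (i p) (covAlong g.tensor i e p (E₁ p)) (φ (i p) (e p)) = κ p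

section Lift

variable (hM : IsContactMetric φ ξ η g) (hπ : IsOrbitFibration φ ξ η g h J π)
include hM hπ

/-- The base point is a variable y equal to π x, because on the cylinder the vector sits at β(q p),
which equals π(i p) only propositionally. -/
lemma IsOrbitFibration.horizontalLift_spec {x : M} {y : N} (hy : π x = y)
    (w : TangentSpace (𝓡 2) y) :
    η x (horizontalLift η π x ⟨y, w⟩) = 0 ∧
      (mfderiv (𝓡 3) (𝓡 2) π x (horizontalLift η π x ⟨y, w⟩) : Euc 2) = w := by
  subst hy
  have h1 : η x (horizontalLift η π x ⟨π x, w⟩) = 0 ∧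
      (⟨π x, mfderiv (𝓡 3) (𝓡 2) π x (horizontalLift η π x ⟨π x, w⟩)⟩ : TangentBundle (𝓡 2) N) =
        ⟨π x, w⟩ := by
    refine Classical.epsilon_spec (p := fun v : TangentSpace (𝓡 3) x =>
      η x v = 0 ∧ (⟨π x, mfderiv (𝓡 3) (𝓡 2) π x v⟩ : TangentBundle (𝓡 2) N) = ⟨π x, w⟩) ?_
    obtain ⟨v, hv, hv'⟩ := hπ.exists_horizontal hM x w
    exact ⟨v, hv, by rw [hv']⟩
  refine ⟨h1.1, ?_⟩
  have h2 := h1.2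
  rw [Bundle.TotalSpace.mk.injEq] at h2
  exact eq_of_heq h2.2

variable (hS : IsHopfCylinder π β q i)
include hS

lemma η_lift₁ (p : S) : η (i p) (lift₁ η π D β q i p) = 0 :=
  (hπ.horizontalLift_spec hM (hS.comm p).symm _).1

lemma mfderiv_lift₁ (p : S) :
    (mfderiv (𝓡 3) (𝓡 2) π (i p) (lift₁ η π D β q i p) : Euc 2) = frame₁ D β (q p) :=
  (hπ.horizontalLift_spec hM (hS.comm p).symm _).2

lemma mfderiv_φ_lift₁ (p : S) :
    (mfderiv (𝓡 3) (𝓡 2) π (i p) (φ (i p) (lift₁ η π D β q i p)) : Euc 2) =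
      frame₂ J D β (q p) := by
  rw [← hπ.complex]
  have hJ : ∀ {x y : N}, x = y → ∀ u : Euc 2, (J x u : Euc 2) = J y u := by
    rintro x _ rfl u
    rfl
  exact (hJ (hS.comm p).symm _).trans (congrArg (J (β (q p))) (mfderiv_lift₁ hM hπ hS p))

/-- Both sides are horizontal and have the same image under dπ, as J ∘ dπ = dπ ∘ φ. -/
lemma lift₂_eq (p : S) : lift₂ η π J D β q i p = φ (i p) (lift₁ η π D β q i p) := by
  have h1 := hπ.horizontalLift_spec hM (hS.comm p).symm (frame₂ J D β (q p))
  exact hπ.eq_of_mfderiv_eq hM h1.1 (hM.η_φ _ _) (h1.2.trans (mfderiv_φ_lift₁ hM hπ hS p).symm)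

variable (hβ : IsArcLengthCurve h D β)
include hβ

lemma mfderiv_comm (p : S) (u : TangentSpace (𝓡 2) p) :
    (mfderiv (𝓡 3) (𝓡 2) π (i p) (mfderiv (𝓡 2) (𝓡 3) i p u) : Euc 2) =
      mfderiv 𝓘(ℝ, ℝ) (𝓡 2) β (q p) (mfderiv (𝓡 2) 𝓘(ℝ, ℝ) q p u) := by
  have h1 := mfderiv_comp_apply p ((hπ.smooth (i p)).mdifferentiableAt (by simp))
    ((hS.smooth_i p).mdifferentiableAt (by simp)) u
  have h2 := mfderiv_comp_apply p ((hβ.smooth (q p)).mdifferentiableAt (by simp))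
    ((hS.smooth_q p).mdifferentiableAt (by simp)) u
  exact h1.symm.trans ((mfderiv_of_map_eq (fun p => (hS.comm p).symm) p u).trans h2)

lemma metric_lift₁ (p : S) :
    g.tensor (i p) (lift₁ η π D β q i p) (lift₁ η π D β q i p) = 1 := by
  have h1 := hπ.metric_mfderiv hM (i p) (lift₁ η π D β q i p) (lift₁ η π D β q i p)
  rw [η_lift₁ hM hπ hS, mul_zero, sub_zero] at h1
  rw [← h1, ← hβ.unit_speed (q p)]
  have h2 := mfderiv_lift₁ (D := D) hM hπ hS p
  have h3 := metric_of_point_eq h.tensor (hS.comm p).symm (frame₁ D β (q p)) (frame₁ D β (q p))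
  exact (congrArg₂ (fun u v : Euc 2 => h.tensor (π (i p)) u v) h2 h2).trans h3

omit hM hπ hS in
lemma smoothAlongAt_frame₁ (t : C) : SmoothAlongAt ℝ β (frame₁ D β) t :=
  SmoothAlongAt.pushforward (k := fun t : C => t) (hβ.smooth t) (hβ.smooth_D t)

/-- The lift is chosen point by point. Its product with a coordinate field Z equals the product of
f₁ with dπ(Z) downstairs, which is smooth. -/
lemma smoothAlongAt_lift₁ (p : S) : SmoothAlongAt (Euc 2) i (lift₁ η π D β q i) p := by
  have hx := mem_chart_source (Euc 3) (i p)
  refine smoothAlongAt_of_metric g.isRiemannian (i p) hx (hS.smooth_i p) fun v => ?_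
  have h1 : SmoothAlongAt (Euc 2) (fun p => π (i p)) (fun p => (frame₁ D β (q p) : Euc 2)) p :=
    SmoothAlongAt.of_map_eq (f := fun p => β (q p)) hS.comm
      ((smoothAlongAt_frame₁ hβ (q p)).comp (k := q) (hS.smooth_q p))
  have h2 : SmoothAlongAt (Euc 2) (fun p => π (i p))
      (fun p' => mfderiv (𝓡 3) (𝓡 2) π (i p') (coordField (i p) v (i p'))) p :=
    SmoothAlongAt.pushforward (k := i) (hπ.smooth (i p))
      ((smoothAlongAt_coordField hx v).comp (k := i) (hS.smooth_i p))
  refine (h.isRiemannian.contMDiffAt h1 h2).congr_of_eventuallyEq (Eventually.of_forall fun p' => ?_)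
  have h3 := hπ.metric_mfderiv hM (i p') (lift₁ η π D β q i p') (coordField (i p) v (i p'))
  rw [η_lift₁ hM hπ hS, zero_mul, sub_zero] at h3
  exact h3.symm.trans (congrArg (fun u : Euc 2 => h.tensor (π (i p')) u
    (mfderiv (𝓡 3) (𝓡 2) π (i p') (coordField (i p) v (i p')))) (mfderiv_lift₁ hM hπ hS p'))

omit hM hπ hS in
lemma D_ne_zero (t : C) : D t ≠ 0 := fun h0 => by
  have h1 := hβ.unit_speed t
  rw [h0, map_zero] at h1
  exact zero_ne_one ((h.isRiemannian.zero_left _).symm.trans h1)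

omit hM hπ hS in
lemma exists_eq_smul_D (t : C) (w : TangentSpace 𝓘(ℝ, ℝ) t) : ∃ a : ℝ, w = a • D t := by
  have key : ∀ d w : ℝ, d ≠ 0 → ∃ a : ℝ, w = a * d := fun d w h0 =>
    ⟨w / d, (div_mul_cancel₀ w h0).symm⟩
  exact key (D t) w (D_ne_zero hβ t)

/-- The vector dπ(di w) = dβ(dq w) is a multiple of f₁, hence of the image of the lift;
orthogonality to φe can thus be read off downstairs. It makes φe the normal of the surface. -/
lemma metric_mfderiv_φ_lift₁ (p : S) (w : TangentSpace (𝓡 2) p) :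
    g.tensor (i p) (mfderiv (𝓡 2) (𝓡 3) i p w) (φ (i p) (lift₁ η π D β q i p)) = 0 := by
  obtain ⟨a, ha⟩ := exists_eq_smul_D hβ (q p) (mfderiv (𝓡 2) 𝓘(ℝ, ℝ) q p w)
  have h1 := mfderiv_comm hM hπ hS hβ p w
  rw [ha, map_smul] at h1
  have h2 : mfderiv (𝓡 3) (𝓡 2) π (i p) (mfderiv (𝓡 2) (𝓡 3) i p w) =
      a • mfderiv (𝓡 3) (𝓡 2) π (i p) (lift₁ η π D β q i p) :=
    h1.trans (congrArg (fun u : Euc 2 => a • u) (mfderiv_lift₁ hM hπ hS p).symm)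
  have h3 := hπ.metric_mfderiv hM (i p) (mfderiv (𝓡 2) (𝓡 3) i p w)
    (φ (i p) (lift₁ η π D β q i p))
  rw [h2, h.isRiemannian.smul_left, hπ.metric_mfderiv hM, hM.η_φ, hM.metric_φ_self] at h3
  linarith

/-- Every di(w) lies in the span of the lift and ξ. The immersion makes the map to the two
coefficients injective, and both spaces have dimension two. -/
lemma exists_mfderiv_eq (p : S) (a b : ℝ) :
    ∃ w, mfderiv (𝓡 2) (𝓡 3) i p w = a • lift₁ η π D β q i p + b • ξ (i p) := by
  have hg := g.isRiemannian
  have hdec : ∀ w, mfderiv (𝓡 2) (𝓡 3) i p w =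
      g.tensor (i p) (mfderiv (𝓡 2) (𝓡 3) i p w) (lift₁ η π D β q i p) • lift₁ η π D β q i p +
        η (i p) (mfderiv (𝓡 2) (𝓡 3) i p w) • ξ (i p) := fun w => by
    have h1 := hM.orthonormal_frame (metric_lift₁ hM hπ hS hβ p) (η_lift₁ hM hπ hS p)
      (mfderiv (𝓡 2) (𝓡 3) i p w)
    rwa [metric_mfderiv_φ_lift₁ hM hπ hS hβ, zero_smul, add_zero] at h1
  let L : TangentSpace (𝓡 2) p →ₗ[ℝ] ℝ × ℝ :=
    { toFun := fun w => (g.tensor (i p) (mfderiv (𝓡 2) (𝓡 3) i p w) (lift₁ η π D β q i p),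
        η (i p) (mfderiv (𝓡 2) (𝓡 3) i p w))
      map_add' := fun u v => by simp only [map_add, hg.add_left, Prod.mk_add_mk]
      map_smul' := fun a u => by
        simp only [map_smul, hg.smul_left, RingHom.id_apply, Prod.smul_mk, smul_eq_mul] }
  have hinj : Function.Injective L := by
    rw [injective_iff_map_eq_zero]
    intro w hw
    have h1 := Prod.ext_iff.1 hw
    have h2 := hdec w
    rw [show g.tensor (i p) (mfderiv (𝓡 2) (𝓡 3) i p w) (lift₁ η π D β q i p) = 0 from h1.1,
      show η (i p) (mfderiv (𝓡 2) (𝓡 3) i p w) = 0 from h1.2, zero_smul, zero_smul,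
      add_zero] at h2
    exact hS.immersion p (h2.trans (map_zero _).symm)
  have hdim : Module.finrank ℝ (TangentSpace (𝓡 2) p) = Module.finrank ℝ (ℝ × ℝ) := by
    have h1 : Module.finrank ℝ (TangentSpace (𝓡 2) p) = Module.finrank ℝ (Euc 2) := rfl
    rw [h1]
    simp
  obtain ⟨w, hw⟩ := (LinearMap.injective_iff_surjective_of_finrank_eq_finrank hdim).1 hinj (a, b)
  have h1 := Prod.ext_iff.1 hw
  refine ⟨w, (hdec w).trans ?_⟩
  rw [show g.tensor (i p) (mfderiv (𝓡 2) (𝓡 3) i p w) (lift₁ η π D β q i p) = a from h1.1,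
    show η (i p) (mfderiv (𝓡 2) (𝓡 3) i p w) = b from h1.2]

/-- Compare the multiples of f₁ in dβ(dq w) = dπ(di w); the unit vector f₁ is nonzero. -/
lemma mfderiv_q_eq {p : S} {w : TangentSpace (𝓡 2) p} {a b : ℝ}
    (hw : mfderiv (𝓡 2) (𝓡 3) i p w = a • lift₁ η π D β q i p + b • ξ (i p)) :
    mfderiv (𝓡 2) 𝓘(ℝ, ℝ) q p w = a • D (q p) := by
  obtain ⟨a', ha⟩ := exists_eq_smul_D hβ (q p) (mfderiv (𝓡 2) 𝓘(ℝ, ℝ) q p w)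
  have h1 := mfderiv_comm hM hπ hS hβ p w
  rw [ha, map_smul, hw, map_add, map_smul, map_smul, hπ.mfderiv_ξ hM, smul_zero, add_zero] at h1
  have h2 : a • frame₁ D β (q p) = a' • frame₁ D β (q p) :=
    (congrArg (fun u : Euc 2 => a • u) (mfderiv_lift₁ hM hπ hS p)).symm.trans h1
  have h0 : frame₁ D β (q p) ≠ 0 := fun h0 => by
    have h1 := hβ.unit_speed (q p)
    exact zero_ne_one (((congrArg (fun u => h.tensor (β (q p)) u u) h0).trans
      (h.isRiemannian.zero_left _)).symm.trans h1)
  rw [ha, smul_left_injective ℝ h0 h2]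

omit hM hπ hβ in
-- Products for the induced metric are products of images under di, so smoothness of di(W) gives
-- smoothness of W.
lemma smoothAlongAt_of_mfderiv (g : SmoothMetric (Euc 3) M) {W : (p : S) → TangentSpace (𝓡 2) p} {p : S}
    (hW : SmoothAlongAt (Euc 2) i (fun p => mfderiv (𝓡 2) (𝓡 3) i p (W p)) p) :
    SmoothAlongAt (Euc 2) (fun p : S => p) W p := by
  have hx := mem_chart_source (Euc 2) p
  refine smoothAlongAt_of_metric (isRiemannian_inducedMetric g.isRiemannian hS.smooth_i
    hS.immersion) p hx contMDiffAt_id fun v => ?_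
  exact g.isRiemannian.contMDiffAt hW
    ((smoothAlongAt_coordField hx v).pushforward (k := fun p : S => p) (hS.smooth_i p))

/-- The Hopf cylinder carries a Hopf frame over the arc-length parameter of the base curve. -/
theorem exists_isHopfFrame :
    ∃ E₁ Ξ : (p : S) → TangentSpace (𝓡 2) p,
      IsHopfFrame φ ξ η g i E₁ Ξ (lift₁ η π D β q i) (fun p => curveCurvature h J D β (q p)) ∧
      ∀ p, mfderiv (𝓡 2) 𝓘(ℝ, ℝ) q p (E₁ p) = D (q p) := by
  choose E₁ hE₁ using fun p => exists_mfderiv_eq hM hπ hS hβ p 1 0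
  choose Ξ hΞ using fun p => exists_mfderiv_eq hM hπ hS hβ p 0 1
  have hq : ∀ p, mfderiv (𝓡 2) 𝓘(ℝ, ℝ) q p (E₁ p) = D (q p) := fun p => by
    rw [mfderiv_q_eq hM hπ hS hβ (hE₁ p), one_smul]
  simp only [one_smul, zero_smul, add_zero, zero_add] at hE₁ hΞ
  refine ⟨E₁, Ξ, ⟨hS.smooth_i, hS.immersion, fun p => ?_, fun p => ?_, hE₁, hΞ,
    metric_lift₁ hM hπ hS hβ, η_lift₁ hM hπ hS, fun p => ?_⟩, hq⟩
  · refine smoothAlongAt_of_mfderiv hS g ?_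
    simp only [hE₁]
    exact smoothAlongAt_lift₁ hM hπ hS hβ p
  · refine smoothAlongAt_of_mfderiv hS g ?_
    simp only [hΞ]
    exact hM.smoothAlongAt_ξ (hS.smooth_i p)
  -- The second fundamental form of π vanishes on horizontal pairs, so dπ carries the derivative of
  -- the lift along E₁ to that of f₁ along β. Since dπ preserves products with the horizontal φe,
  -- the two curvatures agree.
  · have h1 := covAlong_comp_pushforward (g := h.tensor) (h := g.tensor) h.isRiemannian
      g.isRiemannian (Eventually.of_forall hπ.smooth)
      (Eventually.of_forall (smoothAlongAt_lift₁ hM hπ hS hβ)) (E₁ p)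
    rw [hE₁, hπ.secondFund_horizontal hM (η_lift₁ hM hπ hS p) (η_lift₁ hM hπ hS p),
      add_zero] at h1
    have h2 : (covAlong h.tensor (fun p => π (i p)) (fun p => (frame₁ D β (q p) : Euc 2)) p (E₁ p)
        : Euc 2) = covAlong h.tensor β (frame₁ D β) (q p) (D (q p)) := by
      refine (covAlong_of_map_eq (f := fun p => β (q p)) hS.comm
        (fun p => (frame₁ D β (q p) : Euc 2)) p (E₁ p)).symm.trans ?_
      rw [← hq]
      exact covAlong_comp (k := q) (smoothAlongAt_frame₁ hβ (q p))
        ((hS.smooth_q p).mdifferentiableAt (by simp)) (E₁ p)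
    have h3 := hπ.metric_mfderiv hM (i p) (covAlong g.tensor i (lift₁ η π D β q i) p (E₁ p))
      (φ (i p) (lift₁ η π D β q i p))
    rw [hM.η_φ, mul_zero, sub_zero] at h3
    have h4 : (mfderiv (𝓡 3) (𝓡 2) π (i p)
        (covAlong g.tensor i (lift₁ η π D β q i) p (E₁ p)) : Euc 2) =
        covAlong h.tensor β (frame₁ D β) (q p) (D (q p)) := by
      rw [← h2, ← h1]
      exact covAlong_congr (Eventually.of_forall fun p => mfderiv_lift₁ hM hπ hS p) _
    rw [← h3]
    refine (congrArg₂ (fun u v : Euc 2 => h.tensor (π (i p)) u v) h4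
      (mfderiv_φ_lift₁ hM hπ hS p)).trans ?_
    exact metric_of_point_eq h.tensor (hS.comm p).symm _ _

end Lift

end Frame

/-! ### Frame equations, flatness and tension of the Hopf cylinder -/

section HopfSurface

variable {M : Type*} [TopologicalSpace M] [ChartedSpace (Euc 3) M] [IsManifold (𝓡 3) ∞ M]
  {S : Type*} [TopologicalSpace S] [ChartedSpace (Euc 2) S] [IsManifold (𝓡 2) ∞ S]
  {φ : (x : M) → TangentSpace (𝓡 3) x →L[ℝ] TangentSpace (𝓡 3) x}
  {ξ : (x : M) → TangentSpace (𝓡 3) x} {η : (x : M) → TangentSpace (𝓡 3) x →L[ℝ] ℝ}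
  {g : SmoothMetric (Euc 3) M} {i : S → M} {E₁ Ξ : (p : S) → TangentSpace (𝓡 2) p}
  {e : (p : S) → TangentSpace (𝓡 3) (i p)} {κ : S → ℝ}

namespace IsHopfFrame

variable (hF : IsHopfFrame φ ξ η g i E₁ Ξ e κ)

section
include hF

lemma isRiemannian : IsRiemannian (inducedMetric g.tensor i : MetricTensor (Euc 2) S) :=
  isRiemannian_inducedMetric g.isRiemannian hF.smooth hF.immersion

lemma smoothAlongNear_E₁ (p : S) : SmoothAlongNear (Euc 2) (fun p : S => p) E₁ p :=
  Eventually.of_forall hF.smooth_E₁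

lemma smoothAlongNear_Ξ (p : S) : SmoothAlongNear (Euc 2) (fun p : S => p) Ξ p :=
  Eventually.of_forall hF.smooth_Ξ

lemma smoothAlongNear_e (p : S) : SmoothAlongNear (Euc 2) i e p := by
  have h := (hF.smoothAlongNear_E₁ p).pushforward_field (Eventually.of_forall hF.smooth)
  simpa only [hF.mfderiv_E₁] using h

end

variable (hM : IsContactMetric φ ξ η g)
include hF hM

lemma smoothAlongNear_ξ (p : S) : SmoothAlongNear (Euc 2) i (fun p => ξ (i p)) p :=
  Eventually.of_forall fun p => hM.smoothAlongAt_ξ (hF.smooth p)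

lemma smoothAlongNear_φ_e (p : S) : SmoothAlongNear (Euc 2) i (fun p => φ (i p) (e p)) p :=
  (hF.smoothAlongNear_e p).mono fun _ h => hM.smoothAlongAt_φ h

lemma metric_e_ξ (p : S) : g.tensor (i p) (e p) (ξ (i p)) = 0 := by
  rw [g.isRiemannian.symm, hM.metric_ξ, hF.horizontal]

lemma metric_φ_e_ξ (p : S) : g.tensor (i p) (φ (i p) (e p)) (ξ (i p)) = 0 := by
  rw [g.isRiemannian.symm, hM.metric_ξ, hM.η_φ]

lemma metric_φ_e_e (p : S) : g.tensor (i p) (φ (i p) (e p)) (e p) = 0 := by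
  rw [g.isRiemannian.symm, hM.metric_φ_self]

lemma metric_φ_e (p : S) : g.tensor (i p) (φ (i p) (e p)) (φ (i p) (e p)) = 1 := by
  rw [hM.metric_φ_φ, hF.unit, hF.horizontal]; ring

lemma orthonormal (p : S) (j k : Fin 2) :
    (inducedMetric g.tensor i : MetricTensor (Euc 2) S) p (![E₁, Ξ] j p) (![E₁, Ξ] k p) =
      if j = k then 1 else 0 := by
  have h1 := hF.metric_e_ξ hM p
  fin_cases j <;> fin_cases k <;>
    simp [inducedMetric, hF.mfderiv_E₁, hF.mfderiv_Ξ, hF.unit, hM.metric_ξ, hM.η_ξ, h1,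
      hF.horizontal]

lemma eq_add (p : S) (w : TangentSpace (𝓡 2) p) :
    w = inducedMetric g.tensor i p w (E₁ p) • E₁ p + inducedMetric g.tensor i p w (Ξ p) • Ξ p := by
  have h := eq_sum_orthonormal hF.isRiemannian (ι := Fin 2) (p := p) (by simp)
    (fun k => ![E₁, Ξ] k p) (hF.orthonormal hM p) w
  rwa [Fin.sum_univ_two] at h

lemma metric_mfderiv_φ_e (p : S) (w : TangentSpace (𝓡 2) p) :
    g.tensor (i p) (mfderiv (𝓡 2) (𝓡 3) i p w) (φ (i p) (e p)) = 0 := by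
  have hg := g.isRiemannian
  rw [hF.eq_add hM p w, map_add, map_smul, map_smul, hF.mfderiv_E₁, hF.mfderiv_Ξ, hg.add_left,
    hg.smul_left, hg.smul_left, hM.metric_φ_self, hM.metric_ξ, hM.η_φ]
  ring

variable (hξ : ∀ x u, nabla g.tensor ξ x u = -φ x u)
include hξ

lemma covAlong_ξ (p : S) (u : TangentSpace (𝓡 2) p) :
    covAlong g.tensor i (fun p => ξ (i p)) p u = -φ (i p) (mfderiv (𝓡 2) (𝓡 3) i p u) := by
  rw [← hξ]
  exact covAlong_field (hM.smooth_ξ (i p)) ((hF.smooth p).mdifferentiableAt (by simp)) u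

lemma covAlong_ξ_E₁ (p : S) : covAlong g.tensor i (fun p => ξ (i p)) p (E₁ p) = -φ (i p) (e p) := by
  rw [hF.covAlong_ξ hM hξ, hF.mfderiv_E₁]

lemma covAlong_ξ_Ξ (p : S) : covAlong g.tensor i (fun p => ξ (i p)) p (Ξ p) = 0 := by
  rw [hF.covAlong_ξ hM hξ, hF.mfderiv_Ξ, hM.φ_ξ, neg_zero]

/-- Unit length excludes the e-component. Differentiating g(ξ, e) = 0, with ∇_u ξ = -φ(di u) and φe
normal to the surface, excludes the ξ-component. -/
lemma covAlong_e (p : S) (u : TangentSpace (𝓡 2) p) :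
    covAlong g.tensor i e p u =
      g.tensor (i p) (covAlong g.tensor i e p u) (φ (i p) (e p)) • φ (i p) (e p) := by
  have hg := g.isRiemannian
  have h1 := metric_compat hg (hF.smoothAlongNear_e p) (hF.smoothAlongNear_e p) u
  have h2 := metric_compat hg (hF.smoothAlongNear_ξ hM p) (hF.smoothAlongNear_e p) u
  simp only [hF.unit, hM.metric_ξ, hF.horizontal] at h1 h2
  rw [mvfderiv_const, zero_apply, hg.symm _ (e p)] at h1
  rw [mvfderiv_const, zero_apply, hF.covAlong_ξ hM hξ, hg.neg_left, hg.symm _ (φ _ _),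
    hM.metric_φ, hg.symm _ (φ _ _), hF.metric_mfderiv_φ_e hM] at h2
  have h3 := hM.orthonormal_frame (hF.unit p) (hF.horizontal p) (covAlong g.tensor i e p u)
  rw [show g.tensor (i p) (covAlong g.tensor i e p u) (e p) = 0 by linarith,
    show η (i p) (covAlong g.tensor i e p u) = 0 by linarith, zero_smul, zero_smul, zero_add,
    add_zero] at h3
  exact h3

lemma covAlong_e_E₁ (p : S) : covAlong g.tensor i e p (E₁ p) = κ p • φ (i p) (e p) := by
  rw [hF.covAlong_e hM hξ, hF.curvature_eq]

/-- By symmetry of the second fundamental form, ∇_Ξ e and ∇_{E₁} ξ = -φe have the same normal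
component, and ∇_Ξ e is normal by `covAlong_e`. -/
lemma covAlong_e_Ξ (p : S) : covAlong g.tensor i e p (Ξ p) = -φ (i p) (e p) := by
  have hg := g.isRiemannian
  have hs : ∀ᶠ p' in 𝓝 p, ContMDiffAt (𝓡 2) (𝓡 3) ∞ i p' := Eventually.of_forall hF.smooth
  have h1 := secondFund_eq hg hF.isRiemannian hs (hF.smoothAlongNear_E₁ p) (Ξ p)
  have h2 := secondFund_eq hg hF.isRiemannian hs (hF.smoothAlongNear_Ξ p) (E₁ p)
  rw [secondFund_symm hg hF.isRiemannian hs, h2] at h1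
  simp only [hF.mfderiv_E₁, hF.mfderiv_Ξ] at h1
  rw [hF.covAlong_ξ_E₁ hM hξ] at h1
  have h3 := congrArg (fun v => g.tensor (i p) v (φ (i p) (e p))) h1
  simp only [hg.sub_left, hF.metric_mfderiv_φ_e hM, hg.neg_left, hF.metric_φ_e hM] at h3
  rw [hF.covAlong_e hM hξ, ← sub_zero (g.tensor (i p) (covAlong g.tensor i e p (Ξ p)) _), ← h3]
  simp

/-- All three components come from differentiating the orthonormality relations of φe with e, φe and
ξ. -/
lemma covAlong_φ_e (p : S) (u : TangentSpace (𝓡 2) p) :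
    covAlong g.tensor i (fun p => φ (i p) (e p)) p u =
      -g.tensor (i p) (covAlong g.tensor i e p u) (φ (i p) (e p)) • e p +
        g.tensor (i p) (mfderiv (𝓡 2) (𝓡 3) i p u) (e p) • ξ (i p) := by
  have hg := g.isRiemannian
  have h1 := metric_compat hg (hF.smoothAlongNear_φ_e hM p) (hF.smoothAlongNear_φ_e hM p) u
  have h2 := metric_compat hg (hF.smoothAlongNear_ξ hM p) (hF.smoothAlongNear_φ_e hM p) u
  have h3 := metric_compat hg (hF.smoothAlongNear_φ_e hM p) (hF.smoothAlongNear_e p) u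
  simp only [hF.metric_φ_e hM, hM.metric_ξ, hM.η_φ, hF.metric_φ_e_e hM] at h1 h2 h3
  rw [mvfderiv_const, zero_apply] at h1 h2 h3
  rw [hg.symm _ (φ _ _)] at h1
  rw [hF.covAlong_ξ hM hξ, hg.neg_left, hM.metric_φ_φ, hF.horizontal, mul_zero, sub_zero] at h2
  rw [hg.symm _ (φ _ _)] at h3
  have h4 := hM.orthonormal_frame (hF.unit p) (hF.horizontal p)
    (covAlong g.tensor i (fun p => φ (i p) (e p)) p u)
  rw [show g.tensor (i p) (covAlong g.tensor i (fun p => φ (i p) (e p)) p u) (e p) =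
      -g.tensor (i p) (covAlong g.tensor i e p u) (φ (i p) (e p)) by linarith,
    show g.tensor (i p) (covAlong g.tensor i (fun p => φ (i p) (e p)) p u) (φ (i p) (e p)) = 0 by
      linarith,
    show η (i p) (covAlong g.tensor i (fun p => φ (i p) (e p)) p u) =
      g.tensor (i p) (mfderiv (𝓡 2) (𝓡 3) i p u) (e p) by linarith, zero_smul, add_zero] at h4
  exact h4

lemma covAlong_φ_e_E₁ (p : S) :
    covAlong g.tensor i (fun p => φ (i p) (e p)) p (E₁ p) = -κ p • e p + ξ (i p) := by
  rw [hF.covAlong_φ_e hM hξ, hF.curvature_eq, hF.mfderiv_E₁, hF.unit, one_smul]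

lemma covAlong_φ_e_Ξ (p : S) :
    covAlong g.tensor i (fun p => φ (i p) (e p)) p (Ξ p) = e p := by
  rw [hF.covAlong_φ_e hM hξ, hF.covAlong_e_Ξ hM hξ, hF.mfderiv_Ξ, g.isRiemannian.neg_left,
    hF.metric_φ_e hM, hM.metric_ξ, hF.horizontal]
  simp

/-- The derivative of di(W) splits into the tangential part di(∇W) and the normal second fundamental
form. If the derivative is normal, the first part vanishes. Applied to both frame fields, this shows
that the cylinder is flat. -/
lemma nabla_eq_zero_of_normal {W : (p : S) → TangentSpace (𝓡 2) p} {p : S}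
    (hW : SmoothAlongNear (Euc 2) (fun p : S => p) W p) {u : TangentSpace (𝓡 2) p} {a : ℝ}
    (ha : covAlong g.tensor i (fun p => mfderiv (𝓡 2) (𝓡 3) i p (W p)) p u = a • φ (i p) (e p)) :
    nabla (inducedMetric g.tensor i : MetricTensor (Euc 2) S) W p u = 0 := by
  have hg := g.isRiemannian
  have hs : ∀ᶠ p' in 𝓝 p, ContMDiffAt (𝓡 2) (𝓡 3) ∞ i p' := Eventually.of_forall hF.smooth
  apply hF.isRiemannian.eq_zero_of_self
  have h1 := secondFund_normal hg hF.isRiemannian hs u (W p)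
    (nabla (inducedMetric g.tensor i : MetricTensor (Euc 2) S) W p u)
  rw [secondFund_eq hg hF.isRiemannian hs hW, ha, hg.sub_left, hg.smul_left,
    hg.symm _ (φ (i p) (e p)), hF.metric_mfderiv_φ_e hM, mul_zero, zero_sub, neg_eq_zero] at h1
  exact h1

lemma nabla_E₁ (p : S) (u : TangentSpace (𝓡 2) p) :
    nabla (inducedMetric g.tensor i : MetricTensor (Euc 2) S) E₁ p u = 0 := by
  refine hF.nabla_eq_zero_of_normal hM hξ (hF.smoothAlongNear_E₁ p) ?_
    (a := g.tensor (i p) (covAlong g.tensor i e p u) (φ (i p) (e p)))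
  simp only [hF.mfderiv_E₁]
  exact hF.covAlong_e hM hξ p u

lemma nabla_Ξ (p : S) (u : TangentSpace (𝓡 2) p) :
    nabla (inducedMetric g.tensor i : MetricTensor (Euc 2) S) Ξ p u = 0 := by
  refine hF.nabla_eq_zero_of_normal hM hξ (hF.smoothAlongNear_Ξ p) ?_
    (a := -inducedMetric g.tensor i p u (E₁ p))
  simp only [hF.mfderiv_Ξ]
  rw [hF.covAlong_ξ hM hξ]
  conv_lhs => rw [hF.eq_add hM p u]
  rw [map_add, map_smul, map_smul, hF.mfderiv_E₁, hF.mfderiv_Ξ, map_add, map_smul, map_smul,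
    hM.φ_ξ, smul_zero, add_zero, neg_smul]

lemma nabla_frame (p : S) (k : Fin 2) :
    nabla (inducedMetric g.tensor i : MetricTensor (Euc 2) S) (![E₁, Ξ] k) p (![E₁, Ξ] k p) = 0 := by
  fin_cases k
  · exact hF.nabla_E₁ hM hξ p _
  · exact hF.nabla_Ξ hM hξ p _

omit hM hξ in
lemma smooth_frame (p : S) (k : Fin 2) :
    SmoothAlongNear (Euc 2) (fun p : S => p) (![E₁, Ξ] k) p := by
  fin_cases k
  · exact hF.smoothAlongNear_E₁ p
  · exact hF.smoothAlongNear_Ξ p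

/-- The tension field of a Hopf cylinder. -/
theorem tension_eq :
    tension (inducedMetric g.tensor i : MetricTensor (Euc 2) S) g.tensor i =
      fun p => κ p • φ (i p) (e p) := by
  funext p
  rw [tension_eq_sum g.isRiemannian hF.isRiemannian (ι := Fin 2) (by simp) (hF.smooth_frame p)
    (hF.orthonormal hM p) (hF.nabla_frame hM hξ p) (Eventually.of_forall hF.smooth),
    Fin.sum_univ_two]
  simp only [Matrix.cons_val_zero, Matrix.cons_val_one, hF.mfderiv_E₁, hF.mfderiv_Ξ]
  rw [hF.covAlong_ξ_Ξ hM hξ, hF.covAlong_e_E₁ hM hξ, add_zero]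

omit hξ in
lemma smoothNear_κ (p : S) : SmoothNear (Euc 2) κ p := by
  have h := g.isRiemannian.smoothNear (SmoothAlongNear.covAlong g.isRiemannian
    (hF.smoothAlongNear_e p) (hF.smoothAlongNear_E₁ p)) (hF.smoothAlongNear_φ_e hM p)
  simpa only [hF.curvature_eq] using h

end IsHopfFrame

end HopfSurface

/-! ### Bitension of the Hopf cylinder -/

section HopfSurface

variable {M : Type*} [TopologicalSpace M] [ChartedSpace (Euc 3) M] [IsManifold (𝓡 3) ∞ M]
  {S : Type*} [TopologicalSpace S] [ChartedSpace (Euc 2) S] [IsManifold (𝓡 2) ∞ S]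
  {φ : (x : M) → TangentSpace (𝓡 3) x →L[ℝ] TangentSpace (𝓡 3) x}
  {ξ : (x : M) → TangentSpace (𝓡 3) x} {η : (x : M) → TangentSpace (𝓡 3) x →L[ℝ] ℝ}
  {g : SmoothMetric (Euc 3) M} {i : S → M} {E₁ Ξ : (p : S) → TangentSpace (𝓡 2) p}
  {e : (p : S) → TangentSpace (𝓡 3) (i p)} {κ : S → ℝ}

namespace IsHopfFrame

variable (hF : IsHopfFrame φ ξ η g i E₁ Ξ e κ) (hM : IsContactMetric φ ξ η g)
include hF hM

lemma smoothAlongNear_combination {a b d : S → ℝ} {p : S} (ha : SmoothNear (Euc 2) a p)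
    (hb : SmoothNear (Euc 2) b p) (hd : SmoothNear (Euc 2) d p) :
    SmoothAlongNear (Euc 2) i (fun p => a p • e p + b p • φ (i p) (e p) + d p • ξ (i p)) p :=
  (((hF.smoothAlongNear_e p).smul ha).add ((hF.smoothAlongNear_φ_e hM p).smul hb)).add
    ((hF.smoothAlongNear_ξ hM p).smul hd)

lemma covAlong_combination {a b d : S → ℝ} {p : S} (ha : SmoothNear (Euc 2) a p)
    (hb : SmoothNear (Euc 2) b p) (hd : SmoothNear (Euc 2) d p) (u : TangentSpace (𝓡 2) p) :
    covAlong g.tensor i (fun p => a p • e p + b p • φ (i p) (e p) + d p • ξ (i p)) p u =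
      (mvfderiv (𝓡 2) a p u • e p + a p • covAlong g.tensor i e p u) +
      (mvfderiv (𝓡 2) b p u • φ (i p) (e p) +
        b p • covAlong g.tensor i (fun p => φ (i p) (e p)) p u) +
      (mvfderiv (𝓡 2) d p u • ξ (i p) + d p • covAlong g.tensor i (fun p => ξ (i p)) p u) := by
  have hg := g.isRiemannian
  have h1 := (hF.smoothAlongNear_e p).smul ha
  have h2 := (hF.smoothAlongNear_φ_e hM p).smul hb
  have h3 := (hF.smoothAlongNear_ξ hM p).smul hd
  rw [covAlong_add hg (h1.add h2).self h3.self, covAlong_add hg h1.self h2.self,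
    covAlong_smul hg ha.self_of_nhds (hF.smoothAlongNear_e p).self,
    covAlong_smul hg hb.self_of_nhds (hF.smoothAlongNear_φ_e hM p).self,
    covAlong_smul hg hd.self_of_nhds (hF.smoothAlongNear_ξ hM p).self]

variable (hξ : ∀ x u, nabla g.tensor ξ x u = -φ x u)
include hξ

lemma covAlong_combination_E₁ {a b d : S → ℝ} {p : S} (ha : SmoothNear (Euc 2) a p)
    (hb : SmoothNear (Euc 2) b p) (hd : SmoothNear (Euc 2) d p) :
    covAlong g.tensor i (fun p => a p • e p + b p • φ (i p) (e p) + d p • ξ (i p)) p (E₁ p) =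
      (mvfderiv (𝓡 2) a p (E₁ p) - b p * κ p) • e p +
      (mvfderiv (𝓡 2) b p (E₁ p) + a p * κ p - d p) • φ (i p) (e p) +
      (mvfderiv (𝓡 2) d p (E₁ p) + b p) • ξ (i p) := by
  rw [hF.covAlong_combination hM ha hb hd, hF.covAlong_e_E₁ hM hξ, hF.covAlong_φ_e_E₁ hM hξ,
    hF.covAlong_ξ_E₁ hM hξ]
  module

lemma covAlong_combination_Ξ {a b d : S → ℝ} {p : S} (ha : SmoothNear (Euc 2) a p)
    (hb : SmoothNear (Euc 2) b p) (hd : SmoothNear (Euc 2) d p) :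
    covAlong g.tensor i (fun p => a p • e p + b p • φ (i p) (e p) + d p • ξ (i p)) p (Ξ p) =
      (mvfderiv (𝓡 2) a p (Ξ p) + b p) • e p +
      (mvfderiv (𝓡 2) b p (Ξ p) - a p) • φ (i p) (e p) +
      mvfderiv (𝓡 2) d p (Ξ p) • ξ (i p) := by
  rw [hF.covAlong_combination hM ha hb hd, hF.covAlong_e_Ξ hM hξ, hF.covAlong_φ_e_Ξ hM hξ,
    hF.covAlong_ξ_Ξ hM hξ]
  module

omit hξ in
lemma coefficients_eq_zero {p : S} {a b d : ℝ}
    (h : a • e p + b • φ (i p) (e p) + d • ξ (i p) = 0) : a = 0 ∧ b = 0 ∧ d = 0 := by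
  have hg := g.isRiemannian
  have h1 := congrArg (fun v => g.tensor (i p) v (e p)) h
  have h2 := congrArg (fun v => g.tensor (i p) v (φ (i p) (e p))) h
  have h3 := congrArg (fun v => g.tensor (i p) v (ξ (i p))) h
  simp only [hg.add_left, hg.smul_left, hF.unit, hF.metric_φ_e_e hM, hM.metric_ξ, hF.horizontal,
    hM.metric_φ_self, hF.metric_φ_e hM, hM.η_φ, hF.metric_e_ξ hM, hF.metric_φ_e_ξ hM, hM.η_ξ,
    hg.zero_left] at h1 h2 h3
  exact ⟨by linarith, by linarith, by linarith⟩

omit hM hξ in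
/-- The bitension field of a Hopf cylinder in a Sasakian space form. -/
theorem bitension_eq {c : ℝ} (hM : IsSasakianSpaceForm φ ξ η g c)
    (hξ : ∀ x u, nabla g.tensor ξ x u = -φ x u) (p : S) :
    bitension (inducedMetric g.tensor i : MetricTensor (Euc 2) S) g.tensor i p =
      (2 * mvfderiv (𝓡 2) κ p (Ξ p) - 3 * κ p * mvfderiv (𝓡 2) κ p (E₁ p)) • e p +
      (mvfderiv (𝓡 2) (fun p => mvfderiv (𝓡 2) κ p (E₁ p)) p (E₁ p) +
        mvfderiv (𝓡 2) (fun p => mvfderiv (𝓡 2) κ p (Ξ p)) p (Ξ p) - κ p ^ 3 +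
        (c - 1) * κ p) • φ (i p) (e p) +
      (2 * mvfderiv (𝓡 2) κ p (E₁ p)) • ξ (i p) := by
  have hC := hM.toIsContactMetric
  have hg := g.isRiemannian
  have hκ := hF.smoothNear_κ hC
  have h0 : ∀ p, SmoothNear (Euc 2) (fun _ : S => (0 : ℝ)) p := fun p => smoothNear_const 0
  -- Zero coefficients put the tension in the general form of the frame equations, which are then
  -- applied twice.
  have hV : (fun p => κ p • φ (i p) (e p)) =
      fun p => (0 : ℝ) • e p + κ p • φ (i p) (e p) + (0 : ℝ) • ξ (i p) :=
    funext fun p => by rw [zero_smul, zero_smul, zero_add, add_zero]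
  have ht := hF.tension_eq hC hξ
  have hκE : SmoothNear (Euc 2) (fun p => mvfderiv (𝓡 2) κ p (E₁ p)) p :=
    (hF.smoothAlongNear_E₁ p).smoothNear_mvfderiv (hκ p)
  have hκΞ : SmoothNear (Euc 2) (fun p => mvfderiv (𝓡 2) κ p (Ξ p)) p :=
    (hF.smoothAlongNear_Ξ p).smoothNear_mvfderiv (hκ p)
  have hd : MDifferentiableAt (𝓡 2) 𝓘(ℝ, ℝ) κ p :=
    (hκ p).self_of_nhds.mdifferentiableAt (by simp)
  have hκκ : SmoothNear (Euc 2) (fun p => -(κ p * κ p)) p := by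
    filter_upwards [hκ p] with p' h' using (h'.mul h').neg
  have hdκκ : mvfderiv (𝓡 2) (fun p => -(κ p * κ p)) p (E₁ p) =
      -(2 * κ p * mvfderiv (𝓡 2) κ p (E₁ p)) := by
    rw [mvfderiv_fun_neg, mvfderiv_fun_mul hd hd]
    simp only [neg_apply, add_apply, _root_.smul_apply, smul_eq_mul]
    ring
  have hE : (fun p => covAlong g.tensor i (fun p => κ p • φ (i p) (e p)) p (E₁ p)) =
      fun p => (-(κ p * κ p)) • e p + mvfderiv (𝓡 2) κ p (E₁ p) • φ (i p) (e p) +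
        κ p • ξ (i p) := by
    funext p
    rw [hV, hF.covAlong_combination_E₁ hC hξ (h0 p) (hκ p) (h0 p), mvfderiv_const, zero_apply]
    module
  have hΞ : (fun p => covAlong g.tensor i (fun p => κ p • φ (i p) (e p)) p (Ξ p)) =
      fun p => κ p • e p + mvfderiv (𝓡 2) κ p (Ξ p) • φ (i p) (e p) + (0 : ℝ) • ξ (i p) := by
    funext p
    rw [hV, hF.covAlong_combination_Ξ hC hξ (h0 p) (hκ p) (h0 p), mvfderiv_const, zero_apply]
    module
  -- The curvature terms in the directions e and ξ contribute cκφe and κφe. The second derivatives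
  -- contribute -κ in each direction besides -κ³, whence the coefficient c - 1.
  have hR₁ := hM.curvature_φ hξ (hF.unit p) (hF.horizontal p) 0 1
  have hR₂ := hM.curvature_φ hξ (hF.unit p) (hF.horizontal p) 1 0
  simp only [zero_smul, one_smul, zero_add, add_zero] at hR₁ hR₂
  rw [bitension_eq_sum hg hF.isRiemannian (ι := Fin 2) (by simp) (hF.smooth_frame p)
    (hF.orthonormal hC p) (hF.nabla_frame hC hξ p) (by
      rw [ht]; exact (hF.smoothAlongNear_φ_e hC p).smul (hκ p)), Fin.sum_univ_two]
  simp only [Matrix.cons_val_zero, Matrix.cons_val_one, ht, hF.mfderiv_E₁, hF.mfderiv_Ξ, hE, hΞ]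
  rw [hF.covAlong_combination_E₁ hC hξ hκκ hκE (hκ p),
    hF.covAlong_combination_Ξ hC hξ (hκ p) hκΞ (h0 p), curvature_smul_mid hg, curvature_smul_mid hg,
    hR₁, hR₂, mvfderiv_const, zero_apply, hdκκ]
  module

omit hM hξ in
/-- The curvature of a biharmonic Hopf cylinder. -/
theorem curvature_of_biharmonic {c : ℝ} (hM : IsSasakianSpaceForm φ ξ η g c)
    (hξ : ∀ x u, nabla g.tensor ξ x u = -φ x u)
    (hb : ∀ p, bitension (inducedMetric g.tensor i : MetricTensor (Euc 2) S) g.tensor i p = 0)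
    (p : S) : κ p * (κ p ^ 2 - (c - 1)) = 0 := by
  have h1 := fun p => hF.coefficients_eq_zero hM.toIsContactMetric
    ((hF.bitension_eq hM hξ p).symm.trans (hb p))
  -- The ξ-component is 2E₁κ; once it vanishes the e-component is 2Ξκ. With both derivatives zero
  -- everywhere, the second derivatives drop out of the normal component.
  have hE : (fun p => mvfderiv (𝓡 2) κ p (E₁ p)) = fun _ => 0 :=
    funext fun p => by linarith [(h1 p).2.2]
  have hE' := congrFun hE
  have hΞ : (fun p => mvfderiv (𝓡 2) κ p (Ξ p)) = fun _ => 0 :=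
    funext fun p => by
      have h2 := (h1 p).1
      rw [show mvfderiv (𝓡 2) κ p (E₁ p) = 0 from hE' p] at h2
      linarith
  have h2 := (h1 p).2.1
  rw [hE, hΞ, mvfderiv_const] at h2
  simp only [zero_apply] at h2
  linarith

end IsHopfFrame

end HopfSurface

/-! ### Openness of submersions -/

section Submersion

variable {E : Type*} [NormedAddCommGroup E] [NormedSpace ℝ E] [FiniteDimensional ℝ E]
  {M : Type*} [TopologicalSpace M] [ChartedSpace E M] [IsManifold 𝓘(ℝ, E) ∞ M]
  {E' : Type*} [NormedAddCommGroup E'] [NormedSpace ℝ E'] [FiniteDimensional ℝ E']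
  {X : Type*} [TopologicalSpace X] [ChartedSpace E' X] [IsManifold 𝓘(ℝ, E') ∞ X]

/-- Submersions are open maps. -/
theorem map_nhds_eq_of_surjective_mfderiv {q : X → M} {p : X}
    (hq : ContMDiffAt 𝓘(ℝ, E') 𝓘(ℝ, E) ∞ q p)
    (hs : Function.Surjective (mfderiv 𝓘(ℝ, E') 𝓘(ℝ, E) q p)) : map q (𝓝 p) = 𝓝 (q p) := by
  have := FiniteDimensional.complete ℝ E
  have := FiniteDimensional.complete ℝ E'
  have hp := mem_chart_source E' p
  have hx := mem_chart_source E (q p)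
  set ψ := chartAt E (q p) with hψ
  have hψs : ContMDiffAt 𝓘(ℝ, E) 𝓘(ℝ, E) ∞ ψ (q p) := contMDiffAt_of_mem_maximalAtlas
    (IsManifold.chart_mem_maximalAtlas _) hx
  have hF : ContMDiffAt 𝓘(ℝ, E') 𝓘(ℝ, E) ∞ (fun p => ψ (q p)) p := hψs.comp p hq
  have hd := contDiffAt_comp_symm hp hF
  have hstrict := hd.hasStrictFDerivAt (by simp)
  have hsurj : (fderiv ℝ ((fun p => ψ (q p)) ∘ (extChartAt 𝓘(ℝ, E') p).symm)
      (extChartAt 𝓘(ℝ, E') p p)).range = ⊤ := by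
    rw [LinearMap.range_eq_top]
    intro v
    obtain ⟨u, hu⟩ := hs (coordField (q p) v (q p))
    refine ⟨coordComponents p p u, ?_⟩
    have h1 := mvfderiv_coordField hp (hF.mdifferentiableAt (by simp)) (coordComponents p p u)
    rw [coordField_coordComponents hp] at h1
    have h2 := mfderiv_comp_apply p (hψs.mdifferentiableAt (by simp))
      (hq.mdifferentiableAt (by simp)) u
    have h3 := coordComponents_eq_mvfderiv (x := q p) hx (coordField (q p) v (q p))
    rw [coordComponents_coordField hx] at h3
    rw [hu] at h2
    exact h1.symm.trans (h2.trans h3.symm)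
  -- In charts this is the local openness of a strictly differentiable map with surjective
  -- derivative; the rest undoes the two charts.
  have h1 := hstrict.map_nhds_eq_of_surj hsurj
  have h2 : map (extChartAt 𝓘(ℝ, E') p).symm (𝓝 (extChartAt 𝓘(ℝ, E') p p)) = 𝓝 p :=
    (chartAt E' p).symm_map_nhds_eq hp
  have h4 : (extChartAt 𝓘(ℝ, E') p).symm (extChartAt 𝓘(ℝ, E') p p) = p :=
    extChartAt_to_inv (I := 𝓘(ℝ, E')) p
  rw [← map_map, h2, Function.comp_apply, h4] at h1
  have h5 : map ψ.symm (map ψ (map q (𝓝 p))) = 𝓝 (q p) := by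
    rw [map_map (m := q) (m' := ψ)]
    exact (congrArg (map ψ.symm) h1).trans (ψ.symm_map_nhds_eq hx)
  rw [map_map (m := ψ), map_congr (m₂ := id), map_id] at h5
  · exact h5
  · exact hq.continuousAt.eventually (ψ.eventually_left_inverse hx)

end Submersion

/-- A preconnected set of reals with two distinct points is infinite. -/
lemma eq_of_continuous_of_finite_range {C : Type*} [TopologicalSpace C] [PreconnectedSpace C]
    {k : C → ℝ} (hk : Continuous k) (hfin : (Set.range k).Finite) (s t : C) : k s = k t := by
  by_contra hne
  exact (isPreconnected_range hk).infinite_of_nontrivial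
    ⟨k s, Set.mem_range_self s, k t, Set.mem_range_self t, hne⟩ hfin

/-! ### Tension and bitension of curves; geodesics and parallel fields -/

section Curve

variable {E : Type*} [NormedAddCommGroup E] [NormedSpace ℝ E] [FiniteDimensional ℝ E]
  {M : Type*} [TopologicalSpace M] [ChartedSpace E M] [IsManifold 𝓘(ℝ, E) ∞ M]
  {g : MetricTensor E M} {I : Set ℝ} {γ : ℝ → M}

lemma smoothAlongNear_one (s : ℝ) :
    SmoothAlongNear ℝ (fun s : ℝ => s) (fun _ => (1 : ℝ)) s :=
  Eventually.of_forall fun _ => smoothAlongAt_modelSpace_iff.2 ⟨contMDiffAt_id, contMDiffAt_const⟩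

lemma smoothAlongNear_velocity {s : ℝ} (hγ : ∀ᶠ s' in 𝓝 s, ContMDiffAt 𝓘(ℝ, ℝ) 𝓘(ℝ, E) ∞ γ s') :
    SmoothAlongNear ℝ γ (velocity (E := E) γ) s :=
  (smoothAlongNear_one s).pushforward_field hγ

/-- Differentiating the constant product of 1 with itself gives twice the derivative. Thus d/ds is a
parallel orthonormal frame of the line, and both trace formulas reduce to one term. -/
lemma nabla_lineMetric_one (s : ℝ) (u : TangentSpace 𝓘(ℝ, ℝ) s) :
    nabla lineMetric (fun _ => (1 : ℝ)) s u = 0 := by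
  have h1 := metric_compat isRiemannian_lineMetric (smoothAlongNear_one s)
    (smoothAlongNear_one s) u
  have h2 : (fun s : ℝ => lineMetric s (1 : ℝ) (1 : ℝ)) = fun _ => 1 :=
    funext fun _ => mul_one (1 : ℝ)
  rw [h2, mvfderiv_const, zero_apply] at h1
  have key : ∀ a : ℝ, 0 = a * 1 + 1 * a → a = 0 := fun a h => by linarith
  exact key _ h1

lemma tension_curve (hg : IsRiemannian g) {s : ℝ}
    (hγ : ∀ᶠ s' in 𝓝 s, ContMDiffAt 𝓘(ℝ, ℝ) 𝓘(ℝ, E) ∞ γ s') :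
    tension lineMetric g γ s = covAlong g γ (velocity γ) s (1 : ℝ) := by
  rw [tension_eq_sum hg isRiemannian_lineMetric (ι := Fin 1) (by simp)
    (A := fun _ _ => (1 : ℝ)) (fun _ => smoothAlongNear_one s)
    (fun j k => by rw [if_pos (Subsingleton.elim j k)]; exact mul_one (1 : ℝ))
    (fun _ => nabla_lineMetric_one s _) hγ]
  exact Fin.sum_univ_one _

lemma bitension_curve (hg : IsRiemannian g) {s : ℝ}
    (ht : SmoothAlongNear ℝ γ (tension lineMetric g γ) s) :
    bitension lineMetric g γ s =
      covAlong g γ (fun s => covAlong g γ (tension lineMetric g γ) s (1 : ℝ)) s (1 : ℝ) -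
        curvature g (γ s) (velocity γ s) (tension lineMetric g γ s) (velocity γ s) := by
  rw [bitension_eq_sum hg isRiemannian_lineMetric (ι := Fin 1) (by simp)
    (A := fun _ _ => (1 : ℝ)) (fun _ => smoothAlongNear_one s)
    (fun j k => by rw [if_pos (Subsingleton.elim j k)]; exact mul_one (1 : ℝ))
    (fun _ => nabla_lineMetric_one s _) ht]
  exact Fin.sum_univ_one _

/-- The product of the velocity of a geodesic with a parallel field is constant. -/
lemma IsUnitSpeedGeodesicOn.exists_metric_eq (hg : IsRiemannian g)
    (hγ : IsUnitSpeedGeodesicOn g γ I) (hI : IsOpen I) (hI' : I.OrdConnected)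
    {W : (x : M) → TangentSpace 𝓘(ℝ, E) x} (hW : ∀ x, SmoothAlongAt E (fun x : M => x) W x)
    (hpar : ∀ x u, nabla g W x u = 0) :
    ∃ a : ℝ, ∀ s ∈ I, g (γ s) (velocity γ s) (W (γ s)) = a := by
  have hs : ∀ s ∈ I, ∀ᶠ s' in 𝓝 s, ContMDiffAt 𝓘(ℝ, ℝ) 𝓘(ℝ, E) ∞ γ s' := fun s h => by
    filter_upwards [hI.mem_nhds h] with s' h' using hγ.smooth.contMDiffAt (hI.mem_nhds h')
  have hWγ : ∀ s ∈ I, SmoothAlongNear ℝ γ (fun s => W (γ s)) s := fun s h =>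
    (hs s h).mono fun s' h' => (hW (γ s')).comp (k := γ) h'
  refine hI.exists_is_const_of_deriv_eq_zero hI'.isPreconnected ?_ ?_
  · intro s h
    exact ((hg.contMDiffAt (smoothAlongNear_velocity (hs s h)).self
      (hWγ s h).self).mdifferentiableAt (by simp)).differentiableAt.differentiableWithinAt
  · intro s h
    have h1 := metric_compat hg (smoothAlongNear_velocity (hs s h)) (hWγ s h) (1 : ℝ)
    have h3 : covAlong g γ (fun s => W (γ s)) s (1 : ℝ) = 0 :=
      (covAlong_field (hW (γ s)) ((hs s h).self_of_nhds.mdifferentiableAt (by simp)) _).trans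
        (hpar _ _)
    rw [hγ.geodesic s h, h3, hg.zero_left, hg.zero_right, add_zero] at h1
    have h2 : mvfderiv 𝓘(ℝ, ℝ) (fun s => g (γ s) (velocity γ s) (W (γ s))) s =
        fderiv ℝ (fun s => g (γ s) (velocity γ s) (W (γ s))) s := mfderiv_eq_fderiv
    rw [← fderiv_apply_one_eq_deriv]
    exact (congrArg (fun L : ℝ →L[ℝ] ℝ => L 1) h2).symm.trans h1

end Curve

/-! ### Geodesics of the Hopf cylinder as curves in the ambient manifold -/

section HopfGeodesic

variable {M : Type*} [TopologicalSpace M] [ChartedSpace (Euc 3) M] [IsManifold (𝓡 3) ∞ M]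
  {S : Type*} [TopologicalSpace S] [ChartedSpace (Euc 2) S] [IsManifold (𝓡 2) ∞ S]
  {φ : (x : M) → TangentSpace (𝓡 3) x →L[ℝ] TangentSpace (𝓡 3) x}
  {ξ : (x : M) → TangentSpace (𝓡 3) x} {η : (x : M) → TangentSpace (𝓡 3) x →L[ℝ] ℝ}
  {g : SmoothMetric (Euc 3) M} {i : S → M} {E₁ Ξ : (p : S) → TangentSpace (𝓡 2) p}
  {e : (p : S) → TangentSpace (𝓡 3) (i p)} {κ : S → ℝ} {I : Set ℝ} {γ : ℝ → S}

namespace IsHopfFrame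

variable (hF : IsHopfFrame φ ξ η g i E₁ Ξ e κ) (hM : IsContactMetric φ ξ η g)

include hF hM in
lemma eq_zero_of_smul_φ_e {p : S} {b : ℝ} (h : b • φ (i p) (e p) = 0) : b = 0 :=
  (hF.coefficients_eq_zero hM (a := 0) (d := 0) (by
    rw [zero_smul, zero_smul, zero_add, add_zero, h])).2.1

variable (hξ : ∀ x u, nabla g.tensor ξ x u = -φ x u)
include hF hM hξ

/-- A geodesic of a Hopf cylinder makes a constant angle with the fibres. -/
theorem exists_velocity_eq (hI : IsOpen I) (hI' : I.OrdConnected) (hI_ne : I.Nonempty)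
    (hγ : IsUnitSpeedGeodesicOn (inducedMetric g.tensor i : MetricTensor (Euc 2) S) γ I) :
    ∃ c₁ c₂ : ℝ, c₁ ^ 2 + c₂ ^ 2 = 1 ∧
      ∀ s ∈ I, velocity γ s = c₂ • E₁ (γ s) + c₁ • Ξ (γ s) := by
  have hi := hF.isRiemannian
  obtain ⟨c₂, h₂⟩ := hγ.exists_metric_eq hi hI hI' hF.smooth_E₁ (hF.nabla_E₁ hM hξ)
  obtain ⟨c₁, h₁⟩ := hγ.exists_metric_eq hi hI hI' hF.smooth_Ξ (hF.nabla_Ξ hM hξ)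
  have hv : ∀ s ∈ I, velocity γ s = c₂ • E₁ (γ s) + c₁ • Ξ (γ s) := fun s hs => by
    have h := hF.eq_add hM (γ s) (velocity γ s)
    rwa [h₁ s hs, h₂ s hs] at h
  obtain ⟨s, hs⟩ := hI_ne
  refine ⟨c₁, c₂, ?_, hv⟩
  have h := hγ.unit_speed s hs
  conv_lhs at h => rw [hv s hs]
  rw [hi.add_left, hi.smul_left, hi.smul_left, hi.add_right, hi.smul_right, hi.smul_right,
    hi.add_right, hi.smul_right, hi.smul_right] at h
  have o := hF.orthonormal hM (γ s)
  have o₁ : inducedMetric g.tensor i (γ s) (E₁ (γ s)) (E₁ (γ s)) = 1 := o 0 0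
  have o₂ : inducedMetric g.tensor i (γ s) (E₁ (γ s)) (Ξ (γ s)) = 0 := o 0 1
  have o₃ : inducedMetric g.tensor i (γ s) (Ξ (γ s)) (E₁ (γ s)) = 0 := o 1 0
  have o₄ : inducedMetric g.tensor i (γ s) (Ξ (γ s)) (Ξ (γ s)) = 1 := o 1 1
  rw [o₁, o₂, o₃, o₄] at h
  linarith

variable {k c₁ c₂ : ℝ} (hk : ∀ p, κ p = k) (hI : IsOpen I) (hγ : ContMDiffOn 𝓘(ℝ, ℝ) (𝓡 2) ∞ γ I)
  (hv : ∀ s ∈ I, velocity γ s = c₂ • E₁ (γ s) + c₁ • Ξ (γ s))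
include hI hγ

omit hM hξ in
lemma contMDiffAt_comp {s : ℝ} (hs : s ∈ I) :
    ContMDiffAt 𝓘(ℝ, ℝ) (𝓡 3) ∞ (fun s => i (γ s)) s :=
  (hF.smooth (γ s)).comp s (hγ.contMDiffAt (hI.mem_nhds hs))

omit hξ in
lemma smoothAlongNear_curve {V : (s : ℝ) → TangentSpace (𝓡 3) (i (γ s))} {a b d : ℝ}
    (hV : ∀ s ∈ I, V s = a • e (γ s) + b • φ (i (γ s)) (e (γ s)) + d • ξ (i (γ s))) {s : ℝ}
    (hs : s ∈ I) : SmoothAlongNear ℝ (fun s => i (γ s)) V s := by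
  refine SmoothAlongNear.congr (V := fun s =>
    a • e (γ s) + b • φ (i (γ s)) (e (γ s)) + d • ξ (i (γ s))) ?_ ?_
  · filter_upwards [hI.mem_nhds hs] with s' hs'
    exact SmoothAlongAt.comp (k := γ) (hF.smoothAlongNear_combination hM (smoothNear_const a)
      (smoothNear_const b) (smoothNear_const d)).self (hγ.contMDiffAt (hI.mem_nhds hs'))
  · filter_upwards [hI.mem_nhds hs] with s' hs' using (hV s' hs').symm

include hv

omit hM hξ in
lemma velocity_comp {s : ℝ} (hs : s ∈ I) :
    velocity (fun s => i (γ s)) s = c₂ • e (γ s) + c₁ • ξ (i (γ s)) := by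
  have h1 : velocity (fun s => i (γ s)) s = mfderiv (𝓡 2) (𝓡 3) i (γ s) (velocity γ s) :=
    mfderiv_comp_apply s ((hF.smooth (γ s)).mdifferentiableAt (by simp))
      ((hγ.contMDiffAt (hI.mem_nhds hs)).mdifferentiableAt (by simp)) (1 : ℝ)
  rw [h1, hv s hs, map_add, map_smul, map_smul, hF.mfderiv_E₁, hF.mfderiv_Ξ]

include hk

/-- For constant κ the frame equations along γ have constant coefficients. The result has the same
shape as the input on all of I, so the formula can be iterated. -/
lemma covAlong_curve {V : (s : ℝ) → TangentSpace (𝓡 3) (i (γ s))} {a b d : ℝ}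
    (hV : ∀ s ∈ I, V s = a • e (γ s) + b • φ (i (γ s)) (e (γ s)) + d • ξ (i (γ s))) {s : ℝ}
    (hs : s ∈ I) :
    covAlong g.tensor (fun s => i (γ s)) V s (1 : ℝ) =
      (b * (c₁ - c₂ * k)) • e (γ s) + (c₂ * (a * k - d) - c₁ * a) • φ (i (γ s)) (e (γ s)) +
        (c₂ * b) • ξ (i (γ s)) := by
  have hg := g.isRiemannian
  have ha : SmoothNear (Euc 2) (fun _ : S => a) (γ s) := smoothNear_const a
  have hb : SmoothNear (Euc 2) (fun _ : S => b) (γ s) := smoothNear_const b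
  have hd : SmoothNear (Euc 2) (fun _ : S => d) (γ s) := smoothNear_const d
  have h1 : covAlong g.tensor (fun s => i (γ s)) V s (1 : ℝ) =
      covAlong g.tensor i (fun p => a • e p + b • φ (i p) (e p) + d • ξ (i p)) (γ s)
        (velocity γ s) :=
    (covAlong_congr (by filter_upwards [hI.mem_nhds hs] with s' hs' using hV s' hs') _).trans
      (covAlong_comp (k := γ) (hF.smoothAlongNear_combination hM ha hb hd).self
        ((hγ.contMDiffAt (hI.mem_nhds hs)).mdifferentiableAt (by simp)) _)
  rw [h1, hv s hs, covAlong_map_add hg, covAlong_map_smul hg, covAlong_map_smul hg,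
    hF.covAlong_combination_E₁ hM hξ ha hb hd, hF.covAlong_combination_Ξ hM hξ ha hb hd,
    mvfderiv_const, mvfderiv_const, mvfderiv_const, hk]
  simp only [zero_apply]
  module

lemma tension_curve_eq {s : ℝ} (hs : s ∈ I) :
    tension lineMetric g.tensor (fun s => i (γ s)) s =
      (c₂ * (c₂ * k - 2 * c₁)) • φ (i (γ s)) (e (γ s)) := by
  have hf : ∀ᶠ s' in 𝓝 s, ContMDiffAt 𝓘(ℝ, ℝ) (𝓡 3) ∞ (fun s => i (γ s)) s' := by
    filter_upwards [hI.mem_nhds hs] with s' hs' using hF.contMDiffAt_comp hI hγ hs'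
  rw [tension_curve g.isRiemannian hf, hF.covAlong_curve hM hξ hk hI hγ hv (a := c₂) (b := 0)
    (d := c₁) (fun s hs => by rw [hF.velocity_comp hI hγ hv hs, zero_smul, add_zero]) hs]
  module

omit hM hξ in
-- With A = c₂(c₂k - 2c₁), the second derivative contributes -A((c₂k - c₁)² + c₂²) and the curvature
-- A(c₁² + c c₂²). For c = k² + 1 the squares cancel and the cross term 2c₁c₂k remains.
lemma bitension_curve_eq {c : ℝ} (hM : IsSasakianSpaceForm φ ξ η g c)
    (hξ : ∀ x u, nabla g.tensor ξ x u = -φ x u) (hkc : k ^ 2 = c - 1) {s : ℝ} (hs : s ∈ I) :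
    bitension lineMetric g.tensor (fun s => i (γ s)) s =
      (2 * c₁ * c₂ ^ 2 * (c₂ * k - 2 * c₁) * k) • φ (i (γ s)) (e (γ s)) := by
  have hC := hM.toIsContactMetric
  have hg := g.isRiemannian
  have ht : ∀ s ∈ I, tension lineMetric g.tensor (fun s => i (γ s)) s =
      (0 : ℝ) • e (γ s) + (c₂ * (c₂ * k - 2 * c₁)) • φ (i (γ s)) (e (γ s)) +
        (0 : ℝ) • ξ (i (γ s)) := fun s hs => by
    rw [hF.tension_curve_eq hC hξ hk hI hγ hv hs, zero_smul, zero_smul, zero_add, add_zero]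
  have h1 := fun s (hs : s ∈ I) => hF.covAlong_curve hC hξ hk hI hγ hv ht hs
  have hR := hM.curvature_φ hξ (hF.unit (γ s)) (hF.horizontal (γ s)) c₁ c₂
  rw [bitension_curve hg (hF.smoothAlongNear_curve hC hI hγ ht hs),
    hF.covAlong_curve hC hξ hk hI hγ hv h1 hs, hF.tension_curve_eq hC hξ hk hI hγ hv hs,
    hF.velocity_comp hI hγ hv hs, curvature_smul_mid hg, add_comm (c₂ • e (γ s)), hR,
    show c = k ^ 2 + 1 by linarith]
  module

end IsHopfFrame

end HopfGeodesic

/-! ### Constancy of the curvature of the base curve -/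

section HopfCylinder

variable {M : Type*} [TopologicalSpace M] [ChartedSpace (Euc 3) M] [IsManifold (𝓡 3) ∞ M]
  {N : Type*} [TopologicalSpace N] [ChartedSpace (Euc 2) N] [IsManifold (𝓡 2) ∞ N]
  {C : Type*} [TopologicalSpace C] [ChartedSpace ℝ C] [IsManifold 𝓘(ℝ, ℝ) ∞ C]
  {S : Type*} [TopologicalSpace S] [ChartedSpace (Euc 2) S] [IsManifold (𝓡 2) ∞ S]
  {φ : (x : M) → TangentSpace (𝓡 3) x →L[ℝ] TangentSpace (𝓡 3) x}
  {ξ : (x : M) → TangentSpace (𝓡 3) x} {η : (x : M) → TangentSpace (𝓡 3) x →L[ℝ] ℝ}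
  {g : SmoothMetric (Euc 3) M} {h : SmoothMetric (Euc 2) N}
  {J : (y : N) → TangentSpace (𝓡 2) y →L[ℝ] TangentSpace (𝓡 2) y} {π : M → N}
  {D : (t : C) → TangentSpace 𝓘(ℝ, ℝ) t} {β : C → N} {q : S → C} {i : S → M}

/-- The base curve of a proper-biharmonic Hopf cylinder has constant curvature `κ` with
`κ² = c - 1`. -/
theorem exists_curveCurvature_eq [PreconnectedSpace C] {c : ℝ}
    (hM : IsSasakianSpaceForm φ ξ η g c) (hπ : IsOrbitFibration φ ξ η g h J π)
    (hS : IsHopfCylinder π β q i) (hβ : IsArcLengthCurve h D β)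
    (hbih : IsProperBiharmonicOn (inducedMetric g.tensor i : MetricTensor (Euc 2) S) g.tensor i
      Set.univ) :
    ∃ k : ℝ, k ^ 2 = c - 1 ∧ ∀ t, curveCurvature h J D β t = k := by
  have hC := hM.toIsContactMetric
  have hξ := hπ.nabla_ξ hC
  obtain ⟨E₁, Ξ, hF, hq⟩ := exists_isHopfFrame hC hπ hS hβ
  have hsurj : Function.Surjective q := fun t => by
    obtain ⟨x, hx⟩ := hπ.surjective (β t)
    obtain ⟨p, hp, -⟩ := hS.fibre_product t x hx.symm
    exact ⟨p, hp.1⟩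
  have hroot := hF.curvature_of_biharmonic hM hξ fun p => hbih.1 p (Set.mem_univ p)
  -- The curvature is known to be smooth only after composition with q. Since q is a submersion,
  -- neighbourhoods of q p are images of neighbourhoods of p, and continuity descends to C.
  have hcont : Continuous (curveCurvature h J D β) := by
    rw [continuous_iff_continuousAt]
    intro t
    obtain ⟨p, rfl⟩ := hsurj t
    have hs : Function.Surjective (mfderiv (𝓡 2) 𝓘(ℝ, ℝ) q p) := fun w => by
      obtain ⟨a, ha⟩ := exists_eq_smul_D hβ (q p) w
      exact ⟨a • E₁ p, by rw [map_smul, hq, ha]⟩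
    rw [ContinuousAt, ← map_nhds_eq_of_surjective_mfderiv (hS.smooth_q p) hs, tendsto_map'_iff]
    exact (hF.smoothNear_κ hC p).self_of_nhds.continuousAt
  have hfin : (Set.range (curveCurvature h J D β)).Finite := by
    refine Set.Finite.subset (s := {0, Real.sqrt (c - 1), -Real.sqrt (c - 1)}) (by simp) ?_
    rintro _ ⟨t, rfl⟩
    obtain ⟨p, rfl⟩ := hsurj t
    rcases mul_eq_zero.1 (hroot p) with h0 | h0
    · exact Or.inl h0
    · right
      have h1 : curveCurvature h J D β (q p) ^ 2 = c - 1 := by linarith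
      rw [← h1, Real.sqrt_sq_eq_abs]
      rcases abs_choice (curveCurvature h J D β (q p)) with h2 | h2
      · exact Or.inl h2.symm
      · exact Or.inr (Set.mem_singleton_iff.2 (by linarith))
  have hconst := eq_of_continuous_of_finite_range hcont hfin
  -- The tension is κφe, so a point where it does not vanish excludes the root κ = 0.
  obtain ⟨p, hp⟩ := not_forall.1 hbih.2
  have hp0 : curveCurvature h J D β (q p) ≠ 0 := fun h0 => hp fun _ => by
    rw [congrFun (hF.tension_eq hC hξ) p, h0, zero_smul]
  refine ⟨curveCurvature h J D β (q p), ?_, fun t => hconst _ _⟩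
  rcases mul_eq_zero.1 (hroot p) with h0 | h0
  · exact absurd h0 hp0
  · linarith

end HopfCylinder

end BiharmonicHopf

/-! ### Proper-biharmonic geodesics of a proper-biharmonic Hopf cylinder -/

open BiharmonicHopf in
theorem mainTheorem3
    {M : Type*} [TopologicalSpace M] [T2Space M] [ChartedSpace (Euc 3) M] [IsManifold (𝓡 3) ∞ M]
    {N : Type*} [TopologicalSpace N] [T2Space N] [ChartedSpace (Euc 2) N] [IsManifold (𝓡 2) ∞ N]
    {C : Type*} [TopologicalSpace C] [T2Space C] [ConnectedSpace C] [ChartedSpace ℝ C]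
    [IsManifold 𝓘(ℝ, ℝ) ∞ C]
    {S : Type*} [TopologicalSpace S] [T2Space S] [ChartedSpace (Euc 2) S] [IsManifold (𝓡 2) ∞ S]
    (φ : (x : M) → TangentSpace (𝓡 3) x →L[ℝ] TangentSpace (𝓡 3) x)
    (ξ : (x : M) → TangentSpace (𝓡 3) x) (η : (x : M) → TangentSpace (𝓡 3) x →L[ℝ] ℝ)
    (g : SmoothMetric (Euc 3) M) (c : ℝ)
    (hM : IsSasakianSpaceForm φ ξ η g c) (hc : 1 < c)
    (h : SmoothMetric (Euc 2) N)
    (J : (y : N) → TangentSpace (𝓡 2) y →L[ℝ] TangentSpace (𝓡 2) y) (π : M → N)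
    (hπ : IsOrbitFibration φ ξ η g h J π)
    (D : (t : C) → TangentSpace 𝓘(ℝ, ℝ) t) (β : C → N) (hβ : IsArcLengthCurve h D β)
    (q : S → C) (i : S → M) (hS : IsHopfCylinder π β q i)
    (hbih : IsProperBiharmonicOn (inducedMetric g.tensor i : MetricTensor (Euc 2) S) g.tensor i
      Set.univ)
    (I : Set ℝ) (hI : IsOpen I) (hI_conn : I.OrdConnected) (hI_ne : I.Nonempty)
    (γ : ℝ → S)
    (hγ : IsUnitSpeedGeodesicOn (inducedMetric g.tensor i : MetricTensor (Euc 2) S) γ I) :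
    (IsProperBiharmonicOn lineMetric g.tensor (fun s => i (γ s)) I ↔
      ((∀ s ∈ I, velocity (fun s => i (γ s)) s = lift₁ η π D β q i (γ s)) ∨
        (∀ s ∈ I, velocity (fun s => i (γ s)) s = -lift₁ η π D β q i (γ s)))) ∧
    ∃ κ c₁ c₂ : ℝ, κ ^ 2 = c - 1 ∧ (∀ t, curveCurvature h J D β t = κ) ∧ c₁ ^ 2 + c₂ ^ 2 = 1 ∧
      ∀ s ∈ I,
        velocity (fun s => i (γ s)) s = c₁ • ξ (i (γ s)) + c₂ • lift₁ η π D β q i (γ s) ∧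
        tension lineMetric g.tensor (fun s => i (γ s)) s
          = (c₂ * (c₂ * κ - 2 * c₁)) • lift₂ η π J D β q i (γ s) ∧
        bitension lineMetric g.tensor (fun s => i (γ s)) s
          = (2 * c₁ * c₂ ^ 2 * (c₂ * κ - 2 * c₁) * κ) • lift₂ η π J D β q i (γ s) := by
  have hC := hM.toIsContactMetric
  have hξ := hπ.nabla_ξ hC
  obtain ⟨k, hkc, hk⟩ := exists_curveCurvature_eq hM hπ hS hβ hbih
  obtain ⟨E₁, Ξ, hF, -⟩ := exists_isHopfFrame hC hπ hS hβ
  have hk' : ∀ p, curveCurvature h J D β (q p) = k := fun p => hk (q p)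
  obtain ⟨c₁, c₂, hc₁₂, hv⟩ := hF.exists_velocity_eq hC hξ hI hI_conn hI_ne hγ
  have hvel := fun s (hs : s ∈ I) => hF.velocity_comp hI hγ.smooth hv hs
  have hτ := fun s (hs : s ∈ I) => hF.tension_curve_eq hC hξ hk' hI hγ.smooth hv hs
  have hτ₂ := fun s (hs : s ∈ I) => hF.bitension_curve_eq hk' hI hγ.smooth hv hM hξ hkc hs
  -- This is where c > 1 enters: k = 0 would give c = 1.
  have hk0 : k ≠ 0 := by
    rintro rfl
    linarith
  obtain ⟨s₀, hs₀⟩ := hI_ne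
  refine ⟨⟨fun ⟨h₂, h₁⟩ => ?_, fun hd => ?_⟩, k, c₁, c₂, hkc, hk, hc₁₂, fun s hs => ⟨?_, ?_, ?_⟩⟩
  · have hA : c₂ * (c₂ * k - 2 * c₁) ≠ 0 := fun hA => h₁ fun s hs => by
      rw [hτ s hs, hA, zero_smul]
    have h0 := hF.eq_zero_of_smul_φ_e hC ((hτ₂ s₀ hs₀).symm.trans (h₂ s₀ hs₀))
    have hc₁ : c₁ = 0 := by
      -- The bitension coefficient is regrouped around the nonzero tension coefficient; c₁ is the
      -- only factor left that can vanish.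
      have h3 : 2 * (c₂ * (c₂ * k - 2 * c₁)) * c₂ * k * c₁ = 0 := by linear_combination h0
      have hc₂ : c₂ ≠ 0 := left_ne_zero_of_mul hA
      simpa [hA, hc₂, hk0] using h3
    rw [hc₁] at hc₁₂ hvel
    have hc₂ : (c₂ - 1) * (c₂ + 1) = 0 := by linear_combination hc₁₂
    rcases mul_eq_zero.1 hc₂ with h3 | h3
    · left
      intro s hs
      rw [hvel s hs, show c₂ = 1 by linarith, one_smul, zero_smul, add_zero]
    · right
      intro s hs
      rw [hvel s hs, show c₂ = -1 by linarith, neg_smul, one_smul, zero_smul, add_zero]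
  · have hc₁ : c₁ = 0 := by
      have h3 : ∃ a : ℝ, velocity (fun s => i (γ s)) s₀ = a • lift₁ η π D β q i (γ s₀) := by
        rcases hd with hd | hd
        · exact ⟨1, by rw [hd s₀ hs₀, one_smul]⟩
        · exact ⟨-1, by rw [hd s₀ hs₀, neg_smul, one_smul]⟩
      obtain ⟨a, ha⟩ := h3
      -- Applying η annihilates the lift and isolates the component c₁ along ξ.
      have h4 := congrArg (η (i (γ s₀))) ((hvel s₀ hs₀).symm.trans ha)
      rw [map_add, map_smul, map_smul, map_smul, hF.horizontal, hC.η_ξ] at h4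
      simpa using h4
    rw [hc₁] at hc₁₂ hτ hτ₂
    have hc₂ : c₂ ^ 2 = 1 := by linear_combination hc₁₂
    refine ⟨fun s hs => ?_, fun h0 => hk0 ?_⟩
    · rw [hτ₂ s hs, mul_zero, zero_mul, zero_mul, zero_mul, zero_smul]
    -- For c₁ = 0 the tension coefficient is c₂²k = k, so a vanishing tension would contradict k ≠
    -- 0.
    · have h3 := hF.eq_zero_of_smul_φ_e hC ((hτ s₀ hs₀).symm.trans (h0 s₀ hs₀))
      linear_combination h3 - k * hc₂
  · rw [hvel s hs, add_comm]
  · rw [hτ s hs, lift₂_eq hC hπ hS]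
  · rw [hτ₂ s hs, lift₂_eq hC hπ hS]
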